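/- **Theorem.** Write $\langle v\rangle=\sqrt{1+|v|^2}$, $\|f\|_{L^3_{-5/3}(\mathbb R^3)}=\bigl(\int_{\mathbb R^3}|f(v)|^3\langle v\rangle^{-5}\,dv\bigr)^{1/3}\in[0,\infty]$ and $a_{ij}(z)=\frac1{|z|}\bigl(\delta_{ij}-\frac{z_iz_j}{|z|^2}\bigr)$. Let $m_0>0$ and $M_0,E_0,H_0\in\mathbb R$. There is a constant $c_1>0$, depending only on $m_0,M_0,E_0,H_0$, such that the following holds. Let $f:\mathbb R^3\to[0,\infty)$ be locally integrable with locally integrable weak gradient $\nabla f$ (in particular, $f$ may be the velocity profile $f(t,x,\cdot)$ of such regularity, at a fixed time $t$ and position $x$, of a solution of the Landau–Coulomb equation), and suppose that $f$, $f|v|^2$ and $f\log f$ are integrable with $$ m_0\le\int_{\mathbb R^3} f\,dv\le M_0,\qquad \int_{\mathbb R^3} f|v|^2\,dv\le E_0,\qquad \int_{\mathbb R^3} f\log f\,dv\le H_0 .$$ Then the Landau–Coulomb entropy dissipation $$D(f)=\frac12\iint_{\mathbb R^3\times\mathbb R^3}\sum_{i,j=1}^3 a_{ij}(v-w)\,f(v)f(w)\Bigl(\frac{\partial_if(v)}{f(v)}-\frac{\partial_if(w)}{f(w)}\Bigr)\Bigl(\frac{\partial_jf(v)}{f(v)}-\frac{\partial_jf(w)}{f(w)}\Bigr)\,dv\,dw\in[0,\infty]$$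 (the integrand being read as $0$ where $f(v)f(w)=0$) satisfies $$D(f)\ \ge\ c_1\,\|f\|_{L^3_{-5/3}(\mathbb R^3)}-20M_0^2 ;$$ in particular, if $D(f)<\infty$, then the norm on the right is finite. -/

import Mathlib

open MeasureTheory
open scoped ENNReal ContDiff

/-- Velocity space `ℝ³` with its Euclidean norm. -/
abbrev Vel : Type := EuclideanSpace ℝ (Fin 3)

/-- The Japanese bracket `⟨v⟩ = √(1 + |v|²)`. -/
noncomputable def japaneseBracket (v : Vel) : ℝ := Real.sqrt (1 + ‖v‖ ^ 2)

/-- The weighted Lebesgue norm `‖f‖_{L^p_{-q}(ℝ³)} = (∫ |f(v)|^p ⟨v⟩^{-pq} dv)^{1/p}`,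
with values in `[0, ∞]`. -/
noncomputable def weightedNorm (p q : ℝ) (f : Vel → ℝ) : ℝ≥0∞ :=
  (∫⁻ v : Vel, ENNReal.ofReal (|f v| ^ p * japaneseBracket v ^ (-(p * q)))) ^ (1 / p)

/-- The Coulomb coefficient matrix `a_{ij}(z) = |z|⁻¹ (δ_{ij} - z_i z_j / |z|²)`. -/
noncomputable def coulombMatrix (z : Vel) (i j : Fin 3) : ℝ :=
  ‖z‖⁻¹ * ((if i = j then 1 else 0) - z i * z j / ‖z‖ ^ 2)

/-- `f` and `G` are locally integrable and `G = ∇f` in the sense of distributions. -/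
structure IsWeakGradient (f : Vel → ℝ) (G : Vel → Vel) : Prop where
  locallyIntegrable : LocallyIntegrable f volume
  locallyIntegrable_grad : LocallyIntegrable G volume
  integral_eq : ∀ φ : Vel → ℝ, ContDiff ℝ ∞ φ → HasCompactSupport φ → ∀ i : Fin 3,
    ∫ v : Vel, f v * fderiv ℝ φ v (EuclideanSpace.single i 1) = -∫ v : Vel, G v i * φ v

/-- The entropy dissipation of the Landau-Coulomb equation,
`½ ∬ a_{ij}(v-w) f(v) f(w) (∂ᵢf(v)/f(v) - ∂ᵢf(w)/f(w)) (∂ⱼf(v)/f(v) - ∂ⱼf(w)/f(w)) dv dw`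
(summed over `i`, `j`), where `G = ∇f`. For `f ≥ 0` the integrand is nonnegative, so the value
is an element of `[0, ∞]`; the integrand is zero where `f v = 0` or `f w = 0`. -/
noncomputable def entropyDissipation (f : Vel → ℝ) (G : Vel → Vel) : ℝ≥0∞ :=
  ∫⁻ x : Vel × Vel, ENNReal.ofReal (1 / 2 * ∑ i : Fin 3, ∑ j : Fin 3,
    coulombMatrix (x.1 - x.2) i j * (f x.1 * f x.2) *
      (G x.1 i / f x.1 - G x.2 i / f x.2) * (G x.1 j / f x.1 - G x.2 j / f x.2))

/-- `f ≥ 0` has mass between `m₀` and `M₀`, energy at most `E₀` and entropy at most `H₀`, all three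
quantities being given by convergent integrals. -/
structure HydrodynamicBounds (m₀ M₀ E₀ H₀ : ℝ) (f : Vel → ℝ) : Prop where
  nonneg : ∀ v, 0 ≤ f v
  integrable_mass : Integrable f volume
  le_mass : m₀ ≤ ∫ v : Vel, f v
  mass_le : ∫ v : Vel, f v ≤ M₀
  integrable_energy : Integrable (fun v : Vel => f v * ‖v‖ ^ 2) volume
  energy_le : ∫ v : Vel, f v * ‖v‖ ^ 2 ≤ E₀
  integrable_entropy : Integrable (fun v : Vel => f v * Real.log (f v)) volume
  entropy_le : ∫ v : Vel, f v * Real.log (f v) ≤ H₀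

/-!
Write `b = ∇f / f` and let `d(v) = ∫ f(w) |z|⁻³ (|z|² |Δ|² - ⟪z, Δ⟫²) dw`, with `z = v - w` and
`Δ = b(v) - b(w)`, be the density for which the entropy dissipation is `D = ½ ∫ f d`. The proof has
two halves.

*A weighted Fisher information is controlled by the dissipation.* For a test function `ψ`, integrate
the bivector `z ∧ Δ` against `f(w) ψ(w)` in the variable `w`: an integration by parts removes the
derivatives at `w`, so `(v m - m') ∧ b(v)`, with `m = ∫ f ψ` and `m' = ∫ f ψ w`, is known up to terms
without derivatives and up to `d(v)`, by the Cauchy–Schwarz inequality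
(`IsWeakGradient.sq_wedge_le`). Take for `ψ` a cutoff, and the cutoff times the coordinate
`⟪w, e⟫ - s` centred at its mean. The bounds on mass, energy and entropy keep half of the mass in a fixed
ball and at most a quarter in any thin slab (`exists_spread_of_hydrodynamicBounds`), so these moments
are nondegenerate in every direction `e`, and `|b|²` and `|v ∧ b|²` at `v` are both at most
`C (⟨v⟩² + ⟨v⟩³ d(v))` (`exists_gradientBound_logGrad`). Hence `J = C f (⟨v⟩² + ⟨v⟩³ d)` satisfies
`|∇f|² ≤ f J`, `|v ∧ ∇f|² ≤ f J` and `∫ ⟨v⟩⁻³ J ≤ C (M₀ + 2 D)`. The second pointwise bound says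
that tangential derivatives are smaller than radial ones by a factor `|v|`.

*An anisotropic Sobolev inequality.* Such a `J` forces `∫ ⟨v⟩⁻⁵ f³ ≤ C (∫ ⟨v⟩⁻³ (J + f))³`. On the
cone of directions where one coordinate dominates, use the two other coordinates and the distance
`r` to a point on the axis outside the cone as coordinates. Moving one of the two flat coordinates at
fixed `r` is tangential and moving `r` is radial, so the derivatives of `f² r⁻³`, `f² r⁻³` and
`f² r⁻⁴`, suitably cut off, are all bounded by one density `r⁻⁴ f^{3/2} (J + f)^{1/2}`, and the
Loomis–Whitney inequality bounds the integral of the geometric mean `f³ r⁻⁵` by the power `3/2` of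
the integral of that density (`lintegral_verticalCone_le_rpow`). The Cauchy–Schwarz inequality splits
the density into `(⟨v⟩⁻⁵ f³)^{1/2}` and `(⟨v⟩⁻³ (J + f))^{1/2}`, and six cones cover the space; the
powers are such that the left side, if finite, can be absorbed
(`lintegral_weightedCube_le_weightedEnergy`). Mollified functions are smooth, inherit the gradient
bounds with an averaged `J`, and have a finite left side, so Fatou's lemma gives the general case
(`IsWeakGradient.lintegral_weightedCube_le`).

Together these give `‖f‖ ≤ C (M₀ + D)`. Multiplying by a small constant `c₁` makes the error
`c₁ C M₀` at most `20 M₀²`, since `M₀ ≥ m₀ > 0`.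
-/

open Filter Topology
open scoped RealInnerProductSpace

/-! ### Mollification of weakly differentiable functions -/

/-- The smooth bumps of radius `1 / (n + 1)` used as mollifiers. -/
noncomputable def shrinkingBump (n : ℕ) : ContDiffBump (0 : Vel) where
  rIn := 1 / (2 * (n + 1))
  rOut := 1 / (n + 1)
  rIn_pos := by positivity
  rIn_lt_rOut := by
    apply one_div_lt_one_div_of_lt (by positivity)
    have : (0 : ℝ) ≤ n := by positivity
    linarith

/-- The mollification `ρ ∗ f`, where `ρ` is a bump normalized to have integral one. -/
noncomputable def mollify (ρ : ContDiffBump (0 : Vel)) (f : Vel → ℝ) (v : Vel) : ℝ :=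
  ∫ u, ρ.normed volume (v - u) * f u

lemma shrinkingBump_rOut_le (n : ℕ) : (shrinkingBump n).rOut ≤ 1 := by
  change 1 / ((n : ℝ) + 1) ≤ 1
  rw [div_le_one (by positivity)]
  have : (0 : ℝ) ≤ n := by positivity
  linarith

lemma tendsto_shrinkingBump_rOut :
    Tendsto (fun n => (shrinkingBump n).rOut) atTop (𝓝 0) :=
  tendsto_one_div_add_atTop_nhds_zero_nat

lemma mollify_eq_convolution (ρ : ContDiffBump (0 : Vel)) (f : Vel → ℝ) :
    mollify ρ f = convolution (ρ.normed volume) f (ContinuousLinearMap.lsmul ℝ ℝ) volume := by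
  ext v
  rw [convolution_lsmul_swap]
  rfl

lemma ae_tendsto_mollify {f : Vel → ℝ} (hf : LocallyIntegrable f volume) :
    ∀ᵐ v : Vel, Tendsto (fun n => mollify (shrinkingBump n) f v) atTop (𝓝 (f v)) := by
  simp_rw [mollify_eq_convolution]
  refine ContDiffBump.ae_convolution_tendsto_right_of_locallyIntegrable (K := 2)
    tendsto_shrinkingBump_rOut (Eventually.of_forall fun n => ?_) hf
  change 1 / ((n : ℝ) + 1) ≤ 2 * (1 / (2 * (n + 1)))
  apply le_of_eq
  field_simp

lemma contDiff_mollify (ρ : ContDiffBump (0 : Vel)) {f : Vel → ℝ}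
    (hf : LocallyIntegrable f volume) : ContDiff ℝ ∞ (mollify ρ f) := by
  rw [mollify_eq_convolution]
  exact ρ.hasCompactSupport_normed.contDiff_convolution_left _ ρ.contDiff_normed hf

lemma integrable_mollify (ρ : ContDiffBump (0 : Vel)) {f : Vel → ℝ}
    (hf : Integrable f volume) : Integrable (mollify ρ f) volume := by
  rw [mollify_eq_convolution]
  exact ρ.integrable_normed.integrable_convolution _ hf

lemma integral_mollify (ρ : ContDiffBump (0 : Vel)) {f : Vel → ℝ}
    (hf : Integrable f volume) : ∫ v, mollify ρ f v = ∫ v, f v := by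
  rw [mollify_eq_convolution, integral_convolution _ ρ.integrable_normed hf, ρ.integral_normed]
  simp

lemma integrable_normed_mul (ρ : ContDiffBump (0 : Vel)) {f : Vel → ℝ}
    (hf : LocallyIntegrable f volume) (v : Vel) :
    Integrable (fun u => ρ.normed volume (v - u) * f u) volume := by
  refine hf.integrable_smul_left_of_hasCompactSupport (g := fun u => ρ.normed volume (v - u)) ?_ ?_
  · exact ρ.continuous_normed.comp (by fun_prop)
  · exact ρ.hasCompactSupport_normed.comp_homeomorph (Homeomorph.subLeft v)

lemma mollify_nonneg (ρ : ContDiffBump (0 : Vel)) {f : Vel → ℝ} (hf : ∀ v, 0 ≤ f v) (v : Vel) :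
    0 ≤ mollify ρ f v :=
  integral_nonneg fun u => mul_nonneg (ρ.nonneg_normed _) (hf u)

lemma normed_eq_zero (ρ : ContDiffBump (0 : Vel)) {v : Vel} (hv : ρ.rOut ≤ ‖v‖) :
    ρ.normed volume v = 0 := by
  have h : v ∉ Function.support (ρ.normed (volume : Measure Vel)) := by
    rw [ρ.support_normed_eq]
    simpa using hv
  simpa using h

lemma IsWeakGradient.integral_mul_fderiv {f : Vel → ℝ} {G : Vel → Vel} (h : IsWeakGradient f G)
    {φ : Vel → ℝ} (hφ : ContDiff ℝ ∞ φ) (hc : HasCompactSupport φ) (e : Vel) :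
    ∫ v : Vel, f v * fderiv ℝ φ v e = -∫ v : Vel, ⟪G v, e⟫ * φ v := by
  have he : e = ∑ i : Fin 3, e i • EuclideanSpace.single i (1 : ℝ) := by
    have := (EuclideanSpace.basisFun (Fin 3) ℝ).sum_repr e
    simpa using this.symm
  have hGφ : Integrable (fun v => φ v • G v) volume :=
    h.locallyIntegrable_grad.integrable_smul_left_of_hasCompactSupport hφ.continuous hc
  have hGi (i : Fin 3) : Integrable (fun v => G v i * φ v) volume := by
    have := hGφ.inner_const (𝕜 := ℝ) (EuclideanSpace.single i (1 : ℝ))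
    refine this.congr (Eventually.of_forall fun v => ?_)
    simp [EuclideanSpace.inner_single_right, mul_comm]
  have hfi (i : Fin 3) :
      Integrable (fun v => f v * fderiv ℝ φ v (EuclideanSpace.single i 1)) volume := by
    refine h.locallyIntegrable.integrable_smul_right_of_hasCompactSupport
      (g := fun v => fderiv ℝ φ v (EuclideanSpace.single i 1)) ?_ ?_
    · have := hφ.continuous_fderiv (by simp)
      fun_prop
    · exact hc.fderiv_apply ℝ _
  have h1 (v : Vel) : f v * fderiv ℝ φ v e
      = ∑ i : Fin 3, e i * (f v * fderiv ℝ φ v (EuclideanSpace.single i 1)) := by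
    conv_lhs => rw [he]
    rw [map_sum, Finset.mul_sum]
    refine Finset.sum_congr rfl fun i _ => ?_
    rw [map_smul, smul_eq_mul]
    ring
  have h2 (v : Vel) : ⟪G v, e⟫ * φ v = ∑ i : Fin 3, e i * (G v i * φ v) := by
    rw [PiLp.inner_apply, Finset.sum_mul]
    refine Finset.sum_congr rfl fun i _ => ?_
    simp
    ring
  simp_rw [h1, h2]
  rw [integral_finsetSum _ fun i _ => (hfi i).const_mul _,
    integral_finsetSum _ fun i _ => (hGi i).const_mul _, ← Finset.sum_neg_distrib]
  refine Finset.sum_congr rfl fun i _ => ?_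
  rw [integral_const_mul, integral_const_mul, h.integral_eq φ hφ hc i]
  ring

lemma IsWeakGradient.locallyIntegrable_inner {f : Vel → ℝ} {G : Vel → Vel}
    (h : IsWeakGradient f G) (e : Vel) : LocallyIntegrable (fun v => ⟪G v, e⟫) volume := by
  intro x
  obtain ⟨s, hs, hi⟩ := h.locallyIntegrable_grad x
  exact ⟨s, hs, hi.inner_const (𝕜 := ℝ) e⟩

/-- Mollification commutes with weak differentiation. -/
lemma IsWeakGradient.fderiv_mollify {f : Vel → ℝ} {G : Vel → Vel} (h : IsWeakGradient f G)
    (ρ : ContDiffBump (0 : Vel)) (v e : Vel) :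
    fderiv ℝ (mollify ρ f) v e = mollify ρ (fun u => ⟪G u, e⟫) v := by
  have hρ : ContDiff ℝ 1 (ρ.normed (volume : Measure Vel)) := ρ.contDiff_normed
  have hcont : Continuous (fderiv ℝ (ρ.normed (volume : Measure Vel))) :=
    hρ.continuous_fderiv one_ne_zero
  have key : HasFDerivAt (mollify ρ f)
      ((convolution f (fderiv ℝ (ρ.normed volume))
        ((ContinuousLinearMap.lsmul ℝ ℝ).precompR Vel) volume) v) v := by
    have h2 : mollify ρ f = convolution f (ρ.normed volume)
        (ContinuousLinearMap.lsmul ℝ ℝ) volume := by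
      ext w
      rw [convolution_lsmul]
      simp [mollify, mul_comm]
    rw [h2]
    exact ρ.hasCompactSupport_normed.hasFDerivAt_convolution_right _ h.locallyIntegrable hρ v
  rw [key.fderiv, convolution_precompR_apply _ h.locallyIntegrable
    (ρ.hasCompactSupport_normed.fderiv ℝ) hcont, convolution_lsmul]
  have hφ : ContDiff ℝ ∞ (fun u => ρ.normed (volume : Measure Vel) (v - u)) := by
    have : ContDiff ℝ ∞ (ρ.normed (volume : Measure Vel)) := ρ.contDiff_normed
    exact this.comp (by fun_prop)
  have hc : HasCompactSupport (fun u => ρ.normed (volume : Measure Vel) (v - u)) :=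
    ρ.hasCompactSupport_normed.comp_homeomorph (Homeomorph.subLeft v)
  have hd (u : Vel) : fderiv ℝ (fun u => ρ.normed (volume : Measure Vel) (v - u)) u e
      = -fderiv ℝ (ρ.normed (volume : Measure Vel)) (v - u) e := by
    have h1 : HasFDerivAt (fun u => ρ.normed (volume : Measure Vel) (v - u))
        ((fderiv ℝ (ρ.normed (volume : Measure Vel)) (v - u)).comp
          (-ContinuousLinearMap.id ℝ Vel)) u := by
      refine HasFDerivAt.comp u
        ((hρ.differentiable one_ne_zero).differentiableAt.hasFDerivAt) ?_
      exact (hasFDerivAt_id u).const_sub v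
    rw [h1.fderiv]
    simp
  have h3 := h.integral_mul_fderiv hφ hc e
  simp_rw [hd] at h3
  simp only [mul_neg, integral_neg, neg_inj] at h3
  simp only [smul_eq_mul, mollify]
  rw [h3]
  simp_rw [mul_comm]

/-- A form of Scheffé's lemma. -/
lemma tendsto_integral_abs_sub_of_integral_eq {g : Vel → ℝ} {F : ℕ → Vel → ℝ}
    (hg : Integrable g volume) (hg0 : ∀ v, 0 ≤ g v) (hF : ∀ n, Integrable (F n) volume)
    (hF0 : ∀ n v, 0 ≤ F n v) (hint : ∀ n, ∫ v, F n v = ∫ v, g v)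
    (hlim : ∀ᵐ v, Tendsto (fun n => F n v) atTop (𝓝 (g v))) :
    Tendsto (fun n => ∫ v, |F n v - g v|) atTop (𝓝 0) := by
  have h1 (n : ℕ) : ∫ v, |F n v - g v| = 2 * ∫ v, max (g v - F n v) 0 := by
    have e1 (v : Vel) : |F n v - g v| = (F n v - g v) + 2 * max (g v - F n v) 0 := by
      rcases le_total (F n v) (g v) with h | h
      · rw [abs_of_nonpos (by linarith), max_eq_left (by linarith)]
        ring
      · rw [abs_of_nonneg (by linarith), max_eq_right (by linarith)]
        ring
    simp_rw [e1]
    have i1 : Integrable (fun v => F n v - g v) volume := (hF n).sub hg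
    have i2 : Integrable (fun v => 2 * max (g v - F n v) 0) volume :=
      (hg.sub (hF n)).pos_part.const_mul 2
    rw [integral_add i1 i2, integral_sub (hF n) hg, hint, sub_self, zero_add, integral_const_mul]
  simp_rw [h1]
  have h2 : Tendsto (fun n => ∫ v, max (g v - F n v) 0) atTop (𝓝 (∫ _ : Vel, (0 : ℝ))) := by
    refine tendsto_integral_of_dominated_convergence g (fun n => ?_) hg (fun n => ?_) ?_
    · exact (hg.sub (hF n)).pos_part.aestronglyMeasurable
    · refine Eventually.of_forall fun v => ?_
      rw [Real.norm_of_nonneg (le_max_right _ _)]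
      exact max_le (by linarith [hF0 n v]) (hg0 v)
    · filter_upwards [hlim] with v hv
      have : Tendsto (fun n => max (g v - F n v) 0) atTop (𝓝 (max (g v - g v) 0)) :=
        (tendsto_const_nhds.sub hv).max tendsto_const_nhds
      simpa using this
  have := h2.const_mul 2
  simpa using this

/-- Mollifications of an integrable function converge to it in `L¹`. -/
lemma tendsto_integral_abs_mollify_sub {g : Vel → ℝ} (hg : Integrable g volume) :
    Tendsto (fun n => ∫ v, |mollify (shrinkingBump n) g v - g v|) atTop (𝓝 0) := by
  have pos (p : Vel → ℝ) (hp : Integrable p volume) (hp0 : ∀ v, 0 ≤ p v) :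
      Tendsto (fun n => ∫ v, |mollify (shrinkingBump n) p v - p v|) atTop (𝓝 0) :=
    tendsto_integral_abs_sub_of_integral_eq hp hp0 (fun n => integrable_mollify _ hp)
      (fun n => mollify_nonneg _ hp0) (fun n => integral_mollify _ hp)
      (ae_tendsto_mollify hp.locallyIntegrable)
  have hp := hg.pos_part
  have hn := hg.neg_part
  have hsum := (pos _ hp fun v => le_max_right _ _).add (pos _ hn fun v => le_max_right _ _)
  rw [add_zero] at hsum
  refine squeeze_zero (fun n => integral_nonneg fun v => abs_nonneg _) (fun n => ?_) hsum
  have i1 : Integrable (fun v => |mollify (shrinkingBump n) (fun u => max (g u) 0) v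
      - max (g v) 0|) volume := ((integrable_mollify (shrinkingBump n) hp).sub hp).abs
  have i2 : Integrable (fun v => |mollify (shrinkingBump n) (fun u => max (-g u) 0) v
      - max (-g v) 0|) volume := ((integrable_mollify (shrinkingBump n) hn).sub hn).abs
  rw [← integral_add i1 i2]
  refine integral_mono ((integrable_mollify (shrinkingBump n) hg).sub hg).abs (i1.add i2)
    fun v => ?_
  have hsplit : mollify (shrinkingBump n) g v = mollify (shrinkingBump n) (fun u => max (g u) 0) v
      - mollify (shrinkingBump n) (fun u => max (-g u) 0) v := by
    unfold mollify
    rw [← integral_sub (integrable_normed_mul _ hp.locallyIntegrable v)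
      (integrable_normed_mul _ hn.locallyIntegrable v)]
    congr 1
    ext u
    have : g u = max (g u) 0 - max (-g u) 0 := by
      have := max_zero_sub_max_neg_zero_eq_self (g u)
      linarith
    rw [← mul_sub, ← this]
  have hv : g v = max (g v) 0 - max (-g v) 0 := by
    have := max_zero_sub_max_neg_zero_eq_self (g v)
    linarith
  change |mollify (shrinkingBump n) g v - g v| ≤ |_ - max (g v) 0| + |_ - max (-g v) 0|
  rw [hsplit]
  conv_lhs => rw [hv]
  rw [show ∀ a b c d : ℝ, a - b - (c - d) = (a - c) - (b - d) by intros; ring]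
  exact abs_sub _ _

/-- The chain rule for weak gradients. -/
lemma IsWeakGradient.integral_comp_mul_fderiv {f : Vel → ℝ} {G : Vel → Vel}
    (h : IsWeakGradient f G) {H H' : ℝ → ℝ} (hH : ∀ s, HasDerivAt H (H' s) s)
    (hH' : Continuous H') {C : ℝ} (hb : ∀ s, |H s| ≤ C) (hb' : ∀ s, |H' s| ≤ C)
    {φ : Vel → ℝ} (hφ : ContDiff ℝ ∞ φ) (hc : HasCompactSupport φ) (e : Vel) :
    ∫ v : Vel, H (f v) * fderiv ℝ φ v e = -∫ v : Vel, H' (f v) * ⟪G v, e⟫ * φ v := by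
  have hHc : Continuous H := continuous_iff_continuousAt.2 fun s => (hH s).continuousAt
  have hC : 0 ≤ C := (abs_nonneg _).trans (hb 0)
  obtain ⟨Kφ, hKφ⟩ := hc.exists_bound_of_continuous hφ.continuous
  have hKφ0 : 0 ≤ Kφ := (norm_nonneg _).trans (hKφ 0)
  obtain ⟨R, hR⟩ : ∃ R, ∀ v, R < ‖v‖ → φ v = 0 := by
    obtain ⟨R, hR⟩ := hc.isCompact.isBounded.subset_closedBall (0 : Vel)
    refine ⟨R, fun v hv => ?_⟩
    by_contra hne
    have := hR (subset_tsupport φ hne)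
    rw [mem_closedBall_zero_iff] at this
    linarith
  -- Only the values of `G` near the support of `φ` matter, and there `G` is integrable.
  set g : Vel → ℝ := (Metric.closedBall (0 : Vel) (R + 1)).indicator fun v => ⟪G v, e⟫ with hgdef
  have hg : Integrable g volume := by
    refine (integrable_indicator_iff Metric.isClosed_closedBall.measurableSet).2 ?_
    exact (h.locallyIntegrable_inner e).integrableOn_isCompact (isCompact_closedBall _ _)
  set fn : ℕ → Vel → ℝ := fun n => mollify (shrinkingBump n) f with hfn
  have hfnc (n : ℕ) : ContDiff ℝ ∞ (fn n) := contDiff_mollify _ h.locallyIntegrable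
  have hlocal (n : ℕ) (v : Vel) (hv : ‖v‖ ≤ R) :
      fderiv ℝ (fn n) v e = mollify (shrinkingBump n) g v := by
    rw [hfn, h.fderiv_mollify]
    unfold mollify
    congr 1
    ext u
    by_cases hu : u ∈ Metric.closedBall (0 : Vel) (R + 1)
    · rw [hgdef, Set.indicator_of_mem hu]
    · rw [normed_eq_zero, zero_mul, zero_mul]
      rw [mem_closedBall_zero_iff, not_le] at hu
      have h1 := norm_sub_norm_le u v
      rw [norm_sub_rev] at h1
      have h2 := shrinkingBump_rOut_le n
      linarith
  have hdH (n : ℕ) (v : Vel) : HasFDerivAt (fun v => H (fn n v))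
      (H' (fn n v) • fderiv ℝ (fn n) v) v :=
    (hH (fn n v)).comp_hasFDerivAt v ((hfnc n).differentiable (by simp) v).hasFDerivAt
  have hfderivφ : Continuous (fun v => fderiv ℝ φ v e) := by
    have := hφ.continuous_fderiv (by simp)
    fun_prop
  have hfderivφc : HasCompactSupport (fun v => fderiv ℝ φ v e) := hc.fderiv_apply ℝ e
  have smooth (n : ℕ) : ∫ v : Vel, H (fn n v) * fderiv ℝ φ v e
      = -∫ v : Vel, H' (fn n v) * mollify (shrinkingBump n) g v * φ v := by
    have hcf : Continuous (fn n) := (hfnc n).continuous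
    have hcdf := (hfnc n).continuous_fderiv (by simp)
    have hcdf' : Continuous (fun v => fderiv ℝ (fn n) v e) := by fun_prop
    have e1 := integral_mul_fderiv_eq_neg_fderiv_mul_of_integrable (μ := (volume : Measure Vel))
      (f := fun v => H (fn n v)) (g := φ) (v := e) ?_ ?_ ?_
      (fun x _ => (hdH n x).differentiableAt) (fun x _ => hφ.differentiable (by simp) x)
    · rw [e1]
      congr 1
      congr 1
      ext v
      rw [(hdH n v).fderiv]
      by_cases hv : ‖v‖ ≤ R
      · simp only [smul_apply, smul_eq_mul, hlocal n v hv]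
      · rw [hR v (not_le.1 hv), mul_zero, mul_zero]
    · have : Continuous (fun v => fderiv ℝ (fun v => H (fn n v)) v e * φ v) := by
        simp_rw [fun v => (hdH n v).fderiv]
        simp only [smul_apply, smul_eq_mul]
        exact ((hH'.comp hcf).mul hcdf').mul hφ.continuous
      exact this.integrable_of_hasCompactSupport hc.mul_left
    · exact ((hHc.comp hcf).mul hfderivφ).integrable_of_hasCompactSupport hfderivφc.mul_left
    · exact ((hHc.comp hcf).mul hφ.continuous).integrable_of_hasCompactSupport hc.mul_left
  have lim_ae := ae_tendsto_mollify h.locallyIntegrable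
  have hfm : AEStronglyMeasurable f volume := h.locallyIntegrable.aestronglyMeasurable
  have lhs : Tendsto (fun n => ∫ v : Vel, H (fn n v) * fderiv ℝ φ v e) atTop
      (𝓝 (∫ v : Vel, H (f v) * fderiv ℝ φ v e)) := by
    refine tendsto_integral_of_dominated_convergence (fun v => C * |fderiv ℝ φ v e|)
      (fun n => ?_) ?_ (fun n => Eventually.of_forall fun v => ?_) ?_
    · exact ((hHc.comp (hfnc n).continuous).mul hfderivφ).aestronglyMeasurable
    · exact ((hfderivφ.integrable_of_hasCompactSupport hfderivφc).abs).const_mul C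
    · rw [norm_mul]
      exact mul_le_mul_of_nonneg_right (hb _) (abs_nonneg _)
    · filter_upwards [lim_ae] with v hv
      exact ((hHc.tendsto _).comp hv).mul_const _
  -- The derivatives converge in `L¹`, the factors `H' (fn n)` boundedly almost everywhere.
  have rhs1 : Tendsto (fun n => ∫ v : Vel, H' (fn n v) * g v * φ v) atTop
      (𝓝 (∫ v : Vel, H' (f v) * g v * φ v)) := by
    refine tendsto_integral_of_dominated_convergence (fun v => C * Kφ * |g v|)
      (fun n => ?_) ?_ (fun n => Eventually.of_forall fun v => ?_) ?_
    · exact (((hH'.comp (hfnc n).continuous).aestronglyMeasurable).mul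
        hg.aestronglyMeasurable).mul hφ.continuous.aestronglyMeasurable
    · exact hg.abs.const_mul _
    · rw [norm_mul, norm_mul]
      calc ‖H' (fn n v)‖ * ‖g v‖ * ‖φ v‖ ≤ C * |g v| * Kφ := by
            gcongr
            · exact hb' _
            · exact le_rfl
            · exact hKφ v
        _ = C * Kφ * |g v| := by ring
    · filter_upwards [lim_ae] with v hv
      exact (((hH'.tendsto _).comp hv).mul_const _).mul_const _
  have int1 (n : ℕ) : Integrable (fun v => H' (fn n v) * g v * φ v) volume := by
    refine Integrable.mono' (hg.abs.const_mul (C * Kφ)) ?_ (Eventually.of_forall fun v => ?_)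
    · exact (((hH'.comp (hfnc n).continuous).aestronglyMeasurable).mul
        hg.aestronglyMeasurable).mul hφ.continuous.aestronglyMeasurable
    · rw [norm_mul, norm_mul]
      calc ‖H' (fn n v)‖ * ‖g v‖ * ‖φ v‖ ≤ C * |g v| * Kφ := by
            gcongr
            · exact hb' _
            · exact le_rfl
            · exact hKφ v
        _ = C * Kφ * |g v| := by ring
  have int2 (n : ℕ) :
      Integrable (fun v => H' (fn n v) * mollify (shrinkingBump n) g v * φ v) volume := by
    have hm : Continuous (mollify (shrinkingBump n) g) :=
      (contDiff_mollify _ hg.locallyIntegrable).continuous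
    exact (((hH'.comp (hfnc n).continuous).mul hm).mul
      hφ.continuous).integrable_of_hasCompactSupport hc.mul_left
  have rhs2 : Tendsto (fun n => (∫ v : Vel, H' (fn n v) * mollify (shrinkingBump n) g v * φ v)
      - ∫ v : Vel, H' (fn n v) * g v * φ v) atTop (𝓝 0) := by
    have := (tendsto_integral_abs_mollify_sub hg).const_mul (C * Kφ)
    rw [mul_zero] at this
    refine squeeze_zero_norm (fun n => ?_) this
    rw [← integral_sub (int2 n) (int1 n), ← integral_const_mul]
    refine norm_integral_le_of_norm_le
      (((integrable_mollify _ hg).sub hg).abs.const_mul _) (Eventually.of_forall fun v => ?_)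
    rw [← sub_mul, ← mul_sub, norm_mul, norm_mul]
    calc ‖H' (fn n v)‖ * ‖mollify (shrinkingBump n) g v - g v‖ * ‖φ v‖
        ≤ C * |mollify (shrinkingBump n) g v - g v| * Kφ := by
          gcongr
          · exact hb' _
          · exact le_rfl
          · exact hKφ v
      _ = C * Kφ * |mollify (shrinkingBump n) g v - g v| := by ring
  have rhs := (rhs2.add rhs1).neg
  simp only [sub_add_cancel, zero_add] at rhs
  simp_rw [smooth] at lhs
  rw [tendsto_nhds_unique lhs rhs]
  congr 2
  ext v
  by_cases hv : ‖v‖ ≤ R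
  · rw [hgdef, Set.indicator_of_mem]
    rw [mem_closedBall_zero_iff]
    linarith
  · rw [hR v (not_le.1 hv), mul_zero, mul_zero]

/-- A weak gradient vanishes almost everywhere on the zero set of the function. This follows from
the chain rule for `ε arctan (f / ε)`, which tends to `0` while its derivative factor tends to the
indicator of the zero set. -/
lemma IsWeakGradient.ae_eq_zero_of_eq_zero {f : Vel → ℝ} {G : Vel → Vel}
    (h : IsWeakGradient f G) : ∀ᵐ v : Vel, f v = 0 → G v = 0 := by
  have comp (e : Vel) : ∀ᵐ v : Vel, {v | f v = 0}.indicator (fun v => ⟪G v, e⟫) v = 0 := by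
    have hfm : AEStronglyMeasurable f volume := h.locallyIntegrable.aestronglyMeasurable
    have hset : NullMeasurableSet {v | f v = 0} (volume : Measure Vel) :=
      hfm.aemeasurable.nullMeasurable (measurableSet_singleton 0)
    have hloc : LocallyIntegrable ({v | f v = 0}.indicator fun v => ⟪G v, e⟫) volume := by
      intro x
      obtain ⟨s, hs, hi⟩ := h.locallyIntegrable_inner e x
      exact ⟨s, hs, Integrable.indicator₀ hi (hset.mono_ac Measure.restrict_le_self.absolutelyContinuous)⟩
    refine ae_eq_zero_of_integral_contDiff_smul_eq_zero hloc fun φ hφ hc => ?_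
    have hfderivφ : Continuous (fun v => fderiv ℝ φ v e) := by
      have := hφ.continuous_fderiv (by simp)
      fun_prop
    have hfderivφc : HasCompactSupport (fun v => fderiv ℝ φ v e) := hc.fderiv_apply ℝ e
    have hGφ : Integrable (fun v => φ v • ⟪G v, e⟫) volume :=
      (h.locallyIntegrable_inner e).integrable_smul_left_of_hasCompactSupport hφ.continuous hc
    set ε : ℕ → ℝ := fun n => 1 / ((n : ℝ) + 1) with hε
    have hε0 (n : ℕ) : 0 < ε n := by positivity
    have hε1 (n : ℕ) : ε n ≤ 1 := shrinkingBump_rOut_le n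
    have hlim : Tendsto ε atTop (𝓝 0) := tendsto_one_div_add_atTop_nhds_zero_nat
    have habs (n : ℕ) (s : ℝ) : |ε n * Real.arctan (s / ε n)| ≤ 2 * ε n := by
      rw [abs_mul, abs_of_pos (hε0 n), mul_comm]
      have h1 := Real.arctan_lt_pi_div_two (s / ε n)
      have h2 := Real.neg_pi_div_two_lt_arctan (s / ε n)
      have h3 := Real.pi_lt_four
      refine mul_le_mul_of_nonneg_right (abs_le.2 ⟨?_, ?_⟩) (hε0 n).le <;> linarith
    have hle (s : ℝ) : |1 / (1 + s ^ 2)| ≤ 1 := by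
      rw [abs_of_pos (by positivity), div_le_one (by positivity)]
      nlinarith [sq_nonneg s]
    have chain (n : ℕ) := h.integral_comp_mul_fderiv
      (H := fun s => ε n * Real.arctan (s / ε n)) (H' := fun s => 1 / (1 + (s / ε n) ^ 2))
      (fun s => by
        have := ((Real.hasDerivAt_arctan (s / ε n)).comp s
          ((hasDerivAt_id s).div_const (ε n))).const_mul (ε n)
        refine this.congr_deriv ?_
        have := (hε0 n).ne'
        field_simp) (by
        refine Continuous.div continuous_const (by fun_prop) fun s => ?_
        positivity) (C := 2)
      (fun s => (habs n s).trans (by linarith [hε1 n])) (fun s => (hle _).trans (by norm_num))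
      hφ hc e
    have l1 : Tendsto (fun n => ∫ v : Vel, ε n * Real.arctan (f v / ε n) * fderiv ℝ φ v e) atTop
        (𝓝 0) := by
      have hbd : Tendsto (fun n => 2 * ε n * ∫ v : Vel, |fderiv ℝ φ v e|) atTop (𝓝 0) := by
        have := (hlim.const_mul 2).mul_const (∫ v : Vel, |fderiv ℝ φ v e|)
        simpa using this
      refine squeeze_zero_norm (fun n => ?_) hbd
      rw [← integral_const_mul]
      refine norm_integral_le_of_norm_le
        ((hfderivφ.integrable_of_hasCompactSupport hfderivφc).abs.const_mul _)
        (Eventually.of_forall fun v => ?_)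
      rw [norm_mul]
      exact mul_le_mul_of_nonneg_right (habs n _) (abs_nonneg _)
    have l2 : Tendsto (fun n => ∫ v : Vel, 1 / (1 + (f v / ε n) ^ 2) * ⟪G v, e⟫ * φ v) atTop
        (𝓝 (∫ v : Vel, φ v • {v | f v = 0}.indicator (fun v => ⟪G v, e⟫) v)) := by
      refine tendsto_integral_of_dominated_convergence (fun v => |φ v • ⟪G v, e⟫|)
        (fun n => ?_) hGφ.abs (fun n => Eventually.of_forall fun v => ?_)
        (Eventually.of_forall fun v => ?_)
      · have : (fun v => 1 / (1 + (f v / ε n) ^ 2) * ⟪G v, e⟫ * φ v)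
            = fun v => 1 / (1 + (f v / ε n) ^ 2) * (φ v • ⟪G v, e⟫) := by
          ext v
          rw [smul_eq_mul]
          ring
        rw [this]
        refine AEStronglyMeasurable.mul ?_ hGφ.aestronglyMeasurable
        refine Continuous.comp_aestronglyMeasurable (g := fun s : ℝ => 1 / (1 + (s / ε n) ^ 2))
          ?_ hfm
        refine Continuous.div continuous_const (by fun_prop) fun s => ?_
        positivity
      · rw [mul_assoc, norm_mul, mul_comm ⟪G v, e⟫, smul_eq_mul]
        exact mul_le_of_le_one_left (abs_nonneg _) (hle _)
      · by_cases hv : f v = 0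
        · simp [hv, mul_comm]
        · have : Tendsto (fun n => 1 / (1 + (f v / ε n) ^ 2)) atTop (𝓝 0) := by
            have hb : Tendsto (fun n => ε n ^ 2 / f v ^ 2) atTop (𝓝 0) := by
              have := (hlim.pow 2).div_const (f v ^ 2)
              simpa using this
            refine squeeze_zero (fun n => by positivity) (fun n => ?_) hb
            have h1 := hε0 n
            have h2 : 0 < f v ^ 2 := by positivity
            rw [div_pow, div_le_div_iff₀ (by positivity) h2, one_mul, mul_add, mul_one]
            rw [mul_div_cancel₀ _ (by positivity)]
            nlinarith [sq_nonneg (ε n)]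
          have h2 := (this.mul_const ⟪G v, e⟫).mul_const (φ v)
          simpa [hv] using h2
    simp_rw [chain] at l1
    have := tendsto_nhds_unique l1 l2.neg
    linarith
  have all := ae_all_iff.2 fun i : Fin 3 => comp (EuclideanSpace.single i 1)
  filter_upwards [all] with v hv hfv
  ext i
  have := hv i
  rw [Set.indicator_of_mem (show v ∈ {v | f v = 0} from hfv)] at this
  simpa [EuclideanSpace.inner_single_right] using this

/-! ### The dissipation density -/

/-- A form of the Cauchy–Schwarz inequality. -/
lemma sq_lintegral_le_of_sq_le {α : Type*} [MeasurableSpace α] {μ : Measure α}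
    {h A B : α → ℝ≥0∞} (hA : AEMeasurable A μ) (hB : AEMeasurable B μ)
    (hle : ∀ᵐ x ∂μ, h x ^ 2 ≤ A x * B x) :
    (∫⁻ x, h x ∂μ) ^ 2 ≤ (∫⁻ x, A x ∂μ) * ∫⁻ x, B x ∂μ := by
  have h1 : ∫⁻ x, h x ∂μ ≤ ∫⁻ x, A x ^ (1 / 2 : ℝ) * B x ^ (1 / 2 : ℝ) ∂μ := by
    refine lintegral_mono_ae ?_
    filter_upwards [hle] with x hx
    rw [← ENNReal.mul_rpow_of_nonneg _ _ (by norm_num : (0 : ℝ) ≤ 1 / 2)]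
    calc h x = (h x ^ 2) ^ (1 / 2 : ℝ) := by
          rw [← ENNReal.rpow_natCast, ← ENNReal.rpow_mul]
          norm_num
      _ ≤ _ := ENNReal.rpow_le_rpow hx (by norm_num)
  have h2 := ENNReal.lintegral_mul_norm_pow_le (μ := μ) hA hB
    (p := 1 / 2) (q := 1 / 2) (by norm_num) (by norm_num) (by norm_num)
  calc (∫⁻ x, h x ∂μ) ^ 2
      ≤ ((∫⁻ x, A x ∂μ) ^ (1 / 2 : ℝ) * (∫⁻ x, B x ∂μ) ^ (1 / 2 : ℝ)) ^ 2 := by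
        gcongr
        exact h1.trans h2
    _ = _ := by
        rw [← ENNReal.mul_rpow_of_nonneg _ _ (by norm_num : (0 : ℝ) ≤ 1 / 2),
          ← ENNReal.rpow_natCast, ← ENNReal.rpow_mul]
        norm_num

/-- The bivector `v ∧ L`, for a vector `v` and a linear functional `L`, evaluated at `(α, β)`. -/
noncomputable def wedge (v : Vel) (L : Vel → ℝ) (α β : Vel) : ℝ := ⟪v, α⟫ * L β - ⟪v, β⟫ * L α

/-- The squared area `‖z‖² ‖x‖² - ⟪z, x⟫²` of the parallelogram spanned by `z` and `x`. -/
noncomputable def areaSq (z x : Vel) : ℝ := ‖z‖ ^ 2 * ‖x‖ ^ 2 - ⟪z, x⟫ ^ 2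

lemma inner_eq_coord (x y : Vel) : ⟪x, y⟫ = x 0 * y 0 + x 1 * y 1 + x 2 * y 2 := by
  rw [PiLp.inner_apply, Fin.sum_univ_three]
  simp [mul_comm]

lemma norm_sq_eq_coord (x : Vel) : ‖x‖ ^ 2 = x 0 ^ 2 + x 1 ^ 2 + x 2 ^ 2 := by
  rw [← real_inner_self_eq_norm_sq, inner_eq_coord]
  ring

lemma areaSq_nonneg (z x : Vel) : 0 ≤ areaSq z x := by
  have h := abs_real_inner_le_norm z x
  have h2 := sq_le_sq.2 (h.trans (le_abs_self _))
  rw [mul_pow] at h2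
  exact sub_nonneg.2 h2

lemma sq_sum_mul_three_le (p1 p2 p3 q1 q2 q3 : ℝ) : (p1 * q1 + p2 * q2 + p3 * q3) ^ 2
    ≤ (q1 ^ 2 + q2 ^ 2 + q3 ^ 2) * (p1 ^ 2 + p2 ^ 2 + p3 ^ 2) := by
  nlinarith [sq_nonneg (p1 * q2 - p2 * q1), sq_nonneg (p1 * q3 - p3 * q1),
    sq_nonneg (p2 * q3 - p3 * q2)]

/-- The area of a parallelogram bounds its projections to coordinate planes. -/
lemma sq_wedge_le_areaSq (z x α β : Vel) :
    wedge z (fun e => ⟪x, e⟫) α β ^ 2 ≤ (‖α‖ * ‖β‖) ^ 2 * areaSq z x := by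
  unfold wedge areaSq
  rw [mul_pow]
  simp only [norm_sq_eq_coord, inner_eq_coord]
  set p1 := z 1 * x 2 - z 2 * x 1 with h1
  set p2 := z 2 * x 0 - z 0 * x 2 with h2
  set p3 := z 0 * x 1 - z 1 * x 0 with h3
  set q1 := α 1 * β 2 - α 2 * β 1 with h4
  set q2 := α 2 * β 0 - α 0 * β 2 with h5
  set q3 := α 0 * β 1 - α 1 * β 0 with h6
  have e1 : (z 0 * α 0 + z 1 * α 1 + z 2 * α 2) * (x 0 * β 0 + x 1 * β 1 + x 2 * β 2)
      - (z 0 * β 0 + z 1 * β 1 + z 2 * β 2) * (x 0 * α 0 + x 1 * α 1 + x 2 * α 2)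
      = p1 * q1 + p2 * q2 + p3 * q3 := by
    simp only [h1, h2, h3, h4, h5, h6]
    ring
  have e2 : (z 0 ^ 2 + z 1 ^ 2 + z 2 ^ 2) * (x 0 ^ 2 + x 1 ^ 2 + x 2 ^ 2)
      - (z 0 * x 0 + z 1 * x 1 + z 2 * x 2) ^ 2 = p1 ^ 2 + p2 ^ 2 + p3 ^ 2 := by
    simp only [h1, h2, h3]
    ring
  have e3 : (α 0 ^ 2 + α 1 ^ 2 + α 2 ^ 2) * (β 0 ^ 2 + β 1 ^ 2 + β 2 ^ 2)
      = q1 ^ 2 + q2 ^ 2 + q3 ^ 2 + (α 0 * β 0 + α 1 * β 1 + α 2 * β 2) ^ 2 := by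
    simp only [h4, h5, h6]
    ring
  rw [e1, e2, e3]
  refine (sq_sum_mul_three_le p1 p2 p3 q1 q2 q3).trans (mul_le_mul_of_nonneg_right ?_ (by positivity))
  linarith [sq_nonneg (α 0 * β 0 + α 1 * β 1 + α 2 * β 2)]

/-- The logarithmic gradient `∇f / f`, equal to `0` where `f` vanishes. -/
noncomputable def logGrad (f : Vel → ℝ) (G : Vel → Vel) (v : Vel) : Vel := (f v)⁻¹ • G v

/-- The quadratic form of the Coulomb matrix at `v - w` in the difference of the logarithmic
gradients at `v` and `w`. -/
noncomputable def relativeEnergy (f : Vel → ℝ) (G : Vel → Vel) (v w : Vel) : ℝ :=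
  ‖v - w‖⁻¹ ^ 3 * areaSq (v - w) (logGrad f G v - logGrad f G w)

/-- The dissipation density at `v` per unit mass, up to a factor `1 / 2`. -/
noncomputable def dissipationAt (f : Vel → ℝ) (G : Vel → Vel) (v : Vel) : ℝ≥0∞ :=
  ∫⁻ w, ENNReal.ofReal (f w * relativeEnergy f G v w)

lemma relativeEnergy_nonneg (f : Vel → ℝ) (G : Vel → Vel) (v w : Vel) :
    0 ≤ relativeEnergy f G v w :=
  mul_nonneg (by positivity) (areaSq_nonneg _ _)

lemma sum_coulombMatrix (z x : Vel) (c : ℝ) :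
    ∑ i : Fin 3, ∑ j : Fin 3, coulombMatrix z i j * c * x i * x j
      = c * (‖z‖⁻¹ ^ 3 * areaSq z x) := by
  rcases eq_or_ne z 0 with rfl | hz
  · simp [coulombMatrix]
  · have hn : ‖z‖ ≠ 0 := norm_ne_zero_iff.2 hz
    have h1 : ‖z‖⁻¹ ^ 3 * areaSq z x = ‖z‖⁻¹ * (‖x‖ ^ 2 - ⟪z, x⟫ ^ 2 / ‖z‖ ^ 2) := by
      unfold areaSq
      field_simp
    rw [h1]
    unfold coulombMatrix
    simp only [Fin.sum_univ_three, norm_sq_eq_coord x, inner_eq_coord]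
    simp
    ring

lemma entropyDissipation_eq_lintegral_prod (f : Vel → ℝ) (G : Vel → Vel) :
    entropyDissipation f G = ∫⁻ x : Vel × Vel,
      ENNReal.ofReal (1 / 2 * (f x.1 * f x.2 * relativeEnergy f G x.1 x.2)) := by
  unfold entropyDissipation
  congr 1
  ext x
  congr 2
  rw [relativeEnergy, ← sum_coulombMatrix]
  simp [logGrad, div_eq_inv_mul]

lemma aemeasurable_logGrad {f : Vel → ℝ} {G : Vel → Vel} (hf : AEMeasurable f volume)
    (hG : AEMeasurable G volume) : AEMeasurable (logGrad f G) volume :=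
  hf.inv.smul hG

lemma aemeasurable_relativeEnergy {f : Vel → ℝ} {G : Vel → Vel} (hf : AEMeasurable f volume)
    (hG : AEMeasurable G volume) (v : Vel) :
    AEMeasurable (relativeEnergy f G v) volume := by
  have h := aemeasurable_logGrad hf hG
  unfold relativeEnergy areaSq
  fun_prop

lemma entropyDissipation_eq {f : Vel → ℝ} {G : Vel → Vel} (hf0 : ∀ v, 0 ≤ f v)
    (hf : AEMeasurable f volume) (hG : AEMeasurable G volume) :
    entropyDissipation f G = ∫⁻ v, ENNReal.ofReal (1 / 2 * f v) * dissipationAt f G v := by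
  have h := aemeasurable_logGrad hf hG
  have h1 : AEMeasurable (fun x : Vel × Vel => logGrad f G x.1) (volume.prod volume) := h.comp_fst
  have h2 : AEMeasurable (fun x : Vel × Vel => logGrad f G x.2) (volume.prod volume) := h.comp_snd
  have h3 : AEMeasurable (fun x : Vel × Vel => f x.1) (volume.prod volume) := hf.comp_fst
  have h4 : AEMeasurable (fun x : Vel × Vel => f x.2) (volume.prod volume) := hf.comp_snd
  rw [entropyDissipation_eq_lintegral_prod, Measure.volume_eq_prod, lintegral_prod]
  · congr 1
    ext v
    have hm : AEMeasurable (fun w => ENNReal.ofReal (f w * relativeEnergy f G v w)) volume :=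
      (hf.mul (aemeasurable_relativeEnergy hf hG v)).ennreal_ofReal
    rw [dissipationAt, ← lintegral_const_mul'' _ hm]
    congr 1
    ext w
    rw [← ENNReal.ofReal_mul (mul_nonneg (by norm_num) (hf0 v))]
    congr 1
    ring
  · unfold relativeEnergy areaSq
    fun_prop

lemma aemeasurable_dissipationAt {f : Vel → ℝ} {G : Vel → Vel}
    (hf : AEMeasurable f volume) (hG : AEMeasurable G volume) :
    AEMeasurable (dissipationAt f G) volume := by
  have h := aemeasurable_logGrad hf hG
  have h1 : AEMeasurable (fun x : Vel × Vel => logGrad f G x.1) (volume.prod volume) := h.comp_fst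
  have h2 : AEMeasurable (fun x : Vel × Vel => logGrad f G x.2) (volume.prod volume) := h.comp_snd
  have h4 : AEMeasurable (fun x : Vel × Vel => f x.2) (volume.prod volume) := hf.comp_snd
  have : AEMeasurable (fun x : Vel × Vel => ENNReal.ofReal (f x.2 * relativeEnergy f G x.1 x.2))
      (volume.prod volume) := by
    unfold relativeEnergy areaSq
    fun_prop
  exact this.lintegral_prod_right'

/-! ### Testing the dissipation in one variable -/

lemma one_le_japaneseBracket (v : Vel) : 1 ≤ japaneseBracket v := by
  unfold japaneseBracket
  rw [Real.one_le_sqrt]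
  nlinarith [sq_nonneg ‖v‖]

lemma norm_le_japaneseBracket (v : Vel) : ‖v‖ ≤ japaneseBracket v := by
  unfold japaneseBracket
  apply Real.le_sqrt_of_sq_le
  linarith

lemma japaneseBracket_pos (v : Vel) : 0 < japaneseBracket v :=
  zero_lt_one.trans_le (one_le_japaneseBracket v)

lemma sq_japaneseBracket (v : Vel) : japaneseBracket v ^ 2 = 1 + ‖v‖ ^ 2 :=
  Real.sq_sqrt (by positivity)

lemma continuous_japaneseBracket : Continuous japaneseBracket := by
  unfold japaneseBracket
  fun_prop

/-- The quantity `⟨v⟩² + ⟨v⟩³ d(v)`, with `d` the dissipation density, which controls the squared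
logarithmic gradient at `v`. -/
noncomputable def gradMajorant (f : Vel → ℝ) (G : Vel → Vel) (v : Vel) : ℝ≥0∞ :=
  ENNReal.ofReal (japaneseBracket v ^ 2)
    + ENNReal.ofReal (japaneseBracket v ^ 3) * dissipationAt f G v

/-- Integrating the relation `(v - w) ∧ (b(v) - b(w))` between the logarithmic gradients `b` at two
points against `f(w) ψ(w) dw` and moving the derivative of `f(w)` to the test function. -/
lemma IsWeakGradient.wedge_identity {f : Vel → ℝ} {G : Vel → Vel} (h : IsWeakGradient f G)
    {ψ : Vel → ℝ} (hψ : ContDiff ℝ ∞ ψ) (hc : HasCompactSupport ψ) (v b α β : Vel) :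
    (∫ w, f w * ψ w * ⟪v - w, α⟫) * ⟪b, β⟫ - (∫ w, f w * ψ w * ⟪v - w, β⟫) * ⟪b, α⟫
      = (∫ w, f w * ψ w * wedge (v - w) (fun e => ⟪b - logGrad f G w, e⟫) α β)
        - ∫ w, f w * wedge (v - w) (fun e => fderiv ℝ ψ w e) α β := by
  have hd (γ : Vel) : ContDiff ℝ ∞ (fun w => ψ w * ⟪v - w, γ⟫) :=
    hψ.mul ((contDiff_const.sub contDiff_id).inner ℝ contDiff_const)
  have hdc (γ : Vel) : HasCompactSupport (fun w => ψ w * ⟪v - w, γ⟫) := hc.mul_right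
  have i1 (γ : Vel) : Integrable (fun w => f w * ψ w * ⟪v - w, γ⟫) volume := by
    have := h.locallyIntegrable.integrable_smul_right_of_hasCompactSupport (hd γ).continuous (hdc γ)
    simpa only [smul_eq_mul, mul_assoc] using this
  have i2 (γ δ : Vel) : Integrable (fun w => ⟪G w, δ⟫ * (ψ w * ⟪v - w, γ⟫)) volume :=
    (h.locallyIntegrable_inner δ).integrable_smul_right_of_hasCompactSupport
      (hd γ).continuous (hdc γ)
  have hcf : Continuous (fun w => fderiv ℝ ψ w) := hψ.continuous_fderiv (by simp)
  have i3 (γ δ : Vel) : Integrable (fun w => f w * (⟪v - w, γ⟫ * fderiv ℝ ψ w δ)) volume :=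
    h.locallyIntegrable.integrable_smul_right_of_hasCompactSupport (by fun_prop)
      (hc.fderiv_apply ℝ δ).mul_left
  have i4 (γ δ : Vel) : Integrable (fun w => f w * (ψ w * ⟪δ, γ⟫)) volume :=
    h.locallyIntegrable.integrable_smul_right_of_hasCompactSupport
      (hψ.continuous.mul continuous_const) hc.mul_right
  have parts (γ δ : Vel) : (∫ w, f w * (⟪v - w, γ⟫ * fderiv ℝ ψ w δ))
      - ∫ w, f w * (ψ w * ⟪δ, γ⟫) = - ∫ w, ⟪G w, δ⟫ * (ψ w * ⟪v - w, γ⟫) := by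
    rw [← h.integral_mul_fderiv (hd γ) (hdc γ) δ, ← integral_sub (i3 γ δ) (i4 γ δ)]
    congr 1
    ext w
    have h1 : HasFDerivAt ψ (fderiv ℝ ψ w) w := (hψ.differentiable (by simp) w).hasFDerivAt
    have h2 : HasFDerivAt (fun w => ⟪v - w, γ⟫)
        ((innerSL ℝ γ).comp (-ContinuousLinearMap.id ℝ Vel)) w := by
      have h3 : (fun w => ⟪v - w, γ⟫) = fun w => innerSL ℝ γ (v - w) := by
        ext w
        rw [innerSL_apply_apply, real_inner_comm]
      rw [h3]
      exact ((innerSL ℝ γ).hasFDerivAt).comp w ((hasFDerivAt_id w).const_sub v)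
    have h4 : HasFDerivAt (fun w => ψ w * ⟪v - w, γ⟫) _ w := h1.mul h2
    rw [h4.fderiv]
    simp [real_inner_comm]
    ring
  have p1 := parts α β
  have p2 := parts β α
  have sym : ∫ w, f w * (ψ w * ⟪β, α⟫) = ∫ w, f w * (ψ w * ⟪α, β⟫) := by
    simp_rw [real_inner_comm]
  have e2 : ∫ w, f w * wedge (v - w) (fun e => fderiv ℝ ψ w e) α β
      = (∫ w, f w * (⟪v - w, α⟫ * fderiv ℝ ψ w β))
        - ∫ w, f w * (⟪v - w, β⟫ * fderiv ℝ ψ w α) := by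
    rw [← integral_sub (i3 α β) (i3 β α)]
    simp only [wedge, mul_sub]
  have e1 : ∫ w, f w * ψ w * wedge (v - w) (fun e => ⟪b - logGrad f G w, e⟫) α β
      = (∫ w, f w * ψ w * ⟪v - w, α⟫) * ⟪b, β⟫ - (∫ w, f w * ψ w * ⟪v - w, β⟫) * ⟪b, α⟫
        - ((∫ w, ⟪G w, β⟫ * (ψ w * ⟪v - w, α⟫)) - ∫ w, ⟪G w, α⟫ * (ψ w * ⟪v - w, β⟫)) := by
    have j1 : Integrable (fun w => f w * ψ w * ⟪v - w, α⟫ * ⟪b, β⟫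
        - f w * ψ w * ⟪v - w, β⟫ * ⟪b, α⟫) volume := ((i1 α).mul_const _).sub ((i1 β).mul_const _)
    have j2 : Integrable (fun w => ⟪G w, β⟫ * (ψ w * ⟪v - w, α⟫)
        - ⟪G w, α⟫ * (ψ w * ⟪v - w, β⟫)) volume := (i2 α β).sub (i2 β α)
    rw [← integral_mul_const, ← integral_mul_const,
      ← integral_sub ((i1 α).mul_const _) ((i1 β).mul_const _), ← integral_sub (i2 α β) (i2 β α),
      ← integral_sub j1 j2]
    refine integral_congr_ae ?_
    -- `∇f = f b` holds almost everywhere, as `∇f` vanishes where `f` does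
    filter_upwards [h.ae_eq_zero_of_eq_zero] with w hw
    have hG : G w = f w • logGrad f G w := by
      by_cases hf : f w = 0
      · rw [hw hf, hf, zero_smul]
      · rw [logGrad, smul_smul, mul_inv_cancel₀ hf, one_smul]
    conv_rhs => rw [hG]
    simp only [wedge, inner_sub_left, inner_smul_left, RCLike.conj_to_real]
    ring
  rw [e1, e2]
  linarith

/-- A test function turns the dissipation density at `v` into control of the bivector
`(m v - m') ∧ b(v)`, with `m` and `m'` the mass and the first moment of `f ψ` and `b` the
logarithmic gradient. -/
lemma IsWeakGradient.sq_wedge_le {f : Vel → ℝ} {G : Vel → Vel} (h : IsWeakGradient f G)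
    (hf0 : ∀ v, 0 ≤ f v) (hfi : Integrable f volume) {M : ℝ} (hM : ∫ v, f v ≤ M)
    {ψ : Vel → ℝ} (hψ : ContDiff ℝ ∞ ψ) {K R : ℝ} (hR : 1 ≤ R)
    (hsupp : ∀ w, R < ‖w‖ → ψ w = 0) (hK : ∀ w, |ψ w| ≤ K)
    (hK' : ∀ w, ‖fderiv ℝ ψ w‖ ≤ K) (v α β : Vel) :
    ENNReal.ofReal (((∫ w, f w * ψ w * ⟪v - w, α⟫) * ⟪logGrad f G v, β⟫
        - (∫ w, f w * ψ w * ⟪v - w, β⟫) * ⟪logGrad f G v, α⟫) ^ 2)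
      ≤ ENNReal.ofReal ((32 * M ^ 2 * K ^ 2 * R ^ 2 + 16 * M * K ^ 2 * R ^ 3) * (‖α‖ * ‖β‖) ^ 2)
        * gradMajorant f G v := by
  have hM0 : 0 ≤ M := (integral_nonneg hf0).trans hM
  have hK0 : 0 ≤ K := (abs_nonneg _).trans (hK 0)
  have hc : HasCompactSupport ψ := by
    refine HasCompactSupport.intro (isCompact_closedBall (0 : Vel) R) fun w hw => hsupp w ?_
    rwa [mem_closedBall_zero_iff, not_le] at hw
  rw [h.wedge_identity hψ hc]
  set T1 := ∫ w, f w * ψ w * wedge (v - w) (fun e => ⟪logGrad f G v - logGrad f G w, e⟫) α β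
    with hT1
  set T2 := ∫ w, f w * wedge (v - w) (fun e => fderiv ℝ ψ w e) α β with hT2
  set J := japaneseBracket v with hJ
  have hJ1 : 1 ≤ J := one_le_japaneseBracket v
  have hz (w : Vel) (hw : ‖w‖ ≤ R) : ‖v - w‖ ≤ 2 * R * J := by
    have h1 := norm_sub_le v w
    have h2 := norm_le_japaneseBracket v
    nlinarith
  have hfm : AEMeasurable f volume := hfi.aemeasurable
  have hGm : AEMeasurable G volume := h.locallyIntegrable_grad.aestronglyMeasurable.aemeasurable
  set c := ‖α‖ * ‖β‖ with hcdef
  have hc0 : 0 ≤ c := by positivity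
  have b2 : |T2| ≤ M * (4 * K * R * J * c) := by
    have : |T2| ≤ ∫ w, f w * (4 * K * R * J * c) := by
      rw [hT2, ← Real.norm_eq_abs]
      refine norm_integral_le_of_norm_le (hfi.mul_const _) (Eventually.of_forall fun w => ?_)
      rw [norm_mul, Real.norm_of_nonneg (hf0 w)]
      refine mul_le_mul_of_nonneg_left ?_ (hf0 w)
      by_cases hw : ‖w‖ ≤ R
      · have h1 := abs_real_inner_le_norm (v - w) α
        have h2 := abs_real_inner_le_norm (v - w) β
        have h3 : |fderiv ℝ ψ w α| ≤ K * ‖α‖ :=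
          ((fderiv ℝ ψ w).le_opNorm α).trans (by gcongr; exact hK' w)
        have h4 : |fderiv ℝ ψ w β| ≤ K * ‖β‖ :=
          ((fderiv ℝ ψ w).le_opNorm β).trans (by gcongr; exact hK' w)
        unfold wedge
        calc ‖⟪v - w, α⟫ * fderiv ℝ ψ w β - ⟪v - w, β⟫ * fderiv ℝ ψ w α‖
            ≤ |⟪v - w, α⟫| * |fderiv ℝ ψ w β| + |⟪v - w, β⟫| * |fderiv ℝ ψ w α| := by
              rw [← abs_mul, ← abs_mul]
              exact abs_sub _ _
          _ ≤ (‖v - w‖ * ‖α‖) * (K * ‖β‖) + (‖v - w‖ * ‖β‖) * (K * ‖α‖) := by gcongr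
          _ = 2 * K * c * ‖v - w‖ := by rw [hcdef]; ring
          _ ≤ 2 * K * c * (2 * R * J) := by gcongr; exact hz w hw
          _ = _ := by ring
      · have h0 : fderiv ℝ ψ w = 0 := by
          have : ψ =ᶠ[𝓝 w] fun _ => 0 := by
            have hopen : IsOpen {w : Vel | R < ‖w‖} := isOpen_lt continuous_const continuous_norm
            filter_upwards [hopen.mem_nhds (not_le.1 hw)] with u hu using hsupp u hu
          rw [this.fderiv_eq]
          simp
        unfold wedge
        simp only [h0]
        simp
        positivity
    rw [integral_mul_const] at this
    exact this.trans (by gcongr)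
  have b1 : ENNReal.ofReal (T1 ^ 2)
      ≤ ENNReal.ofReal (M * (K ^ 2 * c ^ 2 * (2 * R * J) ^ 3)) * dissipationAt f G v := by
    have h1 : ENNReal.ofReal |T1| ≤ ∫⁻ w, ENNReal.ofReal |f w * ψ w *
        wedge (v - w) (fun e => ⟪logGrad f G v - logGrad f G w, e⟫) α β| := by
      have := enorm_integral_le_lintegral_enorm (μ := (volume : Measure Vel)) (fun w => f w * ψ w *
        wedge (v - w) (fun e => ⟪logGrad f G v - logGrad f G w, e⟫) α β)
      simpa only [Real.enorm_eq_ofReal_abs] using this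
    have h2 := sq_lintegral_le_of_sq_le (μ := (volume : Measure Vel))
      (h := fun w => ENNReal.ofReal |f w * ψ w *
        wedge (v - w) (fun e => ⟪logGrad f G v - logGrad f G w, e⟫) α β|)
      (A := fun w => ENNReal.ofReal (f w * (K ^ 2 * c ^ 2 * (2 * R * J) ^ 3)))
      (B := fun w => ENNReal.ofReal (f w * relativeEnergy f G v w))
      (hfm.mul_const _).ennreal_ofReal
      (hfm.mul (aemeasurable_relativeEnergy hfm hGm v)).ennreal_ofReal
      (Eventually.of_forall fun w => ?_)
    · rw [← sq_abs, ENNReal.ofReal_pow (abs_nonneg _)]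
      refine (pow_le_pow_left' h1 2).trans (h2.trans ?_)
      refine mul_le_mul_left ?_ _
      rw [← ofReal_integral_eq_lintegral_ofReal (hfi.mul_const _)
        (Eventually.of_forall fun w => mul_nonneg (hf0 w) (by positivity)), integral_mul_const]
      gcongr
    · rw [← ENNReal.ofReal_pow (abs_nonneg _), sq_abs,
        ← ENNReal.ofReal_mul (mul_nonneg (hf0 w) (by positivity))]
      refine ENNReal.ofReal_le_ofReal ?_
      by_cases hw : ‖w‖ ≤ R
      · set z := v - w with hzdef
        set x := logGrad f G v - logGrad f G w with hx
        have s1 := sq_wedge_le_areaSq z x α β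
        have s2 : areaSq z x ≤ (2 * R * J) ^ 3 * relativeEnergy f G v w := by
          unfold relativeEnergy
          rw [← hzdef, ← hx]
          rcases eq_or_ne z 0 with h0 | h0
          · rw [h0]
            simp [areaSq]
          · have hn : 0 < ‖z‖ := norm_pos_iff.2 h0
            rw [← mul_assoc, inv_pow]
            refine le_mul_of_one_le_left (areaSq_nonneg _ _) ?_
            rw [← div_eq_mul_inv, one_le_div (by positivity)]
            gcongr
            exact hz w hw
        have s3 : ψ w ^ 2 ≤ K ^ 2 := by
          rw [← sq_abs]
          exact pow_le_pow_left₀ (abs_nonneg _) (hK w) 2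
        calc (f w * ψ w * wedge z (fun e => ⟪x, e⟫) α β) ^ 2
            = f w ^ 2 * (ψ w ^ 2 * wedge z (fun e => ⟪x, e⟫) α β ^ 2) := by ring
          _ ≤ f w ^ 2 * (K ^ 2 * (c ^ 2 * ((2 * R * J) ^ 3 * relativeEnergy f G v w))) := by
              gcongr
              exact s1.trans (by gcongr)
          _ = _ := by ring
      · rw [hsupp w (not_le.1 hw)]
        have := mul_nonneg (hf0 w) (relativeEnergy_nonneg f G v w)
        have := hf0 w
        simp only [mul_zero, zero_mul, ne_eq, OfNat.ofNat_ne_zero, not_false_eq_true, zero_pow]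
        positivity
  calc ENNReal.ofReal ((T1 - T2) ^ 2)
      ≤ ENNReal.ofReal (2 * T1 ^ 2 + 2 * (M * (4 * K * R * J * c)) ^ 2) := by
        refine ENNReal.ofReal_le_ofReal ?_
        have : T2 ^ 2 ≤ (M * (4 * K * R * J * c)) ^ 2 := by
          rw [← sq_abs]
          exact pow_le_pow_left₀ (abs_nonneg _) b2 2
        nlinarith [sq_nonneg (T1 + T2)]
    _ = 2 * ENNReal.ofReal (T1 ^ 2)
        + ENNReal.ofReal (32 * M ^ 2 * K ^ 2 * R ^ 2 * c ^ 2) * ENNReal.ofReal (J ^ 2) := by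
        rw [ENNReal.ofReal_add (by positivity) (by positivity), ENNReal.ofReal_mul (by norm_num),
          ← ENNReal.ofReal_mul (q := J ^ 2) (by positivity), ENNReal.ofReal_ofNat]
        congr 2
        ring
    _ ≤ 2 * (ENNReal.ofReal (M * (K ^ 2 * c ^ 2 * (2 * R * J) ^ 3)) * dissipationAt f G v)
        + ENNReal.ofReal (32 * M ^ 2 * K ^ 2 * R ^ 2 * c ^ 2) * ENNReal.ofReal (J ^ 2) := by
        gcongr
    _ = ENNReal.ofReal (16 * M * K ^ 2 * R ^ 3 * c ^ 2)
          * (ENNReal.ofReal (J ^ 3) * dissipationAt f G v)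
        + ENNReal.ofReal (32 * M ^ 2 * K ^ 2 * R ^ 2 * c ^ 2) * ENNReal.ofReal (J ^ 2) := by
        have e : 2 * ENNReal.ofReal (M * (K ^ 2 * c ^ 2 * (2 * R * J) ^ 3))
            = ENNReal.ofReal (16 * M * K ^ 2 * R ^ 3 * c ^ 2) * ENNReal.ofReal (J ^ 3) := by
          rw [← ENNReal.ofReal_mul (by positivity), ← ENNReal.ofReal_ofNat 2,
            ← ENNReal.ofReal_mul (by norm_num)]
          congr 1
          ring
        rw [← mul_assoc 2, ← mul_assoc (ENNReal.ofReal _) (ENNReal.ofReal _), e]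
    _ ≤ _ := by
        have n1 : 0 ≤ 16 * M * K ^ 2 * R ^ 3 * c ^ 2 := by positivity
        have n2 : 0 ≤ 32 * M ^ 2 * K ^ 2 * R ^ 2 * c ^ 2 := by positivity
        rw [gradMajorant, mul_add, add_comm]
        refine add_le_add (mul_le_mul_left (ENNReal.ofReal_le_ofReal ?_) _)
          (mul_le_mul_left (ENNReal.ofReal_le_ofReal ?_) _) <;> linarith

/-! ### Nonconcentration of mass -/

lemma integrable_exp_neg_sq_norm :
    Integrable (fun v : Vel => Real.exp (-1 * ‖v‖ ^ 2)) volume := by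
  refine Integrable.of_integral_ne_zero ?_
  rw [GaussianFourier.integral_rexp_neg_mul_sq_norm one_pos]
  positivity

/-- The Legendre duality between `s log s - s` and `exp`. -/
lemma mul_le_mul_log_sub_add_exp {s : ℝ} (hs : 0 ≤ s) (t : ℝ) :
    s * t ≤ s * Real.log s - s + Real.exp t := by
  rcases hs.eq_or_lt with rfl | hs
  · simpa using (Real.exp_pos t).le
  · have h1 := Real.add_one_le_exp (t - Real.log s)
    rw [Real.exp_sub, Real.exp_log hs, le_div_iff₀ hs] at h1
    linarith

/-- Bounded energy and entropy prevent concentration of mass on sets of small measure. The duality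
between `s log s` and `exp` is used with the exponent `K 1_A - ‖v‖²`. -/
lemma HydrodynamicBounds.integral_indicator_le {m₀ M₀ E₀ H₀ : ℝ} {f : Vel → ℝ}
    (hf : HydrodynamicBounds m₀ M₀ E₀ H₀ f) {A : Set Vel} (hA : MeasurableSet A)
    (hAfin : volume A ≠ ⊤) (K : ℝ) :
    K * ∫ v, A.indicator f v
      ≤ H₀ + E₀ + (∫ v : Vel, Real.exp (-1 * ‖v‖ ^ 2)) + Real.exp K * volume.real A := by
  have i1 : Integrable (A.indicator f) volume := hf.integrable_mass.indicator hA
  have i2 : Integrable (A.indicator fun _ => Real.exp K) volume :=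
    (integrable_indicator_iff hA).2 (integrableOn_const hAfin)
  have e2 : ∫ v, A.indicator (fun _ => Real.exp K) v = Real.exp K * volume.real A := by
    rw [integral_indicator hA, setIntegral_const, smul_eq_mul, mul_comm]
  have hle : ∫ v, K * A.indicator f v ≤ ∫ v, (f v * Real.log (f v) + f v * ‖v‖ ^ 2
      + Real.exp (-1 * ‖v‖ ^ 2) + A.indicator (fun _ => Real.exp K) v) := by
    refine integral_mono (i1.const_mul K) (((hf.integrable_entropy.add hf.integrable_energy).add
      integrable_exp_neg_sq_norm).add i2) fun v => ?_
    have h0 := hf.nonneg v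
    by_cases hv : v ∈ A
    · have h1 := mul_le_mul_log_sub_add_exp h0 (K - ‖v‖ ^ 2)
      have h2 : Real.exp (K - ‖v‖ ^ 2) ≤ Real.exp K := Real.exp_le_exp.2 (by nlinarith [sq_nonneg ‖v‖])
      have h3 := (Real.exp_pos (-1 * ‖v‖ ^ 2)).le
      simp only [Set.indicator_of_mem hv]
      linarith
    · have h1 := mul_le_mul_log_sub_add_exp h0 (-1 * ‖v‖ ^ 2)
      simp only [Set.indicator_of_notMem hv]
      linarith
  rw [integral_const_mul] at hle
  refine hle.trans ?_
  have j1 : Integrable (fun v => f v * Real.log (f v) + f v * ‖v‖ ^ 2) volume :=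
    hf.integrable_entropy.add hf.integrable_energy
  have j2 : Integrable (fun v => f v * Real.log (f v) + f v * ‖v‖ ^ 2
      + Real.exp (-1 * ‖v‖ ^ 2)) volume := j1.add integrable_exp_neg_sq_norm
  rw [integral_add j2 i2, integral_add j1 integrable_exp_neg_sq_norm,
    integral_add hf.integrable_entropy hf.integrable_energy, e2]
  linarith [hf.entropy_le, hf.energy_le]

/-- The part of the slab of half-width `η` around the plane `⟪w, e⟫ = s` inside the ball of
radius `R`. -/
def truncatedSlab (R η : ℝ) (e : Vel) (s : ℝ) : Set Vel := {w | ‖w‖ ≤ R ∧ |⟪w, e⟫ - s| ≤ η}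

lemma isClosed_truncatedSlab (R η : ℝ) (e : Vel) (s : ℝ) : IsClosed (truncatedSlab R η e s) := by
  have h1 : IsClosed {w : Vel | ‖w‖ ≤ R} := isClosed_le continuous_norm continuous_const
  have h2 : IsClosed {w : Vel | |⟪w, e⟫ - s| ≤ η} := isClosed_le (by fun_prop) continuous_const
  exact h1.inter h2

lemma measurableSet_truncatedSlab (R η : ℝ) (e : Vel) (s : ℝ) :
    MeasurableSet (truncatedSlab R η e s) := (isClosed_truncatedSlab R η e s).measurableSet

lemma volume_truncatedSlab_ne_top (R η : ℝ) (e : Vel) (s : ℝ) :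
    volume (truncatedSlab R η e s) ≠ ⊤ := by
  refine ((measure_mono fun w hw => ?_).trans_lt
    (measure_closedBall_lt_top (x := (0 : Vel)) (r := R))).ne
  exact mem_closedBall_zero_iff.2 hw.1

/-- Thin slabs have small measure, uniformly in their position and direction: many disjoint
translates of a thin slab fit into a ball. -/
lemma exists_volume_truncatedSlab_le (R : ℝ) {δ : ℝ} (hδ : 0 < δ) :
    ∃ η : ℝ, 0 < η ∧ ∀ e : Vel, ‖e‖ = 1 → ∀ s : ℝ,
      volume.real (truncatedSlab R η e s) ≤ δ := by
  obtain ⟨N, hN⟩ := exists_nat_gt (volume.real (Metric.closedBall (0 : Vel) (R + 1)) / δ)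
  have hN0 : (0 : ℝ) < N := lt_of_le_of_lt (by positivity) hN
  refine ⟨1 / (3 * N), by positivity, fun e he s => ?_⟩
  set η : ℝ := 1 / (3 * N) with hη
  have hη0 : 0 < η := by positivity
  set A := truncatedSlab R η e s with hA
  let B : ℕ → Set Vel := fun k => (fun w => (-(3 * η * k)) • e + w) ⁻¹' A
  have hBvol (k : ℕ) : volume (B k) = volume A := measure_preimage_add volume _ A
  have hBmeas (k : ℕ) : MeasurableSet (B k) :=
    (measurable_const_add _) (measurableSet_truncatedSlab R η e s)
  have hinner (k : ℕ) (w : Vel) : ⟪(-(3 * η * k)) • e + w, e⟫ = ⟪w, e⟫ - 3 * η * k := by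
    rw [inner_add_left, inner_smul_left, real_inner_self_eq_norm_sq, he]
    simp
    ring
  have hdisj : Set.PairwiseDisjoint (Finset.range N : Set ℕ) B := by
    intro k _ l _ hkl
    rw [Function.onFun, Set.disjoint_left]
    rintro w ⟨-, h1⟩ ⟨-, h2⟩
    rw [hinner] at h1 h2
    have h3 : |3 * η * ((k : ℝ) - l)| ≤ 2 * η := by
      calc |3 * η * ((k : ℝ) - l)|
          = |(⟪w, e⟫ - 3 * η * l - s) - (⟪w, e⟫ - 3 * η * k - s)| := by ring_nf
        _ ≤ η + η := (abs_sub _ _).trans (add_le_add h2 h1)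
        _ = 2 * η := by ring
    have h4 : (1 : ℝ) ≤ |(k : ℝ) - l| := by
      have : (1 : ℤ) ≤ |(k : ℤ) - l| := Int.one_le_abs (by omega)
      exact_mod_cast this
    rw [abs_mul, abs_of_pos (by positivity : 0 < 3 * η)] at h3
    nlinarith
  have hsub : (⋃ k ∈ Finset.range N, B k) ⊆ Metric.closedBall (0 : Vel) (R + 1) := by
    intro w hw
    simp only [Set.mem_iUnion, Finset.mem_range] at hw
    obtain ⟨k, hk, hw⟩ := hw
    have h1 : ‖(-(3 * η * k)) • e + w‖ ≤ R := hw.1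
    have h2 : ‖(3 * η * k) • e‖ ≤ 1 := by
      rw [norm_smul, he, mul_one, Real.norm_of_nonneg (by positivity), hη]
      have : (k : ℝ) ≤ N := by exact_mod_cast hk.le
      rw [show 3 * (1 / (3 * (N : ℝ))) * k = k / N by field_simp, div_le_one hN0]
      exact this
    rw [mem_closedBall_zero_iff]
    calc ‖w‖ = ‖((-(3 * η * k)) • e + w) + (3 * η * k) • e‖ := by
          congr 1
          module
      _ ≤ R + 1 := (norm_add_le _ _).trans (add_le_add h1 h2)
  have hsum : (N : ℝ≥0∞) * volume A ≤ volume (Metric.closedBall (0 : Vel) (R + 1)) := by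
    have := measure_mono (μ := volume) hsub
    rw [measure_biUnion_finset hdisj fun k _ => hBmeas k] at this
    simpa [hBvol] using this
  have hreal : (N : ℝ) * volume.real A ≤ volume.real (Metric.closedBall (0 : Vel) (R + 1)) := by
    have := ENNReal.toReal_mono (measure_closedBall_lt_top (x := (0 : Vel)) (r := R + 1)).ne hsum
    simpa [Measure.real] using this
  rw [div_lt_iff₀ hδ] at hN
  by_contra! hlt
  have := mul_lt_mul_of_pos_left hlt hN0
  linarith

/-- Under hydrodynamic bounds, a fixed ball contains at least half of the mass, and the mass in it
is spread out in every direction. -/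
lemma exists_spread_of_hydrodynamicBounds (m₀ M₀ E₀ H₀ : ℝ) (hm₀ : 0 < m₀) :
    ∃ R κ : ℝ, 1 ≤ R ∧ 0 < κ ∧ ∀ f : Vel → ℝ, HydrodynamicBounds m₀ M₀ E₀ H₀ f →
      ∀ φ : Vel → ℝ, Continuous φ → HasCompactSupport φ → (∀ w, 0 ≤ φ w) →
        (∀ w, ‖w‖ ≤ R → φ w = 1) →
      m₀ / 2 ≤ ∫ w, f w * φ w ∧
      ∀ e : Vel, ‖e‖ = 1 → ∀ s : ℝ, κ ≤ ∫ w, f w * (φ w * (⟪w, e⟫ - s) ^ 2) := by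
  -- by Chebyshev's inequality, at most half of the mass lies outside the ball of radius `R`
  set R : ℝ := 1 + 2 * |E₀| / m₀ with hR
  have hR1 : 1 ≤ R := by
    have : 0 ≤ 2 * |E₀| / m₀ := by positivity
    linarith
  have hER : E₀ / R ^ 2 ≤ m₀ / 2 := by
    rw [div_le_iff₀ (by positivity)]
    have h1 : 2 * |E₀| / m₀ ≤ R ^ 2 := by nlinarith
    rw [div_le_iff₀ hm₀] at h1
    linarith [le_abs_self E₀]
  set Γ := ∫ v : Vel, Real.exp (-1 * ‖v‖ ^ 2) with hΓ
  -- slabs of measure at most `exp (-K)` carry at most a quarter of the mass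
  set K : ℝ := 8 * (|H₀ + E₀ + Γ| + 1) / m₀ with hK
  have hK0 : 0 < K := by positivity
  obtain ⟨η, hη0, hη⟩ := exists_volume_truncatedSlab_le R (δ := Real.exp (-K)) (Real.exp_pos _)
  have slab (f : Vel → ℝ) (hf : HydrodynamicBounds m₀ M₀ E₀ H₀ f) (e : Vel) (he : ‖e‖ = 1)
      (s : ℝ) : ∫ v, (truncatedSlab R η e s).indicator f v ≤ m₀ / 4 := by
    have h1 := hf.integral_indicator_le (measurableSet_truncatedSlab R η e s)
      (volume_truncatedSlab_ne_top R η e s) K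
    have h2 : Real.exp K * volume.real (truncatedSlab R η e s) ≤ 1 := by
      calc Real.exp K * volume.real (truncatedSlab R η e s) ≤ Real.exp K * Real.exp (-K) := by
            gcongr
            exact hη e he s
        _ = 1 := by rw [← Real.exp_add]; simp
    have h3 : K * (m₀ / 4) = 2 * (|H₀ + E₀ + Γ| + 1) := by
      rw [hK]
      field_simp
      norm_num
    refine le_of_mul_le_mul_left (a := K) ?_ hK0
    rw [h3]
    linarith [le_abs_self (H₀ + E₀ + Γ), abs_nonneg (H₀ + E₀ + Γ)]
  refine ⟨R, η ^ 2 * (m₀ / 4), hR1, by positivity, fun f hf φ hφ hc hφ0 hφ1 => ⟨?_, ?_⟩⟩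
  · have i1 : Integrable (fun w => f w * φ w) volume :=
      hf.integrable_mass.locallyIntegrable.integrable_smul_right_of_hasCompactSupport hφ hc
    have i2 : Integrable (fun w => f w - (f w * ‖w‖ ^ 2) / R ^ 2) volume :=
      hf.integrable_mass.sub (hf.integrable_energy.div_const _)
    have hle := integral_mono i2 i1 fun w => by
      have h0 := hf.nonneg w
      by_cases hw : ‖w‖ ≤ R
      · simp only [hφ1 w hw, mul_one]
        have : 0 ≤ f w * ‖w‖ ^ 2 / R ^ 2 := by positivity
        linarith
      · have h1 : R ^ 2 ≤ ‖w‖ ^ 2 := by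
          have := not_le.1 hw
          gcongr
        have h2 : f w ≤ f w * ‖w‖ ^ 2 / R ^ 2 := by
          rw [le_div_iff₀ (by positivity)]
          gcongr
        have h3 := mul_nonneg h0 (hφ0 w)
        simp only
        linarith
    rw [integral_sub hf.integrable_mass (hf.integrable_energy.div_const _),
      integral_div] at hle
    have h4 : (∫ w, f w * ‖w‖ ^ 2) / R ^ 2 ≤ E₀ / R ^ 2 := by
      gcongr
      exact hf.energy_le
    linarith [hf.le_mass]
  · intro e he s
    set A := truncatedSlab R η e s with hA
    have hAm : MeasurableSet A := measurableSet_truncatedSlab R η e s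
    have i1 : Integrable (fun w => f w * (φ w * (⟪w, e⟫ - s) ^ 2)) volume :=
      hf.integrable_mass.locallyIntegrable.integrable_smul_right_of_hasCompactSupport
        (by fun_prop) hc.mul_right
    have i3 : Integrable (fun w => f w - (f w * ‖w‖ ^ 2) / R ^ 2) volume :=
      hf.integrable_mass.sub (hf.integrable_energy.div_const _)
    have i4 : Integrable (fun w => f w - (f w * ‖w‖ ^ 2) / R ^ 2 - A.indicator f w) volume :=
      i3.sub (hf.integrable_mass.indicator hAm)
    have hle := integral_mono (i4.const_mul (η ^ 2)) i1 fun w => by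
      have h0 := hf.nonneg w
      have h5 : 0 ≤ f w * ‖w‖ ^ 2 / R ^ 2 := by positivity
      have h6 : 0 ≤ f w * (φ w * (⟪w, e⟫ - s) ^ 2) :=
        mul_nonneg h0 (mul_nonneg (hφ0 w) (sq_nonneg _))
      by_cases hwA : w ∈ A
      · simp only [Set.indicator_of_mem hwA]
        have h7 : η ^ 2 * (f w - f w * ‖w‖ ^ 2 / R ^ 2 - f w) ≤ 0 :=
          mul_nonpos_of_nonneg_of_nonpos (by positivity) (by linarith)
        linarith
      · simp only [Set.indicator_of_notMem hwA]
        by_cases hw : ‖w‖ ≤ R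
        · have h7 : η < |⟪w, e⟫ - s| := by
            by_contra hcon
            exact hwA ⟨hw, not_lt.1 hcon⟩
          have h8 : η ^ 2 ≤ (⟪w, e⟫ - s) ^ 2 := by
            rw [← sq_abs (⟪w, e⟫ - s)]
            gcongr
          rw [hφ1 w hw, one_mul]
          calc η ^ 2 * (f w - f w * ‖w‖ ^ 2 / R ^ 2 - 0) ≤ η ^ 2 * f w := by
                gcongr
                linarith
            _ ≤ f w * (⟪w, e⟫ - s) ^ 2 := by
                rw [mul_comm]
                gcongr
        · have h1 : R ^ 2 ≤ ‖w‖ ^ 2 := by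
            have := not_le.1 hw
            gcongr
          have h2 : f w ≤ f w * ‖w‖ ^ 2 / R ^ 2 := by
            rw [le_div_iff₀ (by positivity)]
            gcongr
          have h7 : η ^ 2 * (f w - f w * ‖w‖ ^ 2 / R ^ 2 - 0) ≤ 0 :=
            mul_nonpos_of_nonneg_of_nonpos (by positivity) (by linarith)
          linarith
    rw [integral_const_mul, integral_sub i3 (hf.integrable_mass.indicator hAm),
      integral_sub hf.integrable_mass (hf.integrable_energy.div_const _), integral_div] at hle
    have h4 : (∫ w, f w * ‖w‖ ^ 2) / R ^ 2 ≤ E₀ / R ^ 2 := by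
      gcongr
      exact hf.energy_le
    refine le_trans ?_ hle
    gcongr
    linarith [hf.le_mass, slab f hf e he s]

/-! ### The pointwise bound for the logarithmic gradient -/

/-- The bounds `|∇f|² ≤ f J` and `|v ∧ ∇f|² ≤ f J` at `v`, for a gradient given as a functional
`L`. The second one expresses that the derivatives of `f` along spheres decay faster by a factor
`|v|` than its radial derivative. -/
def GradientBound (s : ℝ≥0∞) (v : Vel) (L : Vel → ℝ) (J : ℝ≥0∞) : Prop :=
  ∀ α β : Vel, ‖α‖ ≤ 1 → ‖β‖ ≤ 1 → ENNReal.ofReal (L β ^ 2) ≤ s * J ∧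
    ENNReal.ofReal (wedge v L α β ^ 2) ≤ s * J

lemma exists_unit_orthogonal (b : Vel) : ∃ e : Vel, ‖e‖ = 1 ∧ ⟪b, e⟫ = 0 := by
  by_cases hb : b = 0
  · exact ⟨EuclideanSpace.single 0 1, by simp, by simp [hb]⟩
  · have : Fact (Module.finrank ℝ Vel = 2 + 1) := ⟨by simp⟩
    have h2 := Submodule.finrank_orthogonal_span_singleton (𝕜 := ℝ) (n := 2) hb
    have : Nontrivial (Submodule.span ℝ {b})ᗮ :=
      Module.nontrivial_of_finrank_pos (R := ℝ) (by rw [h2]; norm_num)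
    obtain ⟨x, hx⟩ := exists_norm_eq (Submodule.span ℝ {b})ᗮ (zero_le_one (α := ℝ))
    exact ⟨x, hx, Submodule.mem_orthogonal_singleton_iff_inner_right.1 x.2⟩

set_option maxHeartbeats 800000 in
/-- The test function `φ` and its first moment bound the logarithmic gradient by the dissipation
density. For a unit vector `e` orthogonal to the logarithmic gradient `b`, testing with the
centred first moment `φ (⟪w, e⟫ - s)` leaves only the variance in direction `e` times `|b|²`. -/
theorem exists_gradientBound_logGrad (m₀ M₀ E₀ H₀ : ℝ) (hm₀ : 0 < m₀) :
    ∃ C : ℝ, 0 < C ∧ ∀ (f : Vel → ℝ) (G : Vel → Vel), HydrodynamicBounds m₀ M₀ E₀ H₀ f →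
      IsWeakGradient f G → ∀ v : Vel,
        GradientBound (ENNReal.ofReal C) v (fun e => ⟪logGrad f G v, e⟫) (gradMajorant f G v) := by
  obtain ⟨R, κ, hR1, hκ, hspread⟩ := exists_spread_of_hydrodynamicBounds m₀ M₀ E₀ H₀ hm₀
  let φ : ContDiffBump (0 : Vel) := ⟨R, 2 * R, by linarith, by linarith⟩
  have hφs : ContDiff ℝ ∞ φ := φ.contDiff
  have hφc : HasCompactSupport φ := φ.hasCompactSupport
  have hφ0 (w : Vel) : 0 ≤ φ w := φ.nonneg
  have hφle (w : Vel) : |φ w| ≤ 1 := by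
    rw [abs_of_nonneg (hφ0 w)]
    exact φ.le_one
  have hφ1 (w : Vel) (hw : ‖w‖ ≤ R) : φ w = 1 :=
    φ.one_of_mem_closedBall (mem_closedBall_zero_iff.2 hw)
  have hφ2 (w : Vel) (hw : 2 * R < ‖w‖) : φ w = 0 :=
    φ.zero_of_le_dist (by rw [dist_zero_right]; exact hw.le)
  obtain ⟨B, hB⟩ := (hφc.fderiv ℝ).exists_bound_of_continuous (hφs.continuous_fderiv (by simp))
  have hB0 : 0 ≤ B := (norm_nonneg _).trans (hB 0)
  set K : ℝ := 4 * R * B + 4 * R with hK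
  have hK0 : 0 < K := by positivity
  have hRB : B ≤ 4 * R * B := le_mul_of_one_le_left hB0 (by linarith)
  set C1 : ℝ := 32 * M₀ ^ 2 * K ^ 2 * (2 * R) ^ 2 + 16 * |M₀| * K ^ 2 * (2 * R) ^ 3 with hC1
  have hC10 : 0 ≤ C1 := by positivity
  refine ⟨C1 / κ ^ 2 + 4 / m₀ ^ 2 * (2 * C1 + 32 * R ^ 2 * M₀ ^ 2 * (C1 / κ ^ 2)) + 1,
    by positivity, fun f G hf hG v α β hα hβ => ?_⟩
  have hM0 : 0 ≤ M₀ := (integral_nonneg hf.nonneg).trans hf.mass_le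
  obtain ⟨hm, hvar⟩ := hspread f hf φ hφs.continuous hφc hφ0 hφ1
  set b := logGrad f G v with hb
  set m := ∫ w, f w * φ w with hmdef
  have hm0 : 0 < m := by linarith
  rcases eq_or_ne (gradMajorant f G v) ⊤ with htop | htop
  · rw [htop, ENNReal.mul_top (by simp; positivity)]
    exact ⟨le_top, le_top⟩
  set θ := (gradMajorant f G v).toReal with hθ
  have hθ0 : 0 ≤ θ := ENNReal.toReal_nonneg
  have hθeq : gradMajorant f G v = ENNReal.ofReal θ := (ENNReal.ofReal_toReal htop).symm
  -- the estimate of the tested bivector, as an inequality between real numbers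
  have test (ψ : Vel → ℝ) (hψ : ContDiff ℝ ∞ ψ) (hs : ∀ w, 2 * R < ‖w‖ → ψ w = 0)
      (h1 : ∀ w, |ψ w| ≤ K) (h2 : ∀ w, ‖fderiv ℝ ψ w‖ ≤ K) (α β : Vel) :
      ((∫ w, f w * ψ w * ⟪v - w, α⟫) * ⟪b, β⟫ - (∫ w, f w * ψ w * ⟪v - w, β⟫) * ⟪b, α⟫) ^ 2
        ≤ C1 * (‖α‖ * ‖β‖) ^ 2 * θ := by
    have := hG.sq_wedge_le hf.nonneg hf.integrable_mass hf.mass_le hψ (by linarith : 1 ≤ 2 * R)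
      hs h1 h2 v α β
    rw [hθeq, ← ENNReal.ofReal_mul (by positivity)] at this
    have h3 := (ENNReal.ofReal_le_ofReal_iff (by positivity)).1 this
    rwa [hC1, abs_of_nonneg hM0]
  have iφ (g : Vel → ℝ) (hg : Continuous g) : Integrable (fun w => f w * (φ w * g w)) volume :=
    hf.integrable_mass.locallyIntegrable.integrable_smul_right_of_hasCompactSupport
      (hφs.continuous.mul hg) hφc.mul_right
  set p : Vel → ℝ := fun γ => ∫ w, f w * (φ w * ⟪w, γ⟫) with hp
  have im : Integrable (fun w => f w * φ w) volume := by
    simpa using iφ (fun _ => 1) continuous_const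
  have mle : m ≤ M₀ := by
    refine (integral_mono im hf.integrable_mass fun w => ?_).trans hf.mass_le
    exact mul_le_of_le_one_right (hf.nonneg w) φ.le_one
  have hpabs (γ : Vel) : |p γ| ≤ m * (2 * R * ‖γ‖) := by
    rw [hp, hmdef, ← integral_mul_const, ← Real.norm_eq_abs]
    refine norm_integral_le_of_norm_le (im.mul_const _) (Eventually.of_forall fun w => ?_)
    rw [norm_mul, norm_mul, Real.norm_of_nonneg (hf.nonneg w), Real.norm_of_nonneg (hφ0 w),
      ← mul_assoc]
    by_cases hw : ‖w‖ ≤ 2 * R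
    · refine mul_le_mul_of_nonneg_left ?_ (mul_nonneg (hf.nonneg w) (hφ0 w))
      exact (abs_real_inner_le_norm w γ).trans (by gcongr)
    · rw [hφ2 w (not_le.1 hw)]
      simp
  have hbsq : ‖b‖ ^ 2 ≤ C1 / κ ^ 2 * θ := by
    rcases eq_or_ne b 0 with hb0 | hb0
    · rw [hb0]
      simp
      positivity
    obtain ⟨e, he, hbe⟩ := exists_unit_orthogonal b
    set s := p e / m with hs
    have hsabs : |s| ≤ 2 * R := by
      rw [hs, abs_div, abs_of_pos hm0, div_le_iff₀ hm0]
      have := hpabs e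
      rw [he] at this
      linarith
    set ψ : Vel → ℝ := fun w => φ w * (⟪w, e⟫ - s) with hψdef
    have hlin (w : Vel) : HasFDerivAt (fun w => ⟪w, e⟫ - s) (innerSL ℝ e) w := by
      have h3 : (fun w => ⟪w, e⟫ - s) = fun w => innerSL ℝ e w - s := by
        ext w
        rw [innerSL_apply_apply, real_inner_comm]
      rw [h3]
      exact (innerSL ℝ e).hasFDerivAt.sub_const s
    have hψs : ContDiff ℝ ∞ ψ :=
      hφs.mul ((contDiff_id.inner ℝ contDiff_const).sub contDiff_const)
    have hfac (w : Vel) (hw : ‖w‖ ≤ 2 * R) : |⟪w, e⟫ - s| ≤ 4 * R := by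
      have h1 := abs_real_inner_le_norm w e
      rw [he, mul_one] at h1
      calc |⟪w, e⟫ - s| ≤ |⟪w, e⟫| + |s| := abs_sub _ _
        _ ≤ 2 * R + 2 * R := add_le_add (h1.trans hw) hsabs
        _ = 4 * R := by ring
    have hψ0 (w : Vel) (hw : 2 * R < ‖w‖) : ψ w = 0 := by simp [hψdef, hφ2 w hw]
    have hψK (w : Vel) : |ψ w| ≤ K := by
      by_cases hw : ‖w‖ ≤ 2 * R
      · rw [hψdef]
        simp only
        rw [abs_mul]
        calc |φ w| * |⟪w, e⟫ - s| ≤ 1 * (4 * R) := by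
              gcongr
              · exact hφle w
              · exact hfac w hw
          _ ≤ K := by
              have : 0 ≤ 4 * R * B := by positivity
              linarith
      · rw [hψ0 w (not_le.1 hw), abs_zero]
        exact hK0.le
    have hψK' (w : Vel) : ‖fderiv ℝ ψ w‖ ≤ K := by
      by_cases hw : ‖w‖ ≤ 2 * R
      · have h4 : HasFDerivAt ψ (φ w • innerSL ℝ e + (⟪w, e⟫ - s) • fderiv ℝ φ w) w :=
          (hφs.differentiable (by simp) w).hasFDerivAt.mul (hlin w)
        rw [h4.fderiv]
        refine (norm_add_le _ _).trans ?_
        rw [norm_smul, norm_smul, innerSL_apply_norm, he]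
        calc ‖φ w‖ * 1 + ‖⟪w, e⟫ - s‖ * ‖fderiv ℝ φ w‖ ≤ 1 * 1 + 4 * R * B := by
              gcongr
              · exact hφle w
              · exact hfac w hw
              · exact hB w
          _ ≤ K := by linarith
      · have h0 : fderiv ℝ ψ w = 0 := by
          have : ψ =ᶠ[𝓝 w] fun _ => 0 := by
            have hopen : IsOpen {w : Vel | 2 * R < ‖w‖} := isOpen_lt continuous_const continuous_norm
            filter_upwards [hopen.mem_nhds (not_le.1 hw)] with u hu using hψ0 u hu
          rw [this.fderiv_eq]
          simp
        rw [h0, norm_zero]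
        exact hK0.le
    have key := test ψ hψs hψ0 hψK hψK' e b
    have hcentre : ∫ w, f w * ψ w = 0 := by
      have h1 (w : Vel) : f w * ψ w = f w * (φ w * ⟪w, e⟫) - f w * φ w * s := by
        rw [hψdef]
        ring
      simp_rw [h1]
      rw [integral_sub (iφ _ (by fun_prop)) (im.mul_const s), integral_mul_const]
      change p e - m * s = 0
      rw [hs, mul_div_cancel₀ _ hm0.ne', sub_self]
    have iψ : Integrable (fun w => f w * ψ w) volume := iφ (fun w => ⟪w, e⟫ - s) (by fun_prop)
    have hPe : ∫ w, f w * ψ w * ⟪v - w, e⟫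
        = -∫ w, f w * (φ w * (⟪w, e⟫ - s) ^ 2) := by
      have h1 (w : Vel) : f w * ψ w * ⟪v - w, e⟫
          = f w * ψ w * (⟪v, e⟫ - s) - f w * (φ w * (⟪w, e⟫ - s) ^ 2) := by
        rw [hψdef, inner_sub_left]
        ring
      simp_rw [h1]
      rw [integral_sub (iψ.mul_const _) (iφ (fun w => (⟪w, e⟫ - s) ^ 2) (by fun_prop)),
        integral_mul_const, hcentre]
      ring
    rw [hPe, hbe, mul_zero, sub_zero, real_inner_self_eq_norm_sq, he, one_mul] at key
    have hv := hvar e he s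
    set V := ∫ w, f w * (φ w * (⟪w, e⟫ - s) ^ 2) with hV
    have hnb : 0 < ‖b‖ ^ 2 := by
      have := norm_pos_iff.2 hb0
      positivity
    have h5 : κ ^ 2 * ‖b‖ ^ 2 ≤ C1 * θ := by
      refine le_of_mul_le_mul_right (a := ‖b‖ ^ 2) ?_ hnb
      calc κ ^ 2 * ‖b‖ ^ 2 * ‖b‖ ^ 2 ≤ V ^ 2 * ‖b‖ ^ 2 * ‖b‖ ^ 2 := by gcongr
        _ = (-V * ‖b‖ ^ 2) ^ 2 := by ring
        _ ≤ C1 * ‖b‖ ^ 2 * θ := key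
        _ = C1 * θ * ‖b‖ ^ 2 := by ring
    rw [div_mul_eq_mul_div, le_div_iff₀ (by positivity)]
    linarith
  have hnβ : ⟪b, β⟫ ^ 2 ≤ ‖b‖ ^ 2 := by
    have := abs_real_inner_le_norm b β
    rw [← sq_abs]
    refine pow_le_pow_left₀ (abs_nonneg _) (this.trans ?_) 2
    exact mul_le_of_le_one_right (norm_nonneg _) hβ
  have hθ2 : 0 ≤ 4 / m₀ ^ 2 * (2 * C1 + 32 * R ^ 2 * M₀ ^ 2 * (C1 / κ ^ 2)) * θ := by positivity
  have hθ3 : 0 ≤ C1 / κ ^ 2 * θ := by positivity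
  rw [hθeq, ← ENNReal.ofReal_mul (by positivity)]
  refine ⟨ENNReal.ofReal_le_ofReal ?_, ENNReal.ofReal_le_ofReal ?_⟩
  · linarith
  · have key := test φ hφs hφ2 (fun w => (hφle w).trans (by
      have : 0 ≤ 4 * R * B := by positivity
      linarith)) (fun w => (hB w).trans (by linarith)) α β
    have hP (γ : Vel) : ∫ w, f w * φ w * ⟪v - w, γ⟫ = m * ⟪v, γ⟫ - p γ := by
      have h1 (w : Vel) : f w * φ w * ⟪v - w, γ⟫
          = f w * φ w * ⟪v, γ⟫ - f w * (φ w * ⟪w, γ⟫) := by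
        rw [inner_sub_left]
        ring
      simp_rw [h1]
      rw [integral_sub (im.mul_const _) (iφ _ (by fun_prop)), integral_mul_const]
    rw [hP, hP] at key
    set X := (m * ⟪v, α⟫ - p α) * ⟪b, β⟫ - (m * ⟪v, β⟫ - p β) * ⟪b, α⟫ with hX
    set Y := p α * ⟪b, β⟫ - p β * ⟪b, α⟫ with hY
    have hw : m * wedge v (fun e => ⟪b, e⟫) α β = X + Y := by
      rw [hX, hY, wedge]
      ring
    have hX2 : X ^ 2 ≤ C1 * θ := by
      refine key.trans ?_
      have : (‖α‖ * ‖β‖) ^ 2 ≤ 1 := by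
        refine pow_le_one₀ (by positivity) ?_
        exact mul_le_one₀ hα (norm_nonneg _) hβ
      calc C1 * (‖α‖ * ‖β‖) ^ 2 * θ ≤ C1 * 1 * θ := by gcongr
        _ = C1 * θ := by ring
    have hpγ (γ : Vel) (hγ : ‖γ‖ ≤ 1) : |p γ| ≤ 2 * R * M₀ := by
      refine (hpabs γ).trans ?_
      calc m * (2 * R * ‖γ‖) ≤ M₀ * (2 * R * 1) := by gcongr
        _ = 2 * R * M₀ := by ring
    have hbγ (γ : Vel) (hγ : ‖γ‖ ≤ 1) : |⟪b, γ⟫| ≤ ‖b‖ :=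
      (abs_real_inner_le_norm b γ).trans (mul_le_of_le_one_right (norm_nonneg _) hγ)
    have hY1 : |Y| ≤ 4 * R * M₀ * ‖b‖ := by
      calc |Y| ≤ |p α| * |⟪b, β⟫| + |p β| * |⟪b, α⟫| := by
            rw [hY, ← abs_mul, ← abs_mul]
            exact abs_sub _ _
        _ ≤ 2 * R * M₀ * ‖b‖ + 2 * R * M₀ * ‖b‖ := by
            gcongr
            · exact hpγ α hα
            · exact hbγ β hβ
            · exact hpγ β hβ
            · exact hbγ α hα
        _ = _ := by ring
    have hY2 : Y ^ 2 ≤ 16 * R ^ 2 * M₀ ^ 2 * (C1 / κ ^ 2 * θ) := by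
      rw [← sq_abs]
      calc |Y| ^ 2 ≤ (4 * R * M₀ * ‖b‖) ^ 2 := by gcongr
        _ = 16 * R ^ 2 * M₀ ^ 2 * ‖b‖ ^ 2 := by ring
        _ ≤ _ := by gcongr
    set W := wedge v (fun e => ⟪b, e⟫) α β with hW
    have h6 : (m₀ / 2) ^ 2 * W ^ 2 ≤ (2 * C1 + 32 * R ^ 2 * M₀ ^ 2 * (C1 / κ ^ 2)) * θ := by
      calc (m₀ / 2) ^ 2 * W ^ 2 ≤ m ^ 2 * W ^ 2 := by gcongr
        _ = (X + Y) ^ 2 := by rw [← mul_pow, hw]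
        _ ≤ 2 * X ^ 2 + 2 * Y ^ 2 := by nlinarith [sq_nonneg (X - Y)]
        _ ≤ 2 * (C1 * θ) + 2 * (16 * R ^ 2 * M₀ ^ 2 * (C1 / κ ^ 2 * θ)) := by gcongr
        _ = _ := by ring
    have h7 : W ^ 2 ≤ 4 / m₀ ^ 2 * (2 * C1 + 32 * R ^ 2 * M₀ ^ 2 * (C1 / κ ^ 2)) * θ := by
      rw [mul_assoc, div_mul_eq_mul_div, le_div_iff₀ (by positivity)]
      calc W ^ 2 * m₀ ^ 2 = 4 * ((m₀ / 2) ^ 2 * W ^ 2) := by ring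
        _ ≤ _ := mul_le_mul_of_nonneg_left h6 (by norm_num)
    linarith

/-! ### An anisotropic Sobolev inequality in a spherical chart -/

/-- The positive part squared is differentiable. -/
lemma hasDerivAt_sq_max_zero (s : ℝ) :
    HasDerivAt (fun s : ℝ => max s 0 ^ 2) (2 * max s 0) s := by
  have hne (y : ℝ) (hy : y ≠ 0) : HasDerivAt (fun s : ℝ => max s 0 ^ 2) (2 * max y 0) y := by
    rcases lt_or_gt_of_ne hy with h | h
    · rw [max_eq_right h.le, mul_zero]
      refine (hasDerivAt_const y (0 : ℝ)).congr_of_eventuallyEq ?_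
      filter_upwards [Iio_mem_nhds h] with u hu
      rw [max_eq_right (le_of_lt hu)]
      norm_num
    · rw [max_eq_left h.le]
      have h1 : HasDerivAt (fun s : ℝ => s ^ 2) (2 * y) y := by
        simpa using hasDerivAt_pow 2 y
      refine h1.congr_of_eventuallyEq ?_
      filter_upwards [Ioi_mem_nhds h] with u hu
      rw [max_eq_left (le_of_lt hu)]
  by_cases hs : s = 0
  · rw [hs]
    refine hasDerivAt_of_hasDerivAt_of_ne (f := fun s : ℝ => max s 0 ^ 2)
      (g := fun s => 2 * max s 0) hne ?_ ?_
    · exact Continuous.continuousAt (by fun_prop)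
    · exact Continuous.continuousAt (by fun_prop)
  · exact hne s hs

/-- A differentiable function with a zero is bounded by the integral of its derivative. -/
lemma ofReal_le_lintegral_of_hasDerivAt {h h' : ℝ → ℝ} (hd : ∀ t, HasDerivAt h (h' t) t) {a : ℝ}
    (ha : h a = 0) {w : ℝ → ℝ≥0∞} (hw : ∀ t, ENNReal.ofReal |h' t| ≤ w t) (t : ℝ) :
    ENNReal.ofReal (h t) ≤ ∫⁻ s, w s := by
  have hderiv : deriv h = h' := funext fun s => (hd s).deriv
  have hmeas : Measurable h' := hderiv ▸ measurable_deriv h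
  refine le_trans ?_ (lintegral_mono hw)
  rcases eq_or_ne (∫⁻ s, ENNReal.ofReal |h' s|) ⊤ with htop | htop
  · rw [htop]
    exact le_top
  have hint : Integrable h' volume := by
    refine ⟨hmeas.aestronglyMeasurable, ?_⟩
    rw [HasFiniteIntegral]
    simpa only [Real.enorm_eq_ofReal_abs] using htop.lt_top
  have hftc : ∫ s in a..t, h' s = h t - h a :=
    intervalIntegral.integral_eq_sub_of_hasDerivAt (fun s _ => hd s) hint.intervalIntegrable
  rw [ha, sub_zero] at hftc
  have hle : h t ≤ ∫ s, |h' s| := by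
    rw [← hftc]
    have hn := intervalIntegral.norm_integral_le_integral_norm_uIoc (f := h') (a := a) (b := t)
      (μ := volume)
    refine (le_abs_self _).trans (hn.trans ?_)
    exact setIntegral_le_integral hint.norm (Eventually.of_forall fun s => norm_nonneg _)
  refine (ENNReal.ofReal_le_ofReal hle).trans ?_
  rw [ofReal_integral_eq_lintegral_ofReal hint.abs (Eventually.of_forall fun s => abs_nonneg _)]

/-- The point `v` with first coordinates `x`, `y` and distance `r` to `(0, 0, -2)`, on the upper
half of the sphere. In the chart `(x, y, r)` the coordinate fields of `x` and `y` are tangent to the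
spheres around `(0, 0, -2)`; this centre lies away from the region on which the chart is used. -/
noncomputable def sphericalChart (x y r : ℝ) : Vel :=
  x • EuclideanSpace.single 0 1 + y • EuclideanSpace.single 1 1
    + (√(r ^ 2 - x ^ 2 - y ^ 2) - 2) • EuclideanSpace.single 2 1

lemma sphericalChart_apply_zero (x y r : ℝ) : sphericalChart x y r 0 = x := by
  simp [sphericalChart]

lemma sphericalChart_apply_one (x y r : ℝ) : sphericalChart x y r 1 = y := by
  simp [sphericalChart]

lemma sphericalChart_apply_two (x y r : ℝ) :
    sphericalChart x y r 2 = √(r ^ 2 - x ^ 2 - y ^ 2) - 2 := by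
  simp [sphericalChart]

/-- A cutoff to the part `r > 1`, `4 (x² + y²) < 3 r²` of the chart, of homogeneity `6` in its
interior. -/
noncomputable def chartCutoff (x y r : ℝ) : ℝ :=
  max (3 * r ^ 2 - 4 * (x ^ 2 + y ^ 2)) 0 ^ 2 * max (r - 1) 0 ^ 2

lemma chartCutoff_nonneg (x y r : ℝ) : 0 ≤ chartCutoff x y r := by
  unfold chartCutoff
  positivity

/-- The density `f^{3/2} (J + f)^{1/2}` dominating the derivative of `f²`. -/
noncomputable def sobolevDensity (f : Vel → ℝ) (J : Vel → ℝ≥0∞) (v : Vel) : ℝ≥0∞ :=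
  ENNReal.ofReal (f v) ^ (3 / 2 : ℝ) * (J v + ENNReal.ofReal (f v)) ^ (1 / 2 : ℝ)

/-- The domain of the spherical chart. -/
def chartDomain : Set (Fin 3 → ℝ) := {x | 1 < x 2 ∧ 4 * (x 0 ^ 2 + x 1 ^ 2) < 3 * x 2 ^ 2}

/-- The density `r⁻⁴ f^{3/2} (J + f)^{1/2}` in the spherical chart. -/
noncomputable def chartDensity (f : Vel → ℝ) (J : Vel → ℝ≥0∞) : (Fin 3 → ℝ) → ℝ≥0∞ :=
  chartDomain.indicator fun x =>
    ENNReal.ofReal ((x 2 ^ 4)⁻¹) * sobolevDensity f J (sphericalChart (x 0) (x 1) (x 2))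

lemma ofReal_abs_le_rpow {l : ℝ} {T : ℝ≥0∞} (h : ENNReal.ofReal (l ^ 2) ≤ T) :
    ENNReal.ofReal |l| ≤ T ^ (1 / 2 : ℝ) := by
  rw [← sq_abs, ENNReal.ofReal_pow (abs_nonneg _)] at h
  calc ENNReal.ofReal |l| = (ENNReal.ofReal |l| ^ 2) ^ (1 / 2 : ℝ) := by
        rw [← ENNReal.rpow_natCast, ← ENNReal.rpow_mul]
        norm_num
    _ ≤ _ := ENNReal.rpow_le_rpow h (by norm_num)

/-- The derivative of `F² a` is dominated by `F^{3/2} (J + F)^{1/2}` when `F' = O((F J)^{1/2})`. -/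
lemma ofReal_abs_deriv_sq_mul_le {F F' a a' k c : ℝ} {J : ℝ≥0∞} (hF : 0 ≤ F) (ha : 0 ≤ a)
    (hF' : ENNReal.ofReal |F'| ≤ ENNReal.ofReal k * (ENNReal.ofReal F * J) ^ (1 / 2 : ℝ))
    (hk : a * k ≤ c) (hc : |a'| ≤ c) :
    ENNReal.ofReal |2 * F * F' * a + F ^ 2 * a'|
      ≤ ENNReal.ofReal (3 * c)
        * (ENNReal.ofReal F ^ (3 / 2 : ℝ) * (J + ENNReal.ofReal F) ^ (1 / 2 : ℝ)) := by
  have hc0 : 0 ≤ c := (abs_nonneg _).trans hc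
  set E := ENNReal.ofReal F ^ (3 / 2 : ℝ) * (J + ENNReal.ofReal F) ^ (1 / 2 : ℝ) with hE
  have e1 : ENNReal.ofReal F * (ENNReal.ofReal F * J) ^ (1 / 2 : ℝ) ≤ E := by
    rw [ENNReal.mul_rpow_of_nonneg _ _ (by norm_num), ← mul_assoc]
    have : ENNReal.ofReal F * ENNReal.ofReal F ^ (1 / 2 : ℝ) = ENNReal.ofReal F ^ (3 / 2 : ℝ) := by
      rw [show (3 / 2 : ℝ) = 1 + 1 / 2 by norm_num,
        ENNReal.rpow_add_of_nonneg _ _ (by norm_num) (by norm_num), ENNReal.rpow_one]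
    rw [this, hE]
    gcongr
    exact le_self_add
  have e2 : ENNReal.ofReal (F ^ 2) ≤ E := by
    have : ENNReal.ofReal (F ^ 2)
        = ENNReal.ofReal F ^ (3 / 2 : ℝ) * ENNReal.ofReal F ^ (1 / 2 : ℝ) := by
      rw [← ENNReal.rpow_add_of_nonneg _ _ (by norm_num) (by norm_num), ENNReal.ofReal_pow hF,
        ← ENNReal.rpow_natCast]
      norm_num
    rw [this, hE]
    gcongr
    exact le_add_self
  have b1 : ENNReal.ofReal |2 * F * F' * a| ≤ ENNReal.ofReal (2 * c) * E := by
    calc ENNReal.ofReal |2 * F * F' * a|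
        = ENNReal.ofReal (2 * F * a) * ENNReal.ofReal |F'| := by
          rw [← ENNReal.ofReal_mul (by positivity)]
          congr 1
          rw [abs_mul, abs_mul, abs_of_nonneg ha, abs_of_nonneg (by positivity : 0 ≤ 2 * F)]
          ring
      _ ≤ ENNReal.ofReal (2 * F * a)
          * (ENNReal.ofReal k * (ENNReal.ofReal F * J) ^ (1 / 2 : ℝ)) := by gcongr
      _ = ENNReal.ofReal (2 * (a * k))
          * (ENNReal.ofReal F * (ENNReal.ofReal F * J) ^ (1 / 2 : ℝ)) := by
          rw [← mul_assoc, ← mul_assoc, ← ENNReal.ofReal_mul (by positivity),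
            ← ENNReal.ofReal_mul' hF]
          congr 2
          ring
      _ ≤ _ := by gcongr
  have b2 : ENNReal.ofReal |F ^ 2 * a'| ≤ ENNReal.ofReal c * E := by
    rw [abs_mul, abs_of_nonneg (sq_nonneg F), mul_comm, ENNReal.ofReal_mul (abs_nonneg _)]
    gcongr
  calc ENNReal.ofReal |2 * F * F' * a + F ^ 2 * a'|
      ≤ ENNReal.ofReal (|2 * F * F' * a| + |F ^ 2 * a'|) :=
        ENNReal.ofReal_le_ofReal (abs_add_le _ _)
    _ ≤ ENNReal.ofReal (2 * c) * E + ENNReal.ofReal c * E := by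
        rw [ENNReal.ofReal_add (abs_nonneg _) (abs_nonneg _)]
        gcongr
    _ = _ := by
        rw [← add_mul, ← ENNReal.ofReal_add (by positivity) hc0]
        congr 2
        ring

section ChartEstimates

variable {x y r : ℝ}

/-- The bounds valid on the domain of the chart. -/
lemma chart_bounds (hr : 1 < r) (hxy : 4 * (x ^ 2 + y ^ 2) < 3 * r ^ 2) :
    r / 2 ≤ √(r ^ 2 - x ^ 2 - y ^ 2) ∧ |x| ≤ r ∧ |y| ≤ r
      ∧ max (3 * r ^ 2 - 4 * (x ^ 2 + y ^ 2)) 0 ≤ 3 * r ^ 2 ∧ max (r - 1) 0 ≤ r := by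
  refine ⟨?_, ?_, ?_, ?_, ?_⟩
  · apply Real.le_sqrt_of_sq_le
    nlinarith
  · apply abs_le_of_sq_le_sq _ (by linarith)
    nlinarith [sq_nonneg y]
  · apply abs_le_of_sq_le_sq _ (by linarith)
    nlinarith [sq_nonneg x]
  · exact max_le (by nlinarith [sq_nonneg x, sq_nonneg y]) (by positivity)
  · exact max_le (by linarith) (by linarith)

lemma hasDerivAt_sphericalChart_fst (h : 0 < r ^ 2 - x ^ 2 - y ^ 2) :
    HasDerivAt (fun t => sphericalChart t y r) (EuclideanSpace.single 0 1
      + (-x / √(r ^ 2 - x ^ 2 - y ^ 2)) • EuclideanSpace.single 2 1) x := by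
  have h1 : HasDerivAt (fun t => √(r ^ 2 - t ^ 2 - y ^ 2)) (-x / √(r ^ 2 - x ^ 2 - y ^ 2)) x := by
    have h2 : HasDerivAt (fun t : ℝ => r ^ 2 - t ^ 2 - y ^ 2) (-(2 * x)) x := by
      simpa using ((hasDerivAt_pow 2 x).const_sub (r ^ 2)).sub_const (y ^ 2)
    refine (h2.sqrt h.ne').congr_deriv ?_
    have := (Real.sqrt_pos.2 h).ne'
    field_simp
  have h3 := (((hasDerivAt_id x).smul_const (EuclideanSpace.single (0 : Fin 3) (1 : ℝ))).add_const
    (y • EuclideanSpace.single (1 : Fin 3) (1 : ℝ))).add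
      ((h1.sub_const 2).smul_const (EuclideanSpace.single (2 : Fin 3) (1 : ℝ)))
  rw [one_smul] at h3
  exact h3

lemma hasDerivAt_sphericalChart_snd (h : 0 < r ^ 2 - x ^ 2 - y ^ 2) :
    HasDerivAt (fun t => sphericalChart x t r) (EuclideanSpace.single 1 1
      + (-y / √(r ^ 2 - x ^ 2 - y ^ 2)) • EuclideanSpace.single 2 1) y := by
  have h1 : HasDerivAt (fun t => √(r ^ 2 - x ^ 2 - t ^ 2)) (-y / √(r ^ 2 - x ^ 2 - y ^ 2)) y := by
    have h2 : HasDerivAt (fun t : ℝ => r ^ 2 - x ^ 2 - t ^ 2) (-(2 * y)) y := by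
      simpa using (hasDerivAt_pow 2 y).const_sub (r ^ 2 - x ^ 2)
    refine (h2.sqrt h.ne').congr_deriv ?_
    have := (Real.sqrt_pos.2 h).ne'
    field_simp
  have h3 := (((hasDerivAt_id y).smul_const (EuclideanSpace.single (1 : Fin 3) (1 : ℝ))).const_add
    (x • EuclideanSpace.single (0 : Fin 3) (1 : ℝ))).add
      ((h1.sub_const 2).smul_const (EuclideanSpace.single (2 : Fin 3) (1 : ℝ)))
  rw [one_smul] at h3
  exact h3

lemma hasDerivAt_sphericalChart_radius (h : 0 < r ^ 2 - x ^ 2 - y ^ 2) :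
    HasDerivAt (fun t => sphericalChart x y t)
      ((r / √(r ^ 2 - x ^ 2 - y ^ 2)) • EuclideanSpace.single 2 1) r := by
  have h1 : HasDerivAt (fun t => √(t ^ 2 - x ^ 2 - y ^ 2)) (r / √(r ^ 2 - x ^ 2 - y ^ 2)) r := by
    have h2 : HasDerivAt (fun t : ℝ => t ^ 2 - x ^ 2 - y ^ 2) (2 * r) r := by
      simpa using ((hasDerivAt_pow 2 r).sub_const (x ^ 2)).sub_const (y ^ 2)
    refine (h2.sqrt h.ne').congr_deriv ?_
    have := (Real.sqrt_pos.2 h).ne'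
    field_simp
  exact ((h1.sub_const 2).smul_const (EuclideanSpace.single (2 : Fin 3) (1 : ℝ))).const_add
    (x • EuclideanSpace.single (0 : Fin 3) (1 : ℝ) + y • EuclideanSpace.single (1 : Fin 3) (1 : ℝ))

lemma ofReal_abs_tangential_le {s J : ℝ≥0∞} {L : Vel →L[ℝ] ℝ} {v : Vel} {z : ℝ} (i : Fin 3)
    (hv2 : v 2 = z - 2) (hz : 0 < z) (hL : GradientBound s v L J) :
    ENNReal.ofReal |L (EuclideanSpace.single i 1 + (-v i / z) • EuclideanSpace.single 2 1)|
      ≤ ENNReal.ofReal (3 / z) * (s * J) ^ (1 / 2 : ℝ) := by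
  obtain ⟨h1, h2⟩ := hL (EuclideanSpace.single 2 1) (EuclideanSpace.single i 1)
    (by simp) (by simp)
  have g1 := ofReal_abs_le_rpow h1
  have g2 := ofReal_abs_le_rpow h2
  have hw : wedge v L (EuclideanSpace.single 2 1) (EuclideanSpace.single i 1)
      = v 2 * L (EuclideanSpace.single i 1) - v i * L (EuclideanSpace.single 2 1) := by
    simp [wedge, EuclideanSpace.inner_single_right]
  set w := wedge v L (EuclideanSpace.single 2 1) (EuclideanSpace.single i 1)
  set l := L (EuclideanSpace.single i 1)
  have e : L (EuclideanSpace.single i 1 + (-v i / z) • EuclideanSpace.single 2 1)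
      = (1 / z) * (w + 2 * l) := by
    rw [map_add, map_smul, hw, hv2, smul_eq_mul]
    field_simp
    ring
  rw [e, abs_mul, abs_of_pos (by positivity : 0 < 1 / z)]
  calc ENNReal.ofReal (1 / z * |w + 2 * l|) ≤ ENNReal.ofReal (1 / z * (|w| + 2 * |l|)) := by
        refine ENNReal.ofReal_le_ofReal ?_
        gcongr
        refine (abs_add_le _ _).trans ?_
        rw [abs_mul, abs_two]
    _ = ENNReal.ofReal (1 / z) * (ENNReal.ofReal |w| + 2 * ENNReal.ofReal |l|) := by
        rw [ENNReal.ofReal_mul (by positivity), ENNReal.ofReal_add (by positivity) (by positivity),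
          ENNReal.ofReal_mul (by norm_num), ENNReal.ofReal_ofNat]
    _ ≤ ENNReal.ofReal (1 / z) * ((s * J) ^ (1 / 2 : ℝ) + 2 * (s * J) ^ (1 / 2 : ℝ)) := by
        gcongr
    _ = ENNReal.ofReal (1 / z) * (3 * (s * J) ^ (1 / 2 : ℝ)) := by ring
    _ = _ := by
        rw [← mul_assoc, ← ENNReal.ofReal_ofNat 3, ← ENNReal.ofReal_mul (by positivity)]
        congr 2
        ring

end ChartEstimates

/-- A nonnegative differentiable function `f` with `|∇f|², |v ∧ ∇f|² ≤ f J`. -/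
structure HasGradientMajorant (f : Vel → ℝ) (J : Vel → ℝ≥0∞) : Prop where
  differentiable : Differentiable ℝ f
  nonneg : ∀ v, 0 ≤ f v
  measurable : Measurable J
  bound : ∀ v, GradientBound (ENNReal.ofReal (f v)) v (fderiv ℝ f v) (J v)

/-! ### Derivative bounds in the chart -/

section ChartDerivatives

variable {f : Vel → ℝ} {J : Vel → ℝ≥0∞}

lemma ofReal_abs_deriv_le_chartDensity (hf : HasGradientMajorant f J) {x y r F' a a' k : ℝ}
    (ha : 0 ≤ a) (hin : 1 < r → 4 * (x ^ 2 + y ^ 2) < 3 * r ^ 2 →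
      ENNReal.ofReal |F'| ≤ ENNReal.ofReal k * (ENNReal.ofReal (f (sphericalChart x y r))
        * J (sphericalChart x y r)) ^ (1 / 2 : ℝ) ∧
      a * k ≤ 144 * (r ^ 4)⁻¹ ∧ |a'| ≤ 144 * (r ^ 4)⁻¹)
    (hout : r ≤ 1 ∨ 3 * r ^ 2 ≤ 4 * (x ^ 2 + y ^ 2) → a = 0 ∧ a' = 0) :
    ENNReal.ofReal |2 * f (sphericalChart x y r) * F' * a + f (sphericalChart x y r) ^ 2 * a'|
      ≤ 432 * chartDensity f J ![x, y, r] := by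
  by_cases hU : 1 < r ∧ 4 * (x ^ 2 + y ^ 2) < 3 * r ^ 2
  · obtain ⟨h1, h2, h3⟩ := hin hU.1 hU.2
    have hmem : ![x, y, r] ∈ chartDomain := hU
    rw [chartDensity, Set.indicator_of_mem hmem]
    refine (ofReal_abs_deriv_sq_mul_le (hf.nonneg _) ha h1 h2 h3).trans (le_of_eq ?_)
    have e : ENNReal.ofReal (3 * (144 * (r ^ 4)⁻¹)) = 432 * ENNReal.ofReal ((r ^ 4)⁻¹) := by
      rw [← ENNReal.ofReal_ofNat 432, ← ENNReal.ofReal_mul (by norm_num)]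
      congr 1
      ring
    rw [e, mul_assoc]
    rfl
  · rw [not_and_or, not_lt, not_lt] at hU
    obtain ⟨h1, h2⟩ := hout hU
    simp [h1, h2]

lemma cutoff_mul_le {r q p : ℝ} (hr : 1 < r) (hq0 : 0 ≤ q) (hp0 : 0 ≤ p) (hq : q ≤ 3 * r ^ 2)
    (hp : p ≤ r) : q ^ 2 * p ^ 2 ≤ 9 * r ^ 6 := by
  calc q ^ 2 * p ^ 2 ≤ (3 * r ^ 2) ^ 2 * r ^ 2 := by gcongr
    _ = 9 * r ^ 6 := by ring

lemma tangential_weight_le {r z q p : ℝ} (hr : 1 < r) (hz : r / 2 ≤ z) (hq0 : 0 ≤ q)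
    (hp0 : 0 ≤ p) (hq : q ≤ 3 * r ^ 2) (hp : p ≤ r) :
    q ^ 2 * p ^ 2 * (r ^ 9)⁻¹ * (3 / z) ≤ 144 * (r ^ 4)⁻¹ := by
  have hr0 : 0 < r := by linarith
  have h1 := cutoff_mul_le hr hq0 hp0 hq hp
  have h2 : 3 / z ≤ 6 / r := by
    rw [div_le_div_iff₀ (by linarith) hr0]
    linarith
  have hz0 : 0 < z := by linarith
  calc q ^ 2 * p ^ 2 * (r ^ 9)⁻¹ * (3 / z) ≤ 9 * r ^ 6 * (r ^ 9)⁻¹ * (6 / r) := by gcongr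
    _ = 54 * (r ^ 4)⁻¹ := by field_simp; norm_num
    _ ≤ 144 * (r ^ 4)⁻¹ := by gcongr; norm_num

lemma tangential_deriv_weight_le {r x q p : ℝ} (hr : 1 < r) (hx : |x| ≤ r) (hq0 : 0 ≤ q)
    (hp0 : 0 ≤ p) (hq : q ≤ 3 * r ^ 2) (hp : p ≤ r) :
    |2 * q * (-(8 * x)) * p ^ 2 * (r ^ 9)⁻¹| ≤ 144 * (r ^ 4)⁻¹ := by
  have hr0 : 0 < r := by linarith
  calc |2 * q * (-(8 * x)) * p ^ 2 * (r ^ 9)⁻¹| = 2 * q * (8 * |x|) * p ^ 2 * (r ^ 9)⁻¹ := by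
        rw [abs_mul, abs_mul, abs_mul, abs_neg, abs_mul 8, abs_of_nonneg (by positivity : 0 ≤ 2 * q),
          abs_of_nonneg (by positivity : 0 ≤ p ^ 2), abs_of_pos (by positivity : 0 < (r ^ 9)⁻¹),
          abs_of_pos (by norm_num : (0 : ℝ) < 8)]
    _ ≤ 2 * (3 * r ^ 2) * (8 * r) * r ^ 2 * (r ^ 9)⁻¹ := by gcongr
    _ = 48 * (r ^ 4)⁻¹ := by field_simp; norm_num
    _ ≤ 144 * (r ^ 4)⁻¹ := by gcongr; norm_num

lemma radial_weight_le {r z q p : ℝ} (hr : 1 < r) (hz : r / 2 ≤ z) (hq0 : 0 ≤ q)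
    (hp0 : 0 ≤ p) (hq : q ≤ 3 * r ^ 2) (hp : p ≤ r) :
    q ^ 2 * p ^ 2 * (r ^ 10)⁻¹ * (r / z) ≤ 144 * (r ^ 4)⁻¹ := by
  have hr0 : 0 < r := by linarith
  have h1 := cutoff_mul_le hr hq0 hp0 hq hp
  have h2 : r / z ≤ 2 := by
    rw [div_le_iff₀ (by linarith)]
    linarith
  have hz0 : 0 < z := by linarith
  calc q ^ 2 * p ^ 2 * (r ^ 10)⁻¹ * (r / z) ≤ 9 * r ^ 6 * (r ^ 10)⁻¹ * 2 := by gcongr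
    _ = 18 * (r ^ 4)⁻¹ := by field_simp; norm_num
    _ ≤ 144 * (r ^ 4)⁻¹ := by gcongr; norm_num

lemma radial_deriv_weight_le {r q p : ℝ} (hr : 1 < r) (hq0 : 0 ≤ q)
    (hp0 : 0 ≤ p) (hq : q ≤ 3 * r ^ 2) (hp : p ≤ r) :
    |(2 * q * (6 * r) * p ^ 2 + q ^ 2 * (2 * p)) * (r ^ 10)⁻¹
      + q ^ 2 * p ^ 2 * (-(10 * r ^ 9) / (r ^ 10) ^ 2)| ≤ 144 * (r ^ 4)⁻¹ := by
  have hr0 : 0 < r := by linarith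
  have h1 := cutoff_mul_le hr hq0 hp0 hq hp
  have e1 : 0 ≤ (2 * q * (6 * r) * p ^ 2 + q ^ 2 * (2 * p)) * (r ^ 10)⁻¹ := by positivity
  have e2 : q ^ 2 * p ^ 2 * (-(10 * r ^ 9) / (r ^ 10) ^ 2) = -(q ^ 2 * p ^ 2 * (10 * (r ^ 11)⁻¹)) := by
    field_simp
  have e3 : 0 ≤ q ^ 2 * p ^ 2 * (10 * (r ^ 11)⁻¹) := by positivity
  have b1 : (2 * q * (6 * r) * p ^ 2 + q ^ 2 * (2 * p)) * (r ^ 10)⁻¹ ≤ 54 * (r ^ 5)⁻¹ := by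
    calc (2 * q * (6 * r) * p ^ 2 + q ^ 2 * (2 * p)) * (r ^ 10)⁻¹
        ≤ (2 * (3 * r ^ 2) * (6 * r) * r ^ 2 + (3 * r ^ 2) ^ 2 * (2 * r)) * (r ^ 10)⁻¹ := by gcongr
      _ = 54 * (r ^ 5)⁻¹ := by field_simp; norm_num
  have b2 : q ^ 2 * p ^ 2 * (10 * (r ^ 11)⁻¹) ≤ 90 * (r ^ 5)⁻¹ := by
    calc q ^ 2 * p ^ 2 * (10 * (r ^ 11)⁻¹) ≤ 9 * r ^ 6 * (10 * (r ^ 11)⁻¹) := by gcongr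
      _ = 90 * (r ^ 5)⁻¹ := by field_simp; norm_num
  have b3 : (r ^ 5)⁻¹ ≤ (r ^ 4)⁻¹ := by
    gcongr
    · exact hr.le
    · norm_num
  have b4 : 0 < (r ^ 4)⁻¹ := by positivity
  rw [e2, abs_le]
  constructor <;> linarith

/-- Outside the region `x² + y² < r²`, `0 < r` the cutoff vanishes near `(x, y, r)`. -/
lemma eventually_chartCutoff_eq_zero {x y r : ℝ} (h : ¬(0 < r ∧ 0 < r ^ 2 - x ^ 2 - y ^ 2)) :
    ∀ᶠ p : ℝ × ℝ × ℝ in 𝓝 (x, y, r), chartCutoff p.1 p.2.1 p.2.2 = 0 := by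
  by_cases hr : 0 < r
  · have h1 : 3 * r ^ 2 < 4 * (x ^ 2 + y ^ 2) := by
      have : ¬(0 < r ^ 2 - x ^ 2 - y ^ 2) := fun h2 => h ⟨hr, h2⟩
      nlinarith
    have hopen : IsOpen {p : ℝ × ℝ × ℝ | 3 * p.2.2 ^ 2 < 4 * (p.1 ^ 2 + p.2.1 ^ 2)} :=
      isOpen_lt (by fun_prop) (by fun_prop)
    filter_upwards [hopen.mem_nhds h1] with p hp
    have : 3 * p.2.2 ^ 2 - 4 * (p.1 ^ 2 + p.2.1 ^ 2) ≤ 0 := by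
      have : 3 * p.2.2 ^ 2 < 4 * (p.1 ^ 2 + p.2.1 ^ 2) := hp
      linarith
    rw [chartCutoff, max_eq_right this]
    ring
  · have hopen : IsOpen {p : ℝ × ℝ × ℝ | p.2.2 < 1} := isOpen_lt (by fun_prop) (by fun_prop)
    have h1 : (x, y, r) ∈ {p : ℝ × ℝ × ℝ | p.2.2 < 1} := by
      simp only [Set.mem_ofPred_eq]
      linarith
    filter_upwards [hopen.mem_nhds h1] with p hp
    have : p.2.2 - 1 ≤ 0 := by
      have : p.2.2 < 1 := hp
      linarith
    rw [chartCutoff, max_eq_right this]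
    ring

lemma hasDerivAt_sq_max_comp {u : ℝ → ℝ} {u' t : ℝ} (hu : HasDerivAt u u' t) :
    HasDerivAt (fun s => max (u s) 0 ^ 2) (2 * max (u t) 0 * u') t :=
  (hasDerivAt_sq_max_zero (u t)).comp t hu

lemma hasDerivAt_sq_mul {F a : ℝ → ℝ} {F' a' t : ℝ} (hF : HasDerivAt F F' t)
    (ha : HasDerivAt a a' t) :
    HasDerivAt (fun s => F s ^ 2 * a s) (2 * F t * F' * a t + F t ^ 2 * a') t := by
  refine ((hF.pow 2).mul ha).congr_deriv ?_
  simp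

lemma max_eq_zero_or {x y r : ℝ} (h : r ≤ 1 ∨ 3 * r ^ 2 ≤ 4 * (x ^ 2 + y ^ 2)) :
    max (r - 1) 0 = 0 ∨ max (3 * r ^ 2 - 4 * (x ^ 2 + y ^ 2)) 0 = 0 := by
  rcases h with h | h
  · exact Or.inl (max_eq_right (by linarith))
  · exact Or.inr (max_eq_right (by linarith))

lemma exists_hasDerivAt_chart_fst (hf : HasGradientMajorant f J) (x y r : ℝ) :
    ∃ g', HasDerivAt (fun t => f (sphericalChart t y r) ^ 2
        * (chartCutoff t y r * (r ^ 9)⁻¹)) g' x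
      ∧ ENNReal.ofReal |g'| ≤ 432 * chartDensity f J ![x, y, r] := by
  by_cases hreg : 0 < r ∧ 0 < r ^ 2 - x ^ 2 - y ^ 2
  · have hF := (hf.differentiable (sphericalChart x y r)).hasFDerivAt.comp_hasDerivAt x
      (hasDerivAt_sphericalChart_fst hreg.2)
    have hq : HasDerivAt (fun t : ℝ => 3 * r ^ 2 - 4 * (t ^ 2 + y ^ 2)) (-(8 * x)) x := by
      refine ((((hasDerivAt_pow 2 x).add_const (y ^ 2)).const_mul 4).const_sub
        (3 * r ^ 2)).congr_deriv ?_
      simp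
      ring
    have ha : HasDerivAt (fun t => chartCutoff t y r * (r ^ 9)⁻¹)
        (2 * max (3 * r ^ 2 - 4 * (x ^ 2 + y ^ 2)) 0 * (-(8 * x)) * max (r - 1) 0 ^ 2
          * (r ^ 9)⁻¹) x :=
      ((hasDerivAt_sq_max_comp hq).mul_const _).mul_const _
    refine ⟨_, hasDerivAt_sq_mul hF ha, ?_⟩
    refine ofReal_abs_deriv_le_chartDensity hf (k := 3 / √(r ^ 2 - x ^ 2 - y ^ 2))
      (mul_nonneg (chartCutoff_nonneg _ _ _) (by have := hreg.1; positivity))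
      (fun hr hxy => ?_) fun hout => ?_
    · obtain ⟨hz, hx, hy, hq, hp⟩ := chart_bounds hr hxy
      have htan := ofReal_abs_tangential_le 0 (sphericalChart_apply_two x y r)
        (Real.sqrt_pos.2 hreg.2) (hf.bound (sphericalChart x y r))
      rw [sphericalChart_apply_zero] at htan
      exact ⟨htan, tangential_weight_le hr hz (le_max_right _ _) (le_max_right _ _) hq hp,
        tangential_deriv_weight_le hr hx (le_max_right _ _) (le_max_right _ _) hq hp⟩
    · unfold chartCutoff
      rcases max_eq_zero_or hout with h | h <;> simp [h]
  · refine ⟨0, ?_, by simp⟩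
    refine (hasDerivAt_const x (0 : ℝ)).congr_of_eventuallyEq ?_
    have hc : ContinuousAt (fun t : ℝ => (t, y, r)) x := Continuous.continuousAt (by fun_prop)
    filter_upwards [hc.eventually (eventually_chartCutoff_eq_zero hreg)] with t ht
    rw [ht]
    ring

lemma exists_hasDerivAt_chart_snd (hf : HasGradientMajorant f J) (x y r : ℝ) :
    ∃ g', HasDerivAt (fun t => f (sphericalChart x t r) ^ 2
        * (chartCutoff x t r * (r ^ 9)⁻¹)) g' y
      ∧ ENNReal.ofReal |g'| ≤ 432 * chartDensity f J ![x, y, r] := by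
  by_cases hreg : 0 < r ∧ 0 < r ^ 2 - x ^ 2 - y ^ 2
  · have hF := (hf.differentiable (sphericalChart x y r)).hasFDerivAt.comp_hasDerivAt y
      (hasDerivAt_sphericalChart_snd hreg.2)
    have hq : HasDerivAt (fun t : ℝ => 3 * r ^ 2 - 4 * (x ^ 2 + t ^ 2)) (-(8 * y)) y := by
      refine ((((hasDerivAt_pow 2 y).const_add (x ^ 2)).const_mul 4).const_sub
        (3 * r ^ 2)).congr_deriv ?_
      simp
      ring
    have ha : HasDerivAt (fun t => chartCutoff x t r * (r ^ 9)⁻¹)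
        (2 * max (3 * r ^ 2 - 4 * (x ^ 2 + y ^ 2)) 0 * (-(8 * y)) * max (r - 1) 0 ^ 2
          * (r ^ 9)⁻¹) y :=
      ((hasDerivAt_sq_max_comp hq).mul_const _).mul_const _
    refine ⟨_, hasDerivAt_sq_mul hF ha, ?_⟩
    refine ofReal_abs_deriv_le_chartDensity hf (k := 3 / √(r ^ 2 - x ^ 2 - y ^ 2))
      (mul_nonneg (chartCutoff_nonneg _ _ _) (by have := hreg.1; positivity))
      (fun hr hxy => ?_) fun hout => ?_
    · obtain ⟨hz, hx, hy, hq, hp⟩ := chart_bounds hr hxy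
      have htan := ofReal_abs_tangential_le 1 (sphericalChart_apply_two x y r)
        (Real.sqrt_pos.2 hreg.2) (hf.bound (sphericalChart x y r))
      rw [sphericalChart_apply_one] at htan
      exact ⟨htan, tangential_weight_le hr hz (le_max_right _ _) (le_max_right _ _) hq hp,
        tangential_deriv_weight_le hr hy (le_max_right _ _) (le_max_right _ _) hq hp⟩
    · unfold chartCutoff
      rcases max_eq_zero_or hout with h | h <;> simp [h]
  · refine ⟨0, ?_, by simp⟩
    refine (hasDerivAt_const y (0 : ℝ)).congr_of_eventuallyEq ?_
    have hc : ContinuousAt (fun t : ℝ => (x, t, r)) y := Continuous.continuousAt (by fun_prop)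
    filter_upwards [hc.eventually (eventually_chartCutoff_eq_zero hreg)] with t ht
    rw [ht]
    ring

lemma exists_hasDerivAt_chart_radius (hf : HasGradientMajorant f J) (x y r : ℝ) :
    ∃ g', HasDerivAt (fun t => f (sphericalChart x y t) ^ 2
        * (chartCutoff x y t * (t ^ 10)⁻¹)) g' r
      ∧ ENNReal.ofReal |g'| ≤ 432 * chartDensity f J ![x, y, r] := by
  by_cases hreg : 0 < r ∧ 0 < r ^ 2 - x ^ 2 - y ^ 2
  · have hr0 := hreg.1
    have hF := (hf.differentiable (sphericalChart x y r)).hasFDerivAt.comp_hasDerivAt r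
      (hasDerivAt_sphericalChart_radius hreg.2)
    have hq : HasDerivAt (fun t : ℝ => 3 * t ^ 2 - 4 * (x ^ 2 + y ^ 2)) (6 * r) r := by
      refine (((hasDerivAt_pow 2 r).const_mul 3).sub_const _).congr_deriv ?_
      simp
      ring
    have hp : HasDerivAt (fun t : ℝ => t - 1) 1 r := (hasDerivAt_id r).sub_const 1
    have hr10 : HasDerivAt (fun t : ℝ => (t ^ 10)⁻¹) (-(10 * r ^ 9) / (r ^ 10) ^ 2) r := by
      have : HasDerivAt (fun t : ℝ => (t ^ 10)⁻¹) _ r :=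
        (hasDerivAt_pow 10 r).inv (by positivity)
      simpa using this
    have ha : HasDerivAt (fun t => chartCutoff x y t * (t ^ 10)⁻¹)
        ((2 * max (3 * r ^ 2 - 4 * (x ^ 2 + y ^ 2)) 0 * (6 * r) * max (r - 1) 0 ^ 2
          + max (3 * r ^ 2 - 4 * (x ^ 2 + y ^ 2)) 0 ^ 2 * (2 * max (r - 1) 0)) * (r ^ 10)⁻¹
          + max (3 * r ^ 2 - 4 * (x ^ 2 + y ^ 2)) 0 ^ 2 * max (r - 1) 0 ^ 2
            * (-(10 * r ^ 9) / (r ^ 10) ^ 2)) r := by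
      refine (((hasDerivAt_sq_max_comp hq).mul (hasDerivAt_sq_max_comp hp)).mul hr10).congr_deriv ?_
      simp
    refine ⟨_, hasDerivAt_sq_mul hF ha, ?_⟩
    refine ofReal_abs_deriv_le_chartDensity hf (k := r / √(r ^ 2 - x ^ 2 - y ^ 2))
      (mul_nonneg (chartCutoff_nonneg _ _ _) (by positivity)) (fun hr hxy => ?_) fun hout => ?_
    · obtain ⟨hz, hx, hy, hq, hp⟩ := chart_bounds hr hxy
      have hz0 := Real.sqrt_pos.2 hreg.2
      have hL := ofReal_abs_le_rpow (hf.bound (sphericalChart x y r) (EuclideanSpace.single 2 1)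
        (EuclideanSpace.single 2 1) (by simp) (by simp)).1
      refine ⟨?_, radial_weight_le hr hz (le_max_right _ _) (le_max_right _ _) hq hp,
        radial_deriv_weight_le hr (le_max_right _ _) (le_max_right _ _) hq hp⟩
      rw [map_smul, smul_eq_mul, abs_mul, abs_of_pos (by positivity),
        ENNReal.ofReal_mul (by positivity)]
      gcongr
    · unfold chartCutoff
      rcases max_eq_zero_or hout with h | h <;> simp [h]
  · refine ⟨0, ?_, by simp⟩
    refine (hasDerivAt_const r (0 : ℝ)).congr_of_eventuallyEq ?_
    have hc : ContinuousAt (fun t : ℝ => (x, y, t)) r := Continuous.continuousAt (by fun_prop)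
    filter_upwards [hc.eventually (eventually_chartCutoff_eq_zero hreg)] with t ht
    rw [ht]
    ring

end ChartDerivatives

/-! ### The Loomis–Whitney inequality on a cone -/

section ChartInequality

variable {f : Vel → ℝ} {J : Vel → ℝ≥0∞}

lemma update_zero_eq (x : Fin 3 → ℝ) (t : ℝ) : Function.update x 0 t = ![t, x 1, x 2] := by
  ext i
  fin_cases i <;> simp [Function.update]

lemma update_one_eq (x : Fin 3 → ℝ) (t : ℝ) : Function.update x 1 t = ![x 0, t, x 2] := by
  ext i
  fin_cases i <;> simp [Function.update]

lemma update_two_eq (x : Fin 3 → ℝ) (t : ℝ) : Function.update x 2 t = ![x 0, x 1, t] := by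
  ext i
  fin_cases i <;> simp [Function.update]

/-- The function `f² χ r⁻ⁿ` in the spherical chart, with `χ` the cutoff. As `χ` has homogeneity `6`,
the exponent `n = 9` gives the weight `r⁻³`, suited to the tangential directions, and `n = 10` gives
the weight `r⁻⁴`, suited to the radial one. -/
noncomputable def chartFunction (f : Vel → ℝ) (n : ℕ) (x y r : ℝ) : ℝ :=
  f (sphericalChart x y r) ^ 2 * (chartCutoff x y r * (r ^ n)⁻¹)

lemma chartFunction_fst_le (hf : HasGradientMajorant f J) (x : Fin 3 → ℝ) :
    ENNReal.ofReal (chartFunction f 9 (x 0) (x 1) (x 2))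
      ≤ ∫⁻ t, 432 * chartDensity f J (Function.update x 0 t) := by
  choose g' hg' hle using fun t => exists_hasDerivAt_chart_fst hf t (x 1) (x 2)
  simp_rw [update_zero_eq]
  refine ofReal_le_lintegral_of_hasDerivAt (a := x 2) hg' ?_ hle (x 0)
  rw [chartCutoff, max_eq_right (by nlinarith [sq_nonneg (x 1), sq_nonneg (x 2)])]
  ring

lemma chartFunction_snd_le (hf : HasGradientMajorant f J) (x : Fin 3 → ℝ) :
    ENNReal.ofReal (chartFunction f 9 (x 0) (x 1) (x 2))
      ≤ ∫⁻ t, 432 * chartDensity f J (Function.update x 1 t) := by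
  choose g' hg' hle using fun t => exists_hasDerivAt_chart_snd hf (x 0) t (x 2)
  simp_rw [update_one_eq]
  refine ofReal_le_lintegral_of_hasDerivAt (a := x 2) hg' ?_ hle (x 1)
  rw [chartCutoff, max_eq_right (by nlinarith [sq_nonneg (x 0), sq_nonneg (x 2)])]
  ring

lemma chartFunction_radius_le (hf : HasGradientMajorant f J) (x : Fin 3 → ℝ) :
    ENNReal.ofReal (chartFunction f 10 (x 0) (x 1) (x 2))
      ≤ ∫⁻ t, 432 * chartDensity f J (Function.update x 2 t) := by
  choose g' hg' hle using fun t => exists_hasDerivAt_chart_radius hf (x 0) (x 1) t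
  simp_rw [update_two_eq]
  refine ofReal_le_lintegral_of_hasDerivAt (a := 0) hg' ?_ hle (x 2)
  rw [chartCutoff, max_eq_right (by norm_num : (0 : ℝ) - 1 ≤ 0)]
  ring

/-- The geometric mean of the functions differentiated in the three directions. -/
noncomputable def chartProduct (f : Vel → ℝ) (x : Fin 3 → ℝ) : ℝ≥0∞ :=
  ENNReal.ofReal (chartFunction f 9 (x 0) (x 1) (x 2)) ^ (1 / 2 : ℝ)
    * ENNReal.ofReal (chartFunction f 9 (x 0) (x 1) (x 2)) ^ (1 / 2 : ℝ)
    * ENNReal.ofReal (chartFunction f 10 (x 0) (x 1) (x 2)) ^ (1 / 2 : ℝ)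

lemma continuous_sphericalChart :
    Continuous fun x : Fin 3 → ℝ => sphericalChart (x 0) (x 1) (x 2) := by
  unfold sphericalChart
  fun_prop

lemma measurable_chartProduct (hf : HasGradientMajorant f J) : Measurable (chartProduct f) := by
  have h1 : Measurable fun x : Fin 3 → ℝ => f (sphericalChart (x 0) (x 1) (x 2)) :=
    (hf.differentiable.continuous.comp continuous_sphericalChart).measurable
  have h2 : Continuous fun x : Fin 3 → ℝ => chartCutoff (x 0) (x 1) (x 2) := by
    unfold chartCutoff
    fun_prop
  have h3 (n : ℕ) : Measurable fun x : Fin 3 → ℝ =>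
      ENNReal.ofReal (chartFunction f n (x 0) (x 1) (x 2)) ^ (1 / 2 : ℝ) :=
    ((h1.pow_const 2).mul (h2.measurable.mul
      ((measurable_pi_apply 2).pow_const n).inv)).ennreal_ofReal.pow_const _
  exact ((h3 9).mul (h3 9)).mul (h3 10)

lemma measurable_sobolevDensity (hf : HasGradientMajorant f J) :
    Measurable (sobolevDensity f J) := by
  have h1 : Measurable f := hf.differentiable.continuous.measurable
  have h2 := hf.measurable
  unfold sobolevDensity
  fun_prop

lemma measurableSet_chartDomain : MeasurableSet chartDomain := by
  have h1 : IsOpen {x : Fin 3 → ℝ | 1 < x 2} := isOpen_lt (by fun_prop) (by fun_prop)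
  have h2 : IsOpen {x : Fin 3 → ℝ | 4 * (x 0 ^ 2 + x 1 ^ 2) < 3 * x 2 ^ 2} :=
    isOpen_lt (by fun_prop) (by fun_prop)
  exact (h1.inter h2).measurableSet

lemma measurable_chartDensity (hf : HasGradientMajorant f J) : Measurable (chartDensity f J) := by
  have h1 : Measurable fun x : Fin 3 → ℝ => sobolevDensity f J (sphericalChart (x 0) (x 1) (x 2)) :=
    (measurable_sobolevDensity hf).comp continuous_sphericalChart.measurable
  refine Measurable.indicator ?_ measurableSet_chartDomain
  fun_prop

/-- The Loomis–Whitney inequality in the chart. -/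
lemma lintegral_chartProduct_le (hf : HasGradientMajorant f J) :
    ∫⁻ x, chartProduct f x ≤ (∫⁻ x, 432 * chartDensity f J x) ^ (3 / 2 : ℝ) := by
  have hp : Real.HolderConjugate (Fintype.card (Fin 3) : ℝ) (3 / 2) := by
    rw [Real.holderConjugate_iff]
    simp
    norm_num
  have hm : Measurable fun x => 432 * chartDensity f J x :=
    (measurable_chartDensity hf).const_mul _
  have key := lintegral_prod_lintegral_pow_le (fun _ : Fin 3 => (volume : Measure ℝ)) hp hm
  rw [← volume_pi] at key
  refine le_trans (lintegral_mono fun x => ?_) key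
  have e : (1 : ℝ) / ((Fintype.card (Fin 3) : ℝ) - 1) = 1 / 2 := by
    simp
    norm_num
  rw [e, Fin.prod_univ_three]
  unfold chartProduct
  gcongr
  · exact chartFunction_fst_le hf x
  · exact chartFunction_snd_le hf x
  · exact chartFunction_radius_le hf x

/-- In the interior of the chart the geometric mean dominates `f³ r⁻⁵`. -/
lemma ofReal_le_chartProduct (hf0 : ∀ v, 0 ≤ f v) {x y r : ℝ} (hr : 2 ≤ r)
    (hxy : 3 * (x ^ 2 + y ^ 2) ≤ 2 * r ^ 2) :
    ENNReal.ofReal ((r ^ 5)⁻¹ * f (sphericalChart x y r) ^ 3)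
      ≤ 216 * chartProduct f ![x, y, r] := by
  have hr0 : 0 < r := by linarith
  set F := f (sphericalChart x y r) with hF
  have hF0 : 0 ≤ F := hf0 _
  have hq : r ^ 2 / 3 ≤ max (3 * r ^ 2 - 4 * (x ^ 2 + y ^ 2)) 0 :=
    le_max_of_le_left (by linarith)
  have hp : r / 2 ≤ max (r - 1) 0 := le_max_of_le_left (by linarith)
  have hcut : r ^ 6 / 36 ≤ chartCutoff x y r := by
    unfold chartCutoff
    calc r ^ 6 / 36 = (r ^ 2 / 3) ^ 2 * (r / 2) ^ 2 := by ring
      _ ≤ _ := by gcongr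
  have hlow (n : ℕ) : F ^ 2 * (r ^ 6 / 36 * (r ^ n)⁻¹) ≤ chartFunction f n x y r := by
    unfold chartFunction
    rw [← hF]
    gcongr
  have hprod : chartProduct f ![x, y, r] = ENNReal.ofReal (chartFunction f 9 x y r
      * chartFunction f 9 x y r * chartFunction f 10 x y r) ^ (1 / 2 : ℝ) := by
    have h0 (n : ℕ) : 0 ≤ chartFunction f n x y r := by
      have := chartCutoff_nonneg x y r
      unfold chartFunction
      positivity
    rw [ENNReal.ofReal_mul (mul_nonneg (h0 9) (h0 9)), ENNReal.ofReal_mul (h0 9),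
      ENNReal.mul_rpow_of_nonneg _ _ (by norm_num), ENNReal.mul_rpow_of_nonneg _ _ (by norm_num)]
    rfl
  have hle : ENNReal.ofReal |(r ^ 5)⁻¹ * F ^ 3 / 216| ≤ chartProduct f ![x, y, r] := by
    rw [hprod]
    refine ofReal_abs_le_rpow (ENNReal.ofReal_le_ofReal ?_)
    calc ((r ^ 5)⁻¹ * F ^ 3 / 216) ^ 2
        = F ^ 2 * (r ^ 6 / 36 * (r ^ 9)⁻¹) * (F ^ 2 * (r ^ 6 / 36 * (r ^ 9)⁻¹))
          * (F ^ 2 * (r ^ 6 / 36 * (r ^ 10)⁻¹)) := by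
          field_simp
          norm_num
      _ ≤ _ := by
          gcongr
          · exact mul_nonneg ((by positivity : 0 ≤ F ^ 2 * (r ^ 6 / 36 * (r ^ 9)⁻¹)).trans (hlow 9))
              ((by positivity : 0 ≤ F ^ 2 * (r ^ 6 / 36 * (r ^ 9)⁻¹)).trans (hlow 9))
          · exact (by positivity : 0 ≤ F ^ 2 * (r ^ 6 / 36 * (r ^ 9)⁻¹)).trans (hlow 9)
          · exact hlow 9
          · exact hlow 9
          · exact hlow 10
  rw [abs_of_nonneg (by positivity)] at hle
  calc ENNReal.ofReal ((r ^ 5)⁻¹ * F ^ 3)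
      = 216 * ENNReal.ofReal ((r ^ 5)⁻¹ * F ^ 3 / 216) := by
        rw [← ENNReal.ofReal_ofNat 216, ← ENNReal.ofReal_mul (by norm_num)]
        congr 1
        ring
    _ ≤ _ := by gcongr

/-- The distance of `(x, y, t)` to `(0, 0, -2)`. -/
noncomputable def chartRadius (x y t : ℝ) : ℝ := √(x ^ 2 + y ^ 2 + (t + 2) ^ 2)

lemma chartRadius_pos (x y : ℝ) {t : ℝ} (ht : -2 < t) : 0 < chartRadius x y t := by
  have : 0 < t + 2 := by linarith
  exact Real.sqrt_pos.2 (by positivity)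

lemma sq_chartRadius (x y t : ℝ) : chartRadius x y t ^ 2 = x ^ 2 + y ^ 2 + (t + 2) ^ 2 :=
  Real.sq_sqrt (by positivity)

lemma hasDerivAt_chartRadius (x y : ℝ) {t : ℝ} (ht : -2 < t) :
    HasDerivAt (chartRadius x y) ((t + 2) / chartRadius x y t) t := by
  have h0 : x ^ 2 + y ^ 2 + (t + 2) ^ 2 ≠ 0 := by
    have : 0 < t + 2 := by linarith
    positivity
  have h1 : HasDerivAt (fun t : ℝ => x ^ 2 + y ^ 2 + (t + 2) ^ 2) (2 * (t + 2)) t := by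
    refine ((((hasDerivAt_id t).add_const 2).pow 2).const_add (x ^ 2 + y ^ 2)).congr_deriv ?_
    simp
  refine (h1.sqrt h0).congr_deriv ?_
  rw [chartRadius]
  exact mul_div_mul_left _ _ two_ne_zero

lemma sphericalChart_chartRadius (x y : ℝ) {t : ℝ} (ht : -2 < t) :
    sphericalChart x y (chartRadius x y t) = WithLp.toLp 2 ![x, y, t] := by
  have h : √(chartRadius x y t ^ 2 - x ^ 2 - y ^ 2) = t + 2 := by
    rw [sq_chartRadius, show x ^ 2 + y ^ 2 + (t + 2) ^ 2 - x ^ 2 - y ^ 2 = (t + 2) ^ 2 by ring]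
    exact Real.sqrt_sq (by linarith)
  ext i
  fin_cases i
  · simp [sphericalChart]
  · simp [sphericalChart]
  · simp [sphericalChart, h]

lemma injOn_chartRadius (x y : ℝ) : Set.InjOn (chartRadius x y) (Set.Ioi (-2)) := by
  intro s hs t ht hst
  have h1 := sq_chartRadius x y s
  rw [hst, sq_chartRadius] at h1
  have h2 : (t + 2) ^ 2 = (s + 2) ^ 2 := by linarith
  have hs' : 0 ≤ s + 2 := by linarith [Set.mem_Ioi.1 hs]
  have ht' : 0 ≤ t + 2 := by linarith [Set.mem_Ioi.1 ht]
  have := (sq_eq_sq₀ ht' hs').1 h2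
  linarith

/-- The change of variables between the vertical coordinate and the radius. -/
lemma lintegral_image_chartRadius (x y : ℝ) (H : ℝ → ℝ≥0∞) :
    ∫⁻ r in chartRadius x y '' Set.Ioi (-2), H r
      = ∫⁻ t in Set.Ioi (-2), ENNReal.ofReal ((t + 2) / chartRadius x y t)
        * H (chartRadius x y t) := by
  rw [lintegral_image_eq_lintegral_abs_deriv_mul measurableSet_Ioi
    (fun t ht => (hasDerivAt_chartRadius x y ht).hasDerivWithinAt) (injOn_chartRadius x y)]
  refine setLIntegral_congr_fun measurableSet_Ioi fun t ht => ?_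
  have h1 := chartRadius_pos x y ht
  have h2 : 0 < t + 2 := by linarith [Set.mem_Ioi.1 ht]
  rw [abs_of_pos (by positivity)]

lemma norm_toLp_sq (x y t : ℝ) :
    ‖(WithLp.toLp 2 ![x, y, t] : Vel)‖ ^ 2 = x ^ 2 + y ^ 2 + t ^ 2 := by
  rw [norm_sq_eq_coord]
  simp

/-- The directions in which the last coordinate dominates. -/
def verticalCone : Set Vel := {v | |v 0| ≤ v 2 ∧ |v 1| ≤ v 2}

lemma isClosed_verticalCone : IsClosed verticalCone := by
  have h1 : IsClosed {v : Vel | |v 0| ≤ v 2} := isClosed_le (by fun_prop) (by fun_prop)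
  have h2 : IsClosed {v : Vel | |v 1| ≤ v 2} := isClosed_le (by fun_prop) (by fun_prop)
  exact h1.inter h2

lemma weightedCube_le_chartProduct (hf0 : ∀ v, 0 ≤ f v) {x y t : ℝ}
    (hv : (WithLp.toLp 2 ![x, y, t] : Vel) ∈ verticalCone) :
    ENNReal.ofReal ((japaneseBracket (WithLp.toLp 2 ![x, y, t]) ^ 5)⁻¹
        * f (WithLp.toLp 2 ![x, y, t]) ^ 3)
      ≤ 104976 * (ENNReal.ofReal ((t + 2) / chartRadius x y t)
        * chartProduct f ![x, y, chartRadius x y t]) := by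
  obtain ⟨hx, hy⟩ : |x| ≤ t ∧ |y| ≤ t := hv
  have ht : 0 ≤ t := (abs_nonneg x).trans hx
  have hx2 : x ^ 2 ≤ t ^ 2 := sq_le_sq' (by linarith [neg_abs_le x]) ((le_abs_self x).trans hx)
  have hy2 : y ^ 2 ≤ t ^ 2 := sq_le_sq' (by linarith [neg_abs_le y]) ((le_abs_self y).trans hy)
  set v : Vel := WithLp.toLp 2 ![x, y, t] with hvdef
  set r := chartRadius x y t with hr
  have hrsq : r ^ 2 = x ^ 2 + y ^ 2 + (t + 2) ^ 2 := sq_chartRadius x y t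
  have hr0 : 0 < r := chartRadius_pos x y (by linarith)
  have hr2 : 2 ≤ r := by
    refine le_of_sq_le_sq ?_ hr0.le
    rw [hrsq]
    nlinarith [sq_nonneg x, sq_nonneg y]
  have h1 := ofReal_le_chartProduct hf0 hr2 (x := x) (y := y) (by
    rw [hrsq]
    nlinarith)
  rw [hr, sphericalChart_chartRadius x y (by linarith), ← hr, ← hvdef] at h1
  have hjac : 1 / 2 ≤ (t + 2) / r := by
    rw [div_le_div_iff₀ (by norm_num) hr0, one_mul]
    refine le_of_sq_le_sq ?_ (by positivity)
    rw [hrsq]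
    nlinarith
  have hjb : r ≤ 3 * japaneseBracket v := by
    have hjp := japaneseBracket_pos v
    refine le_of_sq_le_sq ?_ (by positivity)
    rw [mul_pow, sq_japaneseBracket, hvdef, norm_toLp_sq, hrsq]
    nlinarith [sq_nonneg x, sq_nonneg y, sq_nonneg (t - 1)]
  have h2 : (japaneseBracket v ^ 5)⁻¹ * f v ^ 3 ≤ 243 * ((r ^ 5)⁻¹ * f v ^ 3) := by
    have hjp := japaneseBracket_pos v
    have : (japaneseBracket v ^ 5)⁻¹ ≤ 243 * (r ^ 5)⁻¹ := by
      rw [← div_eq_mul_inv, le_div_iff₀ (by positivity), inv_mul_le_iff₀ (by positivity)]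
      calc r ^ 5 ≤ (3 * japaneseBracket v) ^ 5 := by gcongr
        _ = _ := by ring
    have h0 := hf0 v
    calc (japaneseBracket v ^ 5)⁻¹ * f v ^ 3 ≤ 243 * (r ^ 5)⁻¹ * f v ^ 3 := by gcongr
      _ = _ := by ring
  calc ENNReal.ofReal ((japaneseBracket v ^ 5)⁻¹ * f v ^ 3)
      ≤ ENNReal.ofReal (243 * ((r ^ 5)⁻¹ * f v ^ 3)) := ENNReal.ofReal_le_ofReal h2
    _ = 243 * ENNReal.ofReal ((r ^ 5)⁻¹ * f v ^ 3) := by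
        rw [ENNReal.ofReal_mul (by norm_num), ENNReal.ofReal_ofNat]
    _ ≤ 243 * (216 * chartProduct f ![x, y, r]) := by gcongr
    _ = 52488 * (1 * chartProduct f ![x, y, r]) := by
        rw [← mul_assoc, one_mul]
        norm_num
    _ ≤ 52488 * ((2 * ENNReal.ofReal ((t + 2) / r)) * chartProduct f ![x, y, r]) := by
        gcongr
        calc (1 : ℝ≥0∞) = 2 * ENNReal.ofReal (1 / 2) := by
              rw [← ENNReal.ofReal_ofNat 2, ← ENNReal.ofReal_mul (by norm_num)]
              norm_num
          _ ≤ _ := by gcongr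
    _ = _ := by
        rw [mul_assoc, ← mul_assoc]
        norm_num

lemma lintegral_verticalCone_le (hf : HasGradientMajorant f J) :
    ∫⁻ v in verticalCone, ENNReal.ofReal ((japaneseBracket v ^ 5)⁻¹ * f v ^ 3)
      ≤ 104976 * ∫⁻ x, chartProduct f x := by
  set A : Vel → ℝ≥0∞ := verticalCone.indicator
    fun v => ENNReal.ofReal ((japaneseBracket v ^ 5)⁻¹ * f v ^ 3) with hA
  have hAm : Measurable A := by
    refine Measurable.indicator ?_ isClosed_verticalCone.measurableSet
    have h1 := hf.differentiable.continuous.measurable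
    have h2 := continuous_japaneseBracket.measurable
    fun_prop
  rw [← lintegral_indicator isClosed_verticalCone.measurableSet, ← hA,
    ← (PiLp.volume_preserving_toLp (Fin 3)).lintegral_comp hAm,
    ← lintegral_const_mul _ (measurable_chartProduct hf), volume_pi]
  refine lintegral_le_of_lmarginal_le {2} (hAm.comp (by fun_prop))
    ((measurable_chartProduct hf).const_mul _) ?_
  rw [lmarginal_singleton, lmarginal_singleton]
  intro x
  simp only [update_two_eq]
  calc ∫⁻ t, A (WithLp.toLp 2 ![x 0, x 1, t])
      ≤ ∫⁻ t, (Set.Ioi (-2)).indicator (fun t => ENNReal.ofReal ((t + 2) / chartRadius (x 0) (x 1) t)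
        * (104976 * chartProduct f ![x 0, x 1, chartRadius (x 0) (x 1) t])) t := by
        refine lintegral_mono fun t => ?_
        by_cases hv : (WithLp.toLp 2 ![x 0, x 1, t] : Vel) ∈ verticalCone
        · have ht : -2 < t := by
            have h1 : |x 0| ≤ t := hv.1
            linarith [abs_nonneg (x 0)]
          simp only
          rw [hA, Set.indicator_of_mem hv, Set.indicator_of_mem (Set.mem_Ioi.2 ht)]
          refine (weightedCube_le_chartProduct hf.nonneg hv).trans (le_of_eq ?_)
          ring
        · simp only
          rw [hA, Set.indicator_of_notMem hv]
          exact zero_le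
    _ = ∫⁻ r in chartRadius (x 0) (x 1) '' Set.Ioi (-2), 104976 * chartProduct f ![x 0, x 1, r] := by
        rw [lintegral_indicator measurableSet_Ioi, lintegral_image_chartRadius]
    _ ≤ ∫⁻ r, 104976 * chartProduct f ![x 0, x 1, r] := setLIntegral_le_lintegral _ _

lemma chartDensity_le {x y t : ℝ} (ht : -2 < t) :
    chartDensity f J ![x, y, chartRadius x y t]
      ≤ 256 * (ENNReal.ofReal ((japaneseBracket (WithLp.toLp 2 ![x, y, t]) ^ 4)⁻¹)
        * sobolevDensity f J (WithLp.toLp 2 ![x, y, t])) := by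
  by_cases hU : ![x, y, chartRadius x y t] ∈ chartDomain
  · rw [chartDensity, Set.indicator_of_mem hU]
    change ENNReal.ofReal ((chartRadius x y t ^ 4)⁻¹)
      * sobolevDensity f J (sphericalChart x y (chartRadius x y t)) ≤ _
    rw [sphericalChart_chartRadius x y ht]
    set v : Vel := WithLp.toLp 2 ![x, y, t] with hvdef
    have hr1 : 1 < chartRadius x y t := hU.1
    have hrsq := sq_chartRadius x y t
    set r := chartRadius x y t
    have hjp := japaneseBracket_pos v
    have hjb : japaneseBracket v ≤ 4 * r := by
      refine le_of_sq_le_sq ?_ (by positivity)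
      rw [mul_pow, sq_japaneseBracket, hvdef, norm_toLp_sq, hrsq]
      nlinarith [sq_nonneg x, sq_nonneg y, sq_nonneg (t + 4), sq_nonneg (t + 2)]
    have h1 : (r ^ 4)⁻¹ ≤ 256 * (japaneseBracket v ^ 4)⁻¹ := by
      rw [← div_eq_mul_inv, le_div_iff₀ (by positivity), inv_mul_le_iff₀ (by positivity)]
      calc japaneseBracket v ^ 4 ≤ (4 * r) ^ 4 := by gcongr
        _ = _ := by ring
    calc ENNReal.ofReal ((r ^ 4)⁻¹) * sobolevDensity f J v
        ≤ ENNReal.ofReal (256 * (japaneseBracket v ^ 4)⁻¹) * sobolevDensity f J v := by gcongr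
      _ = _ := by
        rw [ENNReal.ofReal_mul (by norm_num), ENNReal.ofReal_ofNat, mul_assoc]
  · rw [chartDensity, Set.indicator_of_notMem hU]
    exact zero_le

lemma lintegral_chartDensity_le (hf : HasGradientMajorant f J) :
    ∫⁻ x, chartDensity f J x
      ≤ 256 * ∫⁻ v, ENNReal.ofReal ((japaneseBracket v ^ 4)⁻¹) * sobolevDensity f J v := by
  set B : Vel → ℝ≥0∞ := fun v => 256 * (ENNReal.ofReal ((japaneseBracket v ^ 4)⁻¹)
    * sobolevDensity f J v) with hB
  have hm : Measurable fun v => ENNReal.ofReal ((japaneseBracket v ^ 4)⁻¹)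
      * sobolevDensity f J v := by
    have h1 := measurable_sobolevDensity hf
    have h2 := continuous_japaneseBracket.measurable
    fun_prop
  have hBm : Measurable B := hm.const_mul _
  rw [← lintegral_const_mul _ hm, ← hB,
    ← (PiLp.volume_preserving_toLp (Fin 3)).lintegral_comp hBm, volume_pi]
  refine lintegral_le_of_lmarginal_le {2} (measurable_chartDensity hf)
    (hBm.comp (by fun_prop)) ?_
  rw [lmarginal_singleton, lmarginal_singleton]
  intro x
  simp only [update_two_eq]
  have himage (r : ℝ) (hr : ![x 0, x 1, r] ∈ chartDomain) :
      r ∈ chartRadius (x 0) (x 1) '' Set.Ioi (-2) := by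
    have h1 : 1 < r := hr.1
    have h2 : 4 * (x 0 ^ 2 + x 1 ^ 2) < 3 * r ^ 2 := hr.2
    have h3 : 0 < r ^ 2 - x 0 ^ 2 - x 1 ^ 2 := by nlinarith
    refine ⟨√(r ^ 2 - x 0 ^ 2 - x 1 ^ 2) - 2, ?_, ?_⟩
    · rw [Set.mem_Ioi]
      linarith [Real.sqrt_pos.2 h3]
    · rw [chartRadius, sub_add_cancel, Real.sq_sqrt h3.le,
        show x 0 ^ 2 + x 1 ^ 2 + (r ^ 2 - x 0 ^ 2 - x 1 ^ 2) = r ^ 2 by ring]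
      exact Real.sqrt_sq (by linarith)
  have hrestrict : ∫⁻ r, chartDensity f J ![x 0, x 1, r]
      = ∫⁻ r in chartRadius (x 0) (x 1) '' Set.Ioi (-2), chartDensity f J ![x 0, x 1, r] := by
    refine (setLIntegral_eq_of_support_subset fun r hr => himage r ?_).symm
    by_contra hcon
    rw [Function.mem_support, chartDensity, Set.indicator_of_notMem hcon] at hr
    exact hr rfl
  calc ∫⁻ r, chartDensity f J ![x 0, x 1, r]
      = ∫⁻ t in Set.Ioi (-2), ENNReal.ofReal ((t + 2) / chartRadius (x 0) (x 1) t)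
        * chartDensity f J ![x 0, x 1, chartRadius (x 0) (x 1) t] := by
        rw [hrestrict, lintegral_image_chartRadius]
    _ ≤ ∫⁻ t in Set.Ioi (-2), B (WithLp.toLp 2 ![x 0, x 1, t]) := by
        refine setLIntegral_mono' measurableSet_Ioi fun t ht => ?_
        refine le_trans ?_ (chartDensity_le (Set.mem_Ioi.1 ht))
        refine mul_le_of_le_one_left' ?_
        rw [← ENNReal.ofReal_one]
        refine ENNReal.ofReal_le_ofReal ?_
        rw [div_le_one (chartRadius_pos _ _ ht)]
        exact Real.le_sqrt_of_sq_le (by nlinarith [sq_nonneg (x 0), sq_nonneg (x 1)])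
    _ ≤ ∫⁻ t, B (WithLp.toLp 2 ![x 0, x 1, t]) := setLIntegral_le_lintegral _ _

/-- The anisotropic Sobolev inequality on one cone of directions. -/
lemma lintegral_verticalCone_le_rpow (hf : HasGradientMajorant f J) :
    ∫⁻ v in verticalCone, ENNReal.ofReal ((japaneseBracket v ^ 5)⁻¹ * f v ^ 3)
      ≤ 104976 * (110592 * ∫⁻ v, ENNReal.ofReal ((japaneseBracket v ^ 4)⁻¹)
        * sobolevDensity f J v) ^ (3 / 2 : ℝ) := by
  refine (lintegral_verticalCone_le hf).trans ?_
  gcongr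
  refine (lintegral_chartProduct_le hf).trans ?_
  gcongr
  rw [lintegral_const_mul _ (measurable_chartDensity hf)]
  calc 432 * ∫⁻ x, chartDensity f J x ≤ 432 * (256 * ∫⁻ v,
        ENNReal.ofReal ((japaneseBracket v ^ 4)⁻¹) * sobolevDensity f J v) := by
        gcongr
        exact lintegral_chartDensity_le hf
    _ = _ := by
        rw [← mul_assoc]
        norm_num

end ChartInequality

/-! ### The global anisotropic Sobolev inequality -/

lemma HasGradientMajorant.comp_isometry {f : Vel → ℝ} {J : Vel → ℝ≥0∞}
    (hf : HasGradientMajorant f J) (T : Vel ≃ₗᵢ[ℝ] Vel) :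
    HasGradientMajorant (fun v => f (T v)) (fun v => J (T v)) where
  differentiable := hf.differentiable.comp T.differentiable
  nonneg v := hf.nonneg _
  measurable := hf.measurable.comp T.continuous.measurable
  bound v α β hα hβ := by
    have hd : HasFDerivAt (fun v => f (T v))
        ((fderiv ℝ f (T v)).comp (T.toContinuousLinearEquiv : Vel →L[ℝ] Vel)) v :=
      (hf.differentiable (T v)).hasFDerivAt.comp v T.toContinuousLinearEquiv.hasFDerivAt
    have hL (γ : Vel) : fderiv ℝ (fun v => f (T v)) v γ = fderiv ℝ f (T v) (T γ) := by
      rw [hd.fderiv]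
      rfl
    have h := hf.bound (T v) (T α) (T β) (by simpa using hα) (by simpa using hβ)
    simp only [wedge, LinearIsometryEquiv.inner_map_map] at h
    simp only [wedge, hL]
    exact h

/-- The six isometries which permute the last coordinate with another one and possibly change
sign. -/
noncomputable def coneIsometry (i : Fin 3 × Bool) : Vel ≃ₗᵢ[ℝ] Vel :=
  (LinearIsometryEquiv.piLpCongrLeft 2 ℝ ℝ (Equiv.swap i.1 2)).trans
    (if i.2 then LinearIsometryEquiv.neg ℝ else LinearIsometryEquiv.refl ℝ Vel)

lemma iUnion_preimage_verticalCone :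
    ⋃ i : Fin 3 × Bool, coneIsometry i ⁻¹' verticalCone = Set.univ := by
  refine Set.eq_univ_of_forall fun v => Set.mem_iUnion.2 ?_
  obtain ⟨k, hk⟩ := Finite.exists_max fun i : Fin 3 => |v i|
  have hswap (j : Fin 3) :
      LinearIsometryEquiv.piLpCongrLeft 2 ℝ ℝ (Equiv.swap k 2) v j = v (Equiv.swap k 2 j) := by
    simp [LinearIsometryEquiv.piLpCongrLeft_apply, Equiv.piCongrLeft']
  rcases le_total 0 (v k) with h | h
  · refine ⟨(k, false), ?_⟩
    have e (j : Fin 3) : coneIsometry (k, false) v j = v (Equiv.swap k 2 j) := by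
      simp [coneIsometry, hswap]
    rw [abs_of_nonneg h] at hk
    refine ⟨?_, ?_⟩ <;>
    · rw [e, e, Equiv.swap_apply_right]
      exact hk _
  · refine ⟨(k, true), ?_⟩
    have e (j : Fin 3) : coneIsometry (k, true) v j = -v (Equiv.swap k 2 j) := by
      simp [coneIsometry, hswap]
    rw [abs_of_nonpos h] at hk
    refine ⟨?_, ?_⟩ <;>
    · rw [e, e, Equiv.swap_apply_right, abs_neg]
      exact hk _

lemma japaneseBracket_isometry (T : Vel ≃ₗᵢ[ℝ] Vel) (v : Vel) :
    japaneseBracket (T v) = japaneseBracket v := by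
  simp [japaneseBracket]

section Global

variable {f : Vel → ℝ} {J : Vel → ℝ≥0∞}

lemma lintegral_preimage_verticalCone_le (hf : HasGradientMajorant f J) (T : Vel ≃ₗᵢ[ℝ] Vel) :
    ∫⁻ v in T ⁻¹' verticalCone, ENNReal.ofReal ((japaneseBracket v ^ 5)⁻¹ * f v ^ 3)
      ≤ 104976 * (110592 * ∫⁻ v, ENNReal.ofReal ((japaneseBracket v ^ 4)⁻¹)
        * sobolevDensity f J v) ^ (3 / 2 : ℝ) := by
  have key := lintegral_verticalCone_le_rpow (hf.comp_isometry T.symm)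
  have hm1 : Measurable fun v => ENNReal.ofReal ((japaneseBracket v ^ 5)⁻¹ * f v ^ 3) := by
    have h1 := hf.differentiable.continuous.measurable
    have h2 := continuous_japaneseBracket.measurable
    fun_prop
  have hm2 : Measurable fun v => ENNReal.ofReal ((japaneseBracket v ^ 4)⁻¹)
      * sobolevDensity f J v := by
    have h1 := measurable_sobolevDensity hf
    have h2 := continuous_japaneseBracket.measurable
    fun_prop
  have e1 : ∫⁻ v in verticalCone, ENNReal.ofReal ((japaneseBracket v ^ 5)⁻¹ * f (T.symm v) ^ 3)
      = ∫⁻ v in T ⁻¹' verticalCone, ENNReal.ofReal ((japaneseBracket v ^ 5)⁻¹ * f v ^ 3) := by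
    have h := T.symm.measurePreserving.setLIntegral_comp_preimage
      (isClosed_verticalCone.measurableSet.preimage T.continuous.measurable) hm1
    rw [← h]
    have hset : T.symm ⁻¹' (T ⁻¹' verticalCone) = verticalCone := by
      ext v
      simp
    rw [hset]
    simp_rw [japaneseBracket_isometry]
  have e2 : ∫⁻ v, ENNReal.ofReal ((japaneseBracket v ^ 4)⁻¹)
        * sobolevDensity (fun v => f (T.symm v)) (fun v => J (T.symm v)) v
      = ∫⁻ v, ENNReal.ofReal ((japaneseBracket v ^ 4)⁻¹) * sobolevDensity f J v := by
    rw [← T.symm.measurePreserving.lintegral_comp hm2]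
    simp_rw [japaneseBracket_isometry]
    rfl
  rwa [e1, e2] at key

lemma lintegral_weightedCube_le (hf : HasGradientMajorant f J) :
    ∫⁻ v, ENNReal.ofReal ((japaneseBracket v ^ 5)⁻¹ * f v ^ 3)
      ≤ 629856 * (110592 * ∫⁻ v, ENNReal.ofReal ((japaneseBracket v ^ 4)⁻¹)
        * sobolevDensity f J v) ^ (3 / 2 : ℝ) := by
  rw [← setLIntegral_univ, ← iUnion_preimage_verticalCone]
  refine (lintegral_iUnion_le _ _).trans ?_
  rw [tsum_fintype]
  refine (Finset.sum_le_sum fun i _ =>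
    lintegral_preimage_verticalCone_le hf (coneIsometry i)).trans (le_of_eq ?_)
  rw [Finset.sum_const, Finset.card_univ, Fintype.card_prod, Fintype.card_fin, Fintype.card_bool,
    nsmul_eq_mul, ← mul_assoc]
  norm_num

/-- The weighted integral `∫ ⟨v⟩⁻³ (J + f)` of the gradient majorant and the function. -/
noncomputable def weightedEnergy (f : Vel → ℝ) (J : Vel → ℝ≥0∞) : ℝ≥0∞ :=
  ∫⁻ v, ENNReal.ofReal ((japaneseBracket v ^ 3)⁻¹) * (J v + ENNReal.ofReal (f v))

lemma sq_lintegral_sobolevDensity_le (hf : HasGradientMajorant f J) :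
    (∫⁻ v, ENNReal.ofReal ((japaneseBracket v ^ 4)⁻¹) * sobolevDensity f J v) ^ 2
      ≤ (∫⁻ v, ENNReal.ofReal ((japaneseBracket v ^ 5)⁻¹ * f v ^ 3)) * weightedEnergy f J := by
  have h1 := hf.differentiable.continuous.measurable
  have h2 := continuous_japaneseBracket.measurable
  have h3 := hf.measurable
  refine sq_lintegral_le_of_sq_le (by fun_prop) (by fun_prop) (Eventually.of_forall fun v => ?_)
  have hjp := japaneseBracket_pos v
  have hw : ENNReal.ofReal ((japaneseBracket v ^ 4)⁻¹) ^ 2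
      = ENNReal.ofReal ((japaneseBracket v ^ 5)⁻¹) * ENNReal.ofReal ((japaneseBracket v ^ 3)⁻¹) := by
    rw [← ENNReal.ofReal_pow (by positivity), ← ENNReal.ofReal_mul (by positivity)]
    congr 1
    field_simp
  have hd : sobolevDensity f J v ^ 2
      = ENNReal.ofReal (f v ^ 3) * (J v + ENNReal.ofReal (f v)) := by
    rw [sobolevDensity, mul_pow, ← ENNReal.rpow_natCast, ← ENNReal.rpow_natCast,
      ← ENNReal.rpow_mul, ← ENNReal.rpow_mul, ENNReal.ofReal_pow (hf.nonneg v),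
      ← ENNReal.rpow_natCast]
    norm_num
  rw [mul_pow, hw, hd, ENNReal.ofReal_mul (by positivity)]
  apply le_of_eq
  ring

/-- The global anisotropic Sobolev inequality. The a priori finiteness allows one to absorb a power
of the left-hand side. -/
theorem lintegral_weightedCube_le_weightedEnergy (hf : HasGradientMajorant f J)
    (hfin : ∫⁻ v, ENNReal.ofReal ((japaneseBracket v ^ 5)⁻¹ * f v ^ 3) ≠ ⊤) :
    ∫⁻ v, ENNReal.ofReal ((japaneseBracket v ^ 5)⁻¹ * f v ^ 3)
      ≤ 629856 ^ 4 * 110592 ^ 6 * weightedEnergy f J ^ 3 := by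
  have h1 := lintegral_weightedCube_le hf
  have h2 := sq_lintegral_sobolevDensity_le hf
  set N := ∫⁻ v, ENNReal.ofReal ((japaneseBracket v ^ 5)⁻¹ * f v ^ 3)
  set Q := ∫⁻ v, ENNReal.ofReal ((japaneseBracket v ^ 4)⁻¹) * sobolevDensity f J v
  set K := weightedEnergy f J
  rcases eq_or_ne N 0 with h0 | h0
  · rw [h0]
    exact zero_le
  have h3 : N ^ 4 ≤ 629856 ^ 4 * 110592 ^ 6 * K ^ 3 * N ^ 3 := by
    calc N ^ 4 ≤ (629856 * (110592 * Q) ^ (3 / 2 : ℝ)) ^ 4 := by gcongr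
      _ = 629856 ^ 4 * (110592 * Q) ^ 6 := by
          rw [mul_pow, ← ENNReal.rpow_natCast ((110592 * Q) ^ (3 / 2 : ℝ)), ← ENNReal.rpow_mul,
            ← ENNReal.rpow_natCast (110592 * Q) 6]
          norm_num
      _ = 629856 ^ 4 * 110592 ^ 6 * (Q ^ 2) ^ 3 := by ring
      _ ≤ 629856 ^ 4 * 110592 ^ 6 * (N * K) ^ 3 := by gcongr
      _ = _ := by ring
  refine (ENNReal.mul_le_mul_iff_left (pow_ne_zero 3 h0) (ENNReal.pow_ne_top hfin)).1 ?_
  calc N * N ^ 3 = N ^ 4 := by ring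
    _ ≤ _ := h3

end Global

/-! ### Mollification of the gradient bound -/

section Mollify

variable {f : Vel → ℝ} {G : Vel → Vel} {J : Vel → ℝ≥0∞}

/-- The gradient majorant of a mollified function. The factor `9` absorbs the effect of the averaging
on the bound for `v ∧ ∇f`. -/
noncomputable def mollifiedMajorant (ρ : ContDiffBump (0 : Vel)) (J : Vel → ℝ≥0∞) (v : Vel) :
    ℝ≥0∞ :=
  ∫⁻ u, ENNReal.ofReal (ρ.normed volume (v - u)) * (9 * J u)

lemma measurable_ofReal_normed_sub (ρ : ContDiffBump (0 : Vel)) :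
    Measurable fun p : Vel × Vel => ENNReal.ofReal (ρ.normed volume (p.1 - p.2)) :=
  (ρ.continuous_normed.comp (continuous_fst.sub continuous_snd)).measurable.ennreal_ofReal

lemma measurable_mollifiedMajorant (ρ : ContDiffBump (0 : Vel)) (hJ : Measurable J) :
    Measurable (mollifiedMajorant ρ J) := by
  have h1 := measurable_ofReal_normed_sub ρ
  have h2 : Measurable fun p : Vel × Vel => J p.2 := hJ.comp measurable_snd
  exact Measurable.lintegral_prod_right' (f := fun p : Vel × Vel =>
    ENNReal.ofReal (ρ.normed volume (p.1 - p.2)) * (9 * J p.2)) (h1.mul (h2.const_mul 9))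

lemma ofReal_mollify (ρ : ContDiffBump (0 : Vel)) (hf0 : ∀ v, 0 ≤ f v)
    (hf : Integrable f volume) (v : Vel) :
    ENNReal.ofReal (mollify ρ f v)
      = ∫⁻ u, ENNReal.ofReal (ρ.normed volume (v - u) * f u) :=
  ofReal_integral_eq_lintegral_ofReal (integrable_normed_mul ρ hf.locallyIntegrable v)
    (Eventually.of_forall fun u => mul_nonneg (ρ.nonneg_normed _) (hf0 u))

/-- Averaging preserves bounds of the form `l² ≤ f J`, by the Cauchy–Schwarz inequality. -/
lemma sq_mollify_le (ρ : ContDiffBump (0 : Vel)) (hρ : ρ.rOut ≤ 1) (hf0 : ∀ v, 0 ≤ f v)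
    (hf : Integrable f volume) (hJ : Measurable J) {l : Vel → ℝ} (v : Vel)
    (hl : ∀ᵐ u, ‖v - u‖ ≤ 1 →
      ENNReal.ofReal (l u ^ 2) ≤ ENNReal.ofReal (f u) * (9 * J u)) :
    ENNReal.ofReal (mollify ρ l v ^ 2)
      ≤ ENNReal.ofReal (mollify ρ f v) * mollifiedMajorant ρ J v := by
  have h1 : ENNReal.ofReal |mollify ρ l v|
      ≤ ∫⁻ u, ENNReal.ofReal |ρ.normed volume (v - u) * l u| := by
    have := enorm_integral_le_lintegral_enorm (μ := (volume : Measure Vel))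
      (fun u => ρ.normed volume (v - u) * l u)
    simpa only [Real.enorm_eq_ofReal_abs, mollify] using this
  have hm := (measurable_ofReal_normed_sub ρ).comp (measurable_prodMk_left (x := v))
  rw [← sq_abs, ENNReal.ofReal_pow (abs_nonneg _), ofReal_mollify ρ hf0 hf]
  refine (pow_le_pow_left' h1 2).trans (sq_lintegral_le_of_sq_le ?_ ?_ ?_)
  · exact (integrable_normed_mul ρ hf.locallyIntegrable v).aemeasurable.ennreal_ofReal
  · exact (Measurable.mul hm (hJ.const_mul 9)).aemeasurable
  · filter_upwards [hl] with u hu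
    have hρ0 : 0 ≤ ρ.normed volume (v - u) := ρ.nonneg_normed _
    by_cases hvu : ‖v - u‖ ≤ 1
    · have h2 := hu hvu
      rw [← ENNReal.ofReal_pow (abs_nonneg _), sq_abs, mul_pow, ENNReal.ofReal_mul (by positivity),
        ENNReal.ofReal_mul hρ0, ENNReal.ofReal_pow hρ0]
      calc ENNReal.ofReal (ρ.normed volume (v - u)) ^ 2 * ENNReal.ofReal (l u ^ 2)
          ≤ ENNReal.ofReal (ρ.normed volume (v - u)) ^ 2
            * (ENNReal.ofReal (f u) * (9 * J u)) := by gcongr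
        _ = _ := by ring
    · rw [normed_eq_zero ρ (hρ.trans (not_le.1 hvu).le)]
      simp

/-- The gradient bound survives mollification at scale at most one: moving `v` by at most one
changes `v ∧ ∇f` by at most `2 |∇f|`. -/
lemma hasGradientMajorant_mollify (h : IsWeakGradient f G) (ρ : ContDiffBump (0 : Vel))
    (hρ : ρ.rOut ≤ 1) (hf0 : ∀ v, 0 ≤ f v) (hf : Integrable f volume) (hJ : Measurable J)
    (hb : ∀ᵐ v, GradientBound (ENNReal.ofReal (f v)) v (fun e => ⟪G v, e⟫) (J v)) :
    HasGradientMajorant (mollify ρ f) (mollifiedMajorant ρ J) where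
  differentiable := (contDiff_mollify ρ hf.locallyIntegrable).differentiable (by simp)
  nonneg := mollify_nonneg ρ hf0
  measurable := measurable_mollifiedMajorant ρ hJ
  bound v α β hα hβ := by
    have hmono (s : ℝ≥0∞) (j : ℝ≥0∞) : s * j ≤ s * (9 * j) := by
      gcongr
      exact le_mul_of_one_le_left' (by norm_num)
    refine ⟨?_, ?_⟩
    · rw [h.fderiv_mollify]
      refine sq_mollify_le ρ hρ hf0 hf hJ v ?_
      filter_upwards [hb] with u hu _
      exact (hu α β hα hβ).1.trans (hmono _ _)
    · have hw : wedge v (fderiv ℝ (mollify ρ f) v) α β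
          = mollify ρ (fun u => wedge v (fun e => ⟪G u, e⟫) α β) v := by
        have i1 (γ : Vel) := integrable_normed_mul ρ (h.locallyIntegrable_inner γ) v
        simp only [wedge, h.fderiv_mollify]
        unfold mollify
        rw [← integral_const_mul, ← integral_const_mul,
          ← integral_sub ((i1 β).const_mul _) ((i1 α).const_mul _)]
        congr 1
        ext u
        ring
      rw [hw]
      refine sq_mollify_le ρ hρ hf0 hf hJ v ?_
      filter_upwards [hb] with u hu hvu
      have g1 := ofReal_abs_le_rpow (hu α β hα hβ).1
      have g2 := ofReal_abs_le_rpow (hu β α hβ hα).1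
      have g3 := ofReal_abs_le_rpow (hu α β hα hβ).2
      set S := (ENNReal.ofReal (f u) * J u) ^ (1 / 2 : ℝ) with hS
      have hS2 : S ^ 2 = ENNReal.ofReal (f u) * J u := by
        rw [hS, ← ENNReal.rpow_natCast, ← ENNReal.rpow_mul]
        norm_num
      have hγ (γ : Vel) (hγ : ‖γ‖ ≤ 1) : |⟪v - u, γ⟫| ≤ 1 :=
        (abs_real_inner_le_norm _ _).trans (mul_le_one₀ hvu (norm_nonneg _) hγ)
      have hle : |wedge v (fun e => ⟪G u, e⟫) α β|
          ≤ |wedge u (fun e => ⟪G u, e⟫) α β| + |⟪G u, β⟫| + |⟪G u, α⟫| := by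
        have e : wedge v (fun e => ⟪G u, e⟫) α β = wedge u (fun e => ⟪G u, e⟫) α β
            + ⟪v - u, α⟫ * ⟪G u, β⟫ - ⟪v - u, β⟫ * ⟪G u, α⟫ := by
          simp only [wedge, inner_sub_left]
          ring
        rw [e]
        refine (abs_sub _ _).trans (add_le_add ((abs_add_le _ _).trans
          (add_le_add le_rfl ?_)) ?_)
        · rw [abs_mul]
          exact mul_le_of_le_one_left (abs_nonneg _) (hγ α hα)
        · rw [abs_mul]
          exact mul_le_of_le_one_left (abs_nonneg _) (hγ β hβ)
      have h3 : ENNReal.ofReal |wedge v (fun e => ⟪G u, e⟫) α β| ≤ 3 * S := by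
        refine (ENNReal.ofReal_le_ofReal hle).trans ?_
        rw [ENNReal.ofReal_add (by positivity) (abs_nonneg _),
          ENNReal.ofReal_add (abs_nonneg _) (abs_nonneg _)]
        calc _ ≤ S + S + S := add_le_add (add_le_add g3 g1) g2
          _ = 3 * S := by ring
      rw [← sq_abs, ENNReal.ofReal_pow (abs_nonneg _)]
      calc _ ≤ (3 * S) ^ 2 := pow_le_pow_left' h3 2
        _ = 9 * S ^ 2 := by ring
        _ = _ := by rw [hS2]; ring

lemma lintegral_ofReal_normed_sub (ρ : ContDiffBump (0 : Vel)) (u : Vel) :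
    ∫⁻ v, ENNReal.ofReal (ρ.normed volume (v - u)) = 1 := by
  rw [lintegral_sub_right_eq_self (fun v : Vel => ENNReal.ofReal (ρ.normed volume v)) u,
    ← ofReal_integral_eq_lintegral_ofReal ρ.integrable_normed
      (Eventually.of_forall fun v => ρ.nonneg_normed v), ρ.integral_normed, ENNReal.ofReal_one]

lemma japaneseBracket_le_two_mul {u v : Vel} (h : ‖v - u‖ ≤ 1) :
    japaneseBracket u ≤ 2 * japaneseBracket v := by
  have hjp := japaneseBracket_pos v
  have h1 : ‖u‖ ≤ ‖v‖ + 1 := by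
    have := norm_sub_norm_le u v
    rw [norm_sub_rev] at this
    linarith
  refine le_of_sq_le_sq ?_ (by positivity)
  rw [mul_pow, sq_japaneseBracket, sq_japaneseBracket]
  nlinarith [norm_nonneg u, norm_nonneg v, sq_nonneg (‖v‖ - 1)]

lemma ofReal_inv_japaneseBracket_cube_le {u v : Vel} (h : ‖v - u‖ ≤ 1) :
    ENNReal.ofReal ((japaneseBracket v ^ 3)⁻¹) ≤ 8 * ENNReal.ofReal ((japaneseBracket u ^ 3)⁻¹) := by
  have hu := japaneseBracket_pos u
  have hv := japaneseBracket_pos v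
  have h1 : (japaneseBracket v ^ 3)⁻¹ ≤ 8 * (japaneseBracket u ^ 3)⁻¹ := by
    rw [← div_eq_mul_inv, le_div_iff₀ (by positivity), inv_mul_le_iff₀ (by positivity)]
    calc japaneseBracket u ^ 3 ≤ (2 * japaneseBracket v) ^ 3 :=
          pow_le_pow_left₀ hu.le (japaneseBracket_le_two_mul h) 3
      _ = _ := by ring
  rw [← ENNReal.ofReal_ofNat 8, ← ENNReal.ofReal_mul (by norm_num)]
  exact ENNReal.ofReal_le_ofReal h1

lemma lintegral_mul_mollifiedMajorant_le (ρ : ContDiffBump (0 : Vel)) (hρ : ρ.rOut ≤ 1)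
    (hJ : Measurable J) :
    ∫⁻ v, ENNReal.ofReal ((japaneseBracket v ^ 3)⁻¹) * mollifiedMajorant ρ J v
      ≤ 72 * ∫⁻ v, ENNReal.ofReal ((japaneseBracket v ^ 3)⁻¹) * J v := by
  set w : Vel → ℝ≥0∞ := fun v => ENNReal.ofReal ((japaneseBracket v ^ 3)⁻¹) with hw
  have hwm : Measurable w :=
    ((continuous_japaneseBracket.measurable.pow_const 3).inv).ennreal_ofReal
  have hww (u v : Vel) (h : ‖v - u‖ ≤ 1) : w v ≤ 8 * w u := ofReal_inv_japaneseBracket_cube_le h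
  have hρm := measurable_ofReal_normed_sub ρ
  set r : Vel × Vel → ℝ≥0∞ := fun p => ENNReal.ofReal (ρ.normed volume (p.1 - p.2)) with hr
  have hswap := lintegral_lintegral_swap (μ := (volume : Measure Vel))
    (ν := (volume : Measure Vel)) (f := fun v u => w v * (r (v, u) * (9 * J u)))
    ((hwm.comp measurable_fst).mul
      (hρm.mul ((hJ.comp measurable_snd).const_mul 9))).aemeasurable
  calc ∫⁻ v, w v * mollifiedMajorant ρ J v
      = ∫⁻ v, ∫⁻ u, w v * (r (v, u) * (9 * J u)) := by
        refine lintegral_congr fun v => ?_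
        have hm : Measurable fun u => r (v, u) * (9 * J u) :=
          (hρm.comp measurable_prodMk_left).mul (hJ.const_mul 9)
        rw [lintegral_const_mul _ hm]
        rfl
    _ = ∫⁻ u, ∫⁻ v, w v * (r (v, u) * (9 * J u)) := hswap
    _ ≤ ∫⁻ u, ∫⁻ v, r (v, u) * (72 * (w u * J u)) := by
        refine lintegral_mono fun u => lintegral_mono fun v => ?_
        by_cases hvu : ‖v - u‖ ≤ 1
        · calc w v * (r (v, u) * (9 * J u)) ≤ 8 * w u * (r (v, u) * (9 * J u)) :=
                mul_le_mul_left (hww u v hvu) _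
            _ = _ := by ring
        · have h0 : r (v, u) = 0 := by
            rw [hr]
            simp only
            rw [normed_eq_zero ρ (hρ.trans (not_le.1 hvu).le), ENNReal.ofReal_zero]
          rw [h0]
          simp
    _ = ∫⁻ u, 72 * (w u * J u) := by
        refine lintegral_congr fun u => ?_
        have hm : Measurable fun v => r (v, u) := hρm.comp measurable_prodMk_right
        rw [lintegral_mul_const _ hm]
        exact (congrArg (· * _) (lintegral_ofReal_normed_sub ρ u)).trans (one_mul _)
    _ = _ := lintegral_const_mul _ (hwm.mul hJ)

lemma lintegral_mul_mollify_le (ρ : ContDiffBump (0 : Vel)) (hf0 : ∀ v, 0 ≤ f v)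
    (hf : Integrable f volume) :
    ∫⁻ v, ENNReal.ofReal ((japaneseBracket v ^ 3)⁻¹) * ENNReal.ofReal (mollify ρ f v)
      ≤ ENNReal.ofReal (∫ v, f v) := by
  have h1 := ofReal_integral_eq_lintegral_ofReal (integrable_mollify ρ hf)
    (Eventually.of_forall (mollify_nonneg ρ hf0))
  rw [integral_mollify ρ hf] at h1
  rw [h1]
  refine lintegral_mono fun v => mul_le_of_le_one_left' ?_
  rw [← ENNReal.ofReal_one]
  refine ENNReal.ofReal_le_ofReal (inv_le_one_of_one_le₀ ?_)
  exact one_le_pow₀ (one_le_japaneseBracket v)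

lemma weightedEnergy_mollify_le (ρ : ContDiffBump (0 : Vel)) (hρ : ρ.rOut ≤ 1)
    (hf0 : ∀ v, 0 ≤ f v) (hf : Integrable f volume) (hJ : Measurable J) :
    weightedEnergy (mollify ρ f) (mollifiedMajorant ρ J)
      ≤ 72 * (∫⁻ v, ENNReal.ofReal ((japaneseBracket v ^ 3)⁻¹) * J v)
        + ENNReal.ofReal (∫ v, f v) := by
  have hwm : Measurable fun v : Vel => ENNReal.ofReal ((japaneseBracket v ^ 3)⁻¹) :=
    ((continuous_japaneseBracket.measurable.pow_const 3).inv).ennreal_ofReal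
  unfold weightedEnergy
  simp only [mul_add]
  have hm : Measurable fun v => ENNReal.ofReal ((japaneseBracket v ^ 3)⁻¹)
      * mollifiedMajorant ρ J v := hwm.mul (measurable_mollifiedMajorant ρ hJ)
  rw [lintegral_add_left hm]
  exact add_le_add (lintegral_mul_mollifiedMajorant_le ρ hρ hJ) (lintegral_mul_mollify_le ρ hf0 hf)

/-- A mollified integrable function is bounded and integrable, hence in `L³`. -/
lemma lintegral_weightedCube_mollify_ne_top (ρ : ContDiffBump (0 : Vel)) (hf0 : ∀ v, 0 ≤ f v)
    (hf : Integrable f volume) :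
    ∫⁻ v, ENNReal.ofReal ((japaneseBracket v ^ 5)⁻¹ * mollify ρ f v ^ 3) ≠ ⊤ := by
  obtain ⟨S, hS⟩ := (ρ.hasCompactSupport_normed (μ := volume)).exists_bound_of_continuous
    (ρ.continuous_normed (μ := volume))
  have hle (v : Vel) : mollify ρ f v ≤ S * ∫ u, f u := by
    rw [← integral_const_mul]
    refine integral_mono (integrable_normed_mul ρ hf.locallyIntegrable v) (hf.const_mul S)
      fun u => mul_le_mul_of_nonneg_right ((le_abs_self _).trans (hS _)) (hf0 u)
  have hfin : ∫⁻ v, ENNReal.ofReal ((S * ∫ u, f u) ^ 2 * mollify ρ f v) < ⊤ :=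
    ((integrable_mollify ρ hf).const_mul _).lintegral_lt_top
  refine (lt_of_le_of_lt (lintegral_mono fun v => ENNReal.ofReal_le_ofReal ?_) hfin).ne
  have h0 := mollify_nonneg ρ hf0 v
  have h1 : (japaneseBracket v ^ 5)⁻¹ ≤ 1 :=
    inv_le_one_of_one_le₀ (one_le_pow₀ (one_le_japaneseBracket v))
  calc (japaneseBracket v ^ 5)⁻¹ * mollify ρ f v ^ 3 ≤ 1 * mollify ρ f v ^ 3 := by gcongr
    _ = mollify ρ f v ^ 2 * mollify ρ f v := by ring
    _ ≤ _ := by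
        gcongr
        exact hle v

/-- The anisotropic Sobolev inequality for weakly differentiable functions. -/
theorem IsWeakGradient.lintegral_weightedCube_le (h : IsWeakGradient f G) (hf0 : ∀ v, 0 ≤ f v)
    (hf : Integrable f volume) (hJ : Measurable J)
    (hb : ∀ᵐ v, GradientBound (ENNReal.ofReal (f v)) v (fun e => ⟪G v, e⟫) (J v)) :
    ∫⁻ v, ENNReal.ofReal ((japaneseBracket v ^ 5)⁻¹ * f v ^ 3)
      ≤ 629856 ^ 4 * 110592 ^ 6
        * (72 * (∫⁻ v, ENNReal.ofReal ((japaneseBracket v ^ 3)⁻¹) * J v)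
          + ENNReal.ofReal (∫ v, f v)) ^ 3 := by
  set B := 629856 ^ 4 * 110592 ^ 6
        * (72 * (∫⁻ v, ENNReal.ofReal ((japaneseBracket v ^ 3)⁻¹) * J v)
          + ENNReal.ofReal (∫ v, f v)) ^ 3 with hB
  have hn (n : ℕ) : ∫⁻ v, ENNReal.ofReal ((japaneseBracket v ^ 5)⁻¹
      * mollify (shrinkingBump n) f v ^ 3) ≤ B := by
    refine (lintegral_weightedCube_le_weightedEnergy (hasGradientMajorant_mollify h
      (shrinkingBump n) (shrinkingBump_rOut_le n) hf0 hf hJ hb)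
      (lintegral_weightedCube_mollify_ne_top _ hf0 hf)).trans ?_
    rw [hB]
    gcongr
    exact weightedEnergy_mollify_le _ (shrinkingBump_rOut_le n) hf0 hf hJ
  calc ∫⁻ v, ENNReal.ofReal ((japaneseBracket v ^ 5)⁻¹ * f v ^ 3)
      = ∫⁻ v, liminf (fun n => ENNReal.ofReal ((japaneseBracket v ^ 5)⁻¹
        * mollify (shrinkingBump n) f v ^ 3)) atTop := by
        refine lintegral_congr_ae ?_
        filter_upwards [ae_tendsto_mollify hf.locallyIntegrable] with v hv
        exact (ENNReal.tendsto_ofReal ((hv.pow 3).const_mul _)).liminf_eq.symm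
    _ ≤ liminf (fun n => ∫⁻ v, ENNReal.ofReal ((japaneseBracket v ^ 5)⁻¹
        * mollify (shrinkingBump n) f v ^ 3)) atTop := by
        refine lintegral_liminf_le fun n => ?_
        have h1 := (contDiff_mollify (shrinkingBump n) hf.locallyIntegrable).continuous.measurable
        have h2 := continuous_japaneseBracket.measurable
        fun_prop
    _ ≤ B := liminf_le_of_le (by isBoundedDefault) fun b hbn => by
        obtain ⟨n, hn'⟩ := hbn.exists
        exact hn'.trans (hn n)

end Mollify

/-! ### The entropy dissipation estimate -/

lemma gradientBound_of_logGrad {f : Vel → ℝ} {G : Vel → Vel} {v : Vel} {C : ℝ} (hf0 : 0 ≤ f v)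
    (hG : f v = 0 → G v = 0) {Θ : ℝ≥0∞}
    (h : GradientBound (ENNReal.ofReal C) v (fun e => ⟪logGrad f G v, e⟫) Θ) :
    GradientBound (ENNReal.ofReal (f v)) v (fun e => ⟪G v, e⟫)
      (ENNReal.ofReal (f v) * (ENNReal.ofReal C * Θ)) := by
  have hGf : G v = f v • logGrad f G v := by
    by_cases hf : f v = 0
    · rw [hG hf, hf, zero_smul]
    · rw [logGrad, smul_smul, mul_inv_cancel₀ hf, one_smul]
  intro α β hα hβ
  obtain ⟨h1, h2⟩ := h α β hα hβ
  have hw : wedge v (fun e => ⟪G v, e⟫) α β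
      = f v * wedge v (fun e => ⟪logGrad f G v, e⟫) α β := by
    conv_lhs => rw [hGf]
    simp only [wedge, inner_smul_left, RCLike.conj_to_real]
    ring
  have hi : ⟪G v, β⟫ = f v * ⟪logGrad f G v, β⟫ := by
    conv_lhs => rw [hGf]
    simp only [inner_smul_left, RCLike.conj_to_real]
  have key (l : ℝ) (hl : ENNReal.ofReal (l ^ 2) ≤ ENNReal.ofReal C * Θ) :
      ENNReal.ofReal ((f v * l) ^ 2)
        ≤ ENNReal.ofReal (f v) * (ENNReal.ofReal (f v) * (ENNReal.ofReal C * Θ)) := by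
    rw [mul_pow, ENNReal.ofReal_mul (by positivity), ENNReal.ofReal_pow hf0, sq, mul_assoc]
    gcongr
  constructor
  · change ENNReal.ofReal (⟪G v, β⟫ ^ 2) ≤ _
    rw [hi]
    exact key _ h1
  · rw [hw]
    exact key _ h2

lemma lintegral_gradMajorant_le {m₀ M₀ E₀ H₀ : ℝ} {f : Vel → ℝ} {G : Vel → Vel}
    (hf : HydrodynamicBounds m₀ M₀ E₀ H₀ f) (hG : AEMeasurable G volume) :
    ∫⁻ v, ENNReal.ofReal ((japaneseBracket v ^ 3)⁻¹) * (ENNReal.ofReal (f v) * gradMajorant f G v)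
      ≤ ENNReal.ofReal M₀ + 2 * entropyDissipation f G := by
  have hfm : AEMeasurable f volume := hf.integrable_mass.aemeasurable
  have hdm := aemeasurable_dissipationAt hfm hG
  have hM : ∫⁻ v, ENNReal.ofReal (f v) ≤ ENNReal.ofReal M₀ := by
    rw [← ofReal_integral_eq_lintegral_ofReal hf.integrable_mass (Eventually.of_forall hf.nonneg)]
    exact ENNReal.ofReal_le_ofReal hf.mass_le
  have hD : 2 * entropyDissipation f G = ∫⁻ v, ENNReal.ofReal (f v) * dissipationAt f G v := by
    rw [entropyDissipation_eq hf.nonneg hfm hG, ← lintegral_const_mul'' _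
      (by fun_prop)]
    refine lintegral_congr fun v => ?_
    rw [ENNReal.ofReal_mul (by norm_num), ← mul_assoc, ← mul_assoc, ← ENNReal.ofReal_ofNat 2,
      ← ENNReal.ofReal_mul (by norm_num)]
    norm_num
  rw [hD]
  refine le_trans ?_ (add_le_add_left hM _)
  rw [← lintegral_add_left' (by fun_prop)]
  refine lintegral_mono fun v => ?_
  have hj := one_le_japaneseBracket v
  have hjp := japaneseBracket_pos v
  have e1 : ENNReal.ofReal ((japaneseBracket v ^ 3)⁻¹) * ENNReal.ofReal (japaneseBracket v ^ 2)
      ≤ 1 := by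
    rw [← ENNReal.ofReal_mul (by positivity), ← ENNReal.ofReal_one]
    refine ENNReal.ofReal_le_ofReal ?_
    rw [inv_mul_le_iff₀ (by positivity), mul_one]
    exact pow_le_pow_right₀ hj (by norm_num)
  have e2 : ENNReal.ofReal ((japaneseBracket v ^ 3)⁻¹) * ENNReal.ofReal (japaneseBracket v ^ 3)
      = 1 := by
    rw [← ENNReal.ofReal_mul (by positivity), inv_mul_cancel₀ (by positivity), ENNReal.ofReal_one]
  rw [gradMajorant]
  calc _ = ENNReal.ofReal (f v)
          * (ENNReal.ofReal ((japaneseBracket v ^ 3)⁻¹) * ENNReal.ofReal (japaneseBracket v ^ 2))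
        + ENNReal.ofReal (f v)
          * ((ENNReal.ofReal ((japaneseBracket v ^ 3)⁻¹) * ENNReal.ofReal (japaneseBracket v ^ 3))
            * dissipationAt f G v) := by ring
    _ ≤ ENNReal.ofReal (f v) * 1 + ENNReal.ofReal (f v) * (1 * dissipationAt f G v) := by
        rw [e2]
        gcongr
    _ = _ := by rw [mul_one, one_mul]

lemma weightedNorm_three_eq {f : Vel → ℝ} (hf0 : ∀ v, 0 ≤ f v) :
    weightedNorm 3 (5 / 3) f
      = (∫⁻ v, ENNReal.ofReal ((japaneseBracket v ^ 5)⁻¹ * f v ^ 3)) ^ (1 / 3 : ℝ) := by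
  unfold weightedNorm
  congr 1
  refine lintegral_congr fun v => ?_
  rw [abs_of_nonneg (hf0 v), show -(3 * (5 / 3) : ℝ) = -(5 : ℕ) by norm_num,
    Real.rpow_neg (japaneseBracket_pos v).le, Real.rpow_natCast, mul_comm]
  congr 2
  exact_mod_cast Real.rpow_natCast (f v) 3

/-- The estimate with an unspecified multiple of the mass as lower-order term. -/
theorem exists_weightedNorm_le (m₀ M₀ E₀ H₀ : ℝ) (hm₀ : 0 < m₀) :
    ∃ C : ℝ, 0 < C ∧ ∀ (f : Vel → ℝ) (G : Vel → Vel), HydrodynamicBounds m₀ M₀ E₀ H₀ f →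
      IsWeakGradient f G → weightedNorm 3 (5 / 3) f
        ≤ ENNReal.ofReal C * (ENNReal.ofReal M₀ + entropyDissipation f G) := by
  obtain ⟨C, hC, hbound⟩ := exists_gradientBound_logGrad m₀ M₀ E₀ H₀ hm₀
  set a : ℝ≥0∞ := (629856 ^ 4 * 110592 ^ 6) ^ (1 / 3 : ℝ) with ha
  have hatop : a ≠ ⊤ := ENNReal.rpow_ne_top_of_nonneg (by norm_num) (by norm_num)
  set A : ℝ≥0∞ := a * (144 * ENNReal.ofReal C + 1) with hA
  have hAtop : A ≠ ⊤ := by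
    refine ENNReal.mul_ne_top hatop (ENNReal.add_ne_top.2 ⟨?_, by norm_num⟩)
    exact ENNReal.mul_ne_top (by norm_num) ENNReal.ofReal_ne_top
  refine ⟨A.toReal + 1, by positivity, fun f G hf hG => ?_⟩
  have hGm : AEMeasurable G volume := hG.locallyIntegrable_grad.aestronglyMeasurable.aemeasurable
  have hfm : AEMeasurable f volume := hf.integrable_mass.aemeasurable
  have hjm := continuous_japaneseBracket.measurable
  have hdm := aemeasurable_dissipationAt hfm hGm
  have hΘm : AEMeasurable (gradMajorant f G) volume := by
    unfold gradMajorant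
    fun_prop
  have hJm : AEMeasurable (fun v => ENNReal.ofReal (f v)
      * (ENNReal.ofReal C * gradMajorant f G v)) volume := by fun_prop
  set D := entropyDissipation f G with hD
  set J := hJm.mk with hJ
  have hJeq := hJm.ae_eq_mk
  have hint : ∫⁻ v, ENNReal.ofReal ((japaneseBracket v ^ 3)⁻¹) * J v
      ≤ ENNReal.ofReal C * (ENNReal.ofReal M₀ + 2 * D) := by
    calc ∫⁻ v, ENNReal.ofReal ((japaneseBracket v ^ 3)⁻¹) * J v
        = ∫⁻ v, ENNReal.ofReal C * (ENNReal.ofReal ((japaneseBracket v ^ 3)⁻¹)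
          * (ENNReal.ofReal (f v) * gradMajorant f G v)) := by
          refine lintegral_congr_ae ?_
          filter_upwards [hJeq] with v hv
          rw [hJ, ← hv]
          ring
      _ = ENNReal.ofReal C * ∫⁻ v, ENNReal.ofReal ((japaneseBracket v ^ 3)⁻¹)
          * (ENNReal.ofReal (f v) * gradMajorant f G v) := by
          rw [lintegral_const_mul'' _ (by fun_prop)]
      _ ≤ _ := by
          gcongr
          exact lintegral_gradMajorant_le hf hGm
  have hb : ∀ᵐ v, GradientBound (ENNReal.ofReal (f v)) v (fun e => ⟪G v, e⟫) (J v) := by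
    filter_upwards [hJeq, hG.ae_eq_zero_of_eq_zero] with v hv hz
    rw [hJ, ← hv]
    exact gradientBound_of_logGrad (hf.nonneg v) hz (hbound f G hf hG v)
  have key := hG.lintegral_weightedCube_le hf.nonneg hf.integrable_mass hJm.measurable_mk hb
  rw [weightedNorm_three_eq hf.nonneg]
  have hcube (x : ℝ≥0∞) : (x ^ 3) ^ (1 / 3 : ℝ) = x := by
    rw [← ENNReal.rpow_natCast, ← ENNReal.rpow_mul]
    norm_num
  have hlin : 72 * (ENNReal.ofReal C * (ENNReal.ofReal M₀ + 2 * D))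
      ≤ 144 * ENNReal.ofReal C * (ENNReal.ofReal M₀ + D) := by
    calc 72 * (ENNReal.ofReal C * (ENNReal.ofReal M₀ + 2 * D))
        ≤ 72 * (ENNReal.ofReal C * (2 * ENNReal.ofReal M₀ + 2 * D)) :=
          mul_le_mul_right (mul_le_mul_right (add_le_add
            (le_mul_of_one_le_left' (by norm_num)) le_rfl) _) _
      _ = _ := by ring
  have hm : ENNReal.ofReal (∫ v, f v) ≤ ENNReal.ofReal M₀ := ENNReal.ofReal_le_ofReal hf.mass_le
  calc _ ≤ (629856 ^ 4 * 110592 ^ 6 * (72 * (ENNReal.ofReal C * (ENNReal.ofReal M₀ + 2 * D))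
          + ENNReal.ofReal M₀) ^ 3) ^ (1 / 3 : ℝ) := by
        refine ENNReal.rpow_le_rpow (key.trans ?_) (by norm_num)
        gcongr
    _ = a * (72 * (ENNReal.ofReal C * (ENNReal.ofReal M₀ + 2 * D)) + ENNReal.ofReal M₀) := by
        rw [ENNReal.mul_rpow_of_nonneg _ _ (by norm_num), hcube]
    _ ≤ a * (144 * ENNReal.ofReal C * (ENNReal.ofReal M₀ + D) + (ENNReal.ofReal M₀ + D)) :=
        mul_le_mul_right (add_le_add hlin le_self_add) a
    _ = A * (ENNReal.ofReal M₀ + D) := by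
        rw [hA]
        ring
    _ ≤ _ := by
        gcongr
        refine ENNReal.le_ofReal_iff_toReal_le hAtop (by positivity) |>.2 ?_
        linarith

theorem theorem1 (m₀ M₀ E₀ H₀ : ℝ) (hm₀ : 0 < m₀) :
    ∃ c₁ : ℝ, 0 < c₁ ∧ ∀ (f : Vel → ℝ) (G : Vel → Vel),
      HydrodynamicBounds m₀ M₀ E₀ H₀ f → IsWeakGradient f G →
        ENNReal.ofReal c₁ * weightedNorm 3 (5 / 3) f ≤
          entropyDissipation f G + ENNReal.ofReal (20 * M₀ ^ 2) := by
  obtain ⟨C, hC, hle⟩ := exists_weightedNorm_le m₀ M₀ E₀ H₀ hm₀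
  refine ⟨min 1 (20 * m₀) / C, by positivity, fun f G hf hG => ?_⟩
  have hm : m₀ ≤ M₀ := hf.le_mass.trans hf.mass_le
  -- since `m₀ ≤ M₀`, this choice gives `k * M₀ ≤ 20 * M₀ ^ 2`
  set k := min 1 (20 * m₀) with hk
  have hk0 : 0 < k := by positivity
  calc ENNReal.ofReal (k / C) * weightedNorm 3 (5 / 3) f
      ≤ ENNReal.ofReal (k / C)
        * (ENNReal.ofReal C * (ENNReal.ofReal M₀ + entropyDissipation f G)) := by
        gcongr
        exact hle f G hf hG
    _ = ENNReal.ofReal k * entropyDissipation f G + ENNReal.ofReal (k * M₀) := by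
        rw [← mul_assoc, ← ENNReal.ofReal_mul (by positivity), div_mul_cancel₀ _ hC.ne', mul_add,
          ← ENNReal.ofReal_mul hk0.le, add_comm]
    _ ≤ 1 * entropyDissipation f G + ENNReal.ofReal (20 * M₀ ^ 2) := by
        refine add_le_add (mul_le_mul_left ?_ _) (ENNReal.ofReal_le_ofReal ?_)
        · rw [← ENNReal.ofReal_one]
          exact ENNReal.ofReal_le_ofReal (min_le_left _ _)
        · calc k * M₀ ≤ 20 * M₀ * M₀ := mul_le_mul_of_nonneg_right
                ((min_le_right _ _).trans (by linarith)) (by linarith)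
            _ = 20 * M₀ ^ 2 := by ring
    _ = _ := by rw [one_mul]
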